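/- Let $p$ be an odd prime and let $M=\mathbb{Q}^*\cap\mathbb{Z}_{(p)}\hookrightarrow\mathbb{Z}_{(p)}$ be the canonical log structure. A ($p$-typical) Witt complex over a $\mathbb{Z}_{(p)}$-algebra $A$ consists of graded-commutative graded rings $E_n^*$ ($n\ge 0$, $*\ge 0$, $E_0^*=0$) with graded ring maps $R,F:E_{n+1}^*\to E_n^*$, graded additive maps $V:E_n^*\to E_{n+1}^*$ and $d:E_n^*\to E_n^{*+1}$, where $F,V,d$ commute with $R$, and ring maps $\lambda:W_n(A)\to E_n^0$ compatible with $R,F,V$, such that $d$ is a graded derivation with $dd=0$, $V(x)y=V(xF(y))$, $FV=p$, $FdV=d$, and $Fd\lambda([a]_{n+1})=\lambda([a]_n)^{p-1}d\lambda([a]_n)$ for $a\in A$. A Witt complex over a log ring $(A,\alpha:M\to A)$ is a Witt complex over $A$ together with a monoid $M_E$, maps of monoids $\alpha_n:M_E\to E_n^0$ (multiplicative) and $d\log:M_E\to E_n^1$ (to the additive group), compatible with $R$, with $\alpha_n(m)\,d\log m=d\alpha_n(m)$ and $d(d\log m)=0$, and a map of monoids $\lambda:M\to M_E$ with $\alpha_n(\lambda(a))=\lambda([\alpha(a)]_n)$;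 for $a\in M$ write $d\log[a]_n\in E_n^1$ for $d\log\lambda(a)$, and require $F(d\log[a]_{n+1})=d\log[a]_n$. Maps are maps of graded rings compatible with all the structure. The de Rham–Witt complexes $W_\bullet\Omega^*_A$ and $W_\bullet\Omega^*_{(A,M)}$ are the initial objects of the corresponding categories. Write $V^i(1)=V^i([1]_{n-i})$ at level $n$ (zero if $i\ge n$), and $dV^i(1)=d(V^i(1))$. **Theorem.** The complexes $W_\bullet\Omega^*_{\mathbb{Z}_{(p)}}$ and $W_\bullet\Omega^*_{(\mathbb{Z}_{(p)},M)}$ exist, and have the following structure, for all $n\ge 0$. (i) The canonical map $W_n\Omega^0_{\mathbb{Z}_{(p)}}\to W_n\Omega^0_{(\mathbb{Z}_{(p)},M)}$ is an isomorphism, and $\lambda$ identifies both with $W_n(\mathbb{Z}_{(p)})=\bigoplus_{i=0}^{n-1}\mathbb{Z}_{(p)}\cdot V^i(1)$. In degree one, $$W_n\Omega^1_{\mathbb{Z}_{(p)}}=\bigoplus_{i=1}^{n-1}\mathbb{Z}/p^i\mathbb{Z}\cdot dV^i(1),\qquad W_n\Omega^1_{(\mathbb{Z}_{(p)},M)}=W_n\Omega^1_{\mathbb{Z}_{(p)}}\oplus\mathbb{Z}/p^n\mathbb{Z}\cdot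 d\log[p]_n,$$ where $W_n\Omega^1_{\mathbb{Z}_{(p)}}$ is embedded by the canonical map. Both complexes vanish in degrees $\ge 2$. (ii) In $W_n\Omega^*_{(\mathbb{Z}_{(p)},M)}$: $V^i(1)V^j(1)=p^iV^j(1)$ for $i\le j$; $V^i(1)\,dV^j(1)=p^i\,dV^j(1)$ for $i<j$, and $V^i(1)\,dV^j(1)=0$ for $i\ge j$; and for $i\ge 1$ $$V^i(1)\,d\log[p]_n=\begin{cases}3^i\,d\log[3]_n+3^{i-1}\,dV^i(1)+3^i\,dV^{i+1}(1),&p=3,\\ p^i\,d\log[p]_n+p^{i-1}\,dV^i(1),&p\ge 5.\end{cases}$$ (iii) $FV^{i}(1)=pV^{i-1}(1)$ and $FdV^{i}(1)=dV^{i-1}(1)$ for $i\ge1$; $V(V^i(1))=V^{i+1}(1)$ and $V(dV^i(1))=p\,dV^{i+1}(1)$ for $i\ge0$; $F(d\log[p]_{n+1})=d\log[p]_n$; and $$V(d\log[p]_n)=\begin{cases}3\,d\log[3]_{n+1}+dV([1]_n)+3\,dV^2([1]_{n-1}),&p=3,\\ p\,d\log[p]_{n+1}+dV([1]_n),&p\ge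 5.\end{cases}$$ -/

import Mathlib

open CategoryTheory CategoryTheory.Limits

universe v u w

/-- A (`p`-typical, `p` an odd prime) Witt complex over a commutative ring `A` (in practice a
`ℤ_(p)`-algebra). The level is indexed by `n : ℕ`, the object of level `0` being zero.
At each level `n` there is a graded ring `obj n`, whose part of degree `q` is the subgroup
`gr n q`. The maps `R`, `F`, `V`, `d` are given on the whole graded rings and are homogeneous.
The ring of Witt vectors of length `n` is `TruncatedWittVector p n A`; its restriction, Frobenius
and Verschiebung maps are induced by those of `WittVector p A` through the surjections
`WittVector.truncate n`. -/
structure WittComplex (p : ℕ) [Fact p.Prime] (A : Type u) [CommRing A] : Type (max u (v + 1)) where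
  /-- the graded ring of level `n` -/
  obj : ℕ → Type v
  [ring : ∀ n, Ring (obj n)]
  /-- the homogeneous part of degree `q` -/
  gr : ∀ n : ℕ, ℕ → AddSubgroup (obj n)
  one_mem : ∀ n, 1 ∈ gr n 0
  mul_mem : ∀ n i j x y, x ∈ gr n i → y ∈ gr n j → x * y ∈ gr n (i + j)
  isInternal : ∀ n, DirectSum.IsInternal (gr n)
  graded_comm : ∀ n i j x y, x ∈ gr n i → y ∈ gr n j → x * y = (-1) ^ (i * j) * (y * x)
  level_zero : Subsingleton (obj 0)
  /-- restriction -/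
  R : ∀ n, obj (n + 1) →+* obj n
  R_mem : ∀ n q x, x ∈ gr (n + 1) q → R n x ∈ gr n q
  /-- the strict map of pro-rings from the Witt vectors of `A` -/
  lam : ∀ n, TruncatedWittVector p n A →+* obj n
  lam_mem : ∀ n x, lam n x ∈ gr n 0
  R_lam : ∀ n (x : WittVector p A),
    R n (lam (n + 1) (WittVector.truncate (n + 1) x)) = lam n (WittVector.truncate n x)
  /-- Frobenius -/
  F : ∀ n, obj (n + 1) →+* obj n
  F_mem : ∀ n q x, x ∈ gr (n + 1) q → F n x ∈ gr n q
  R_F : ∀ n x, R n (F (n + 1) x) = F n (R (n + 1) x)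
  F_lam : ∀ n (x : WittVector p A),
    F n (lam (n + 1) (WittVector.truncate (n + 1) x)) =
      lam n (WittVector.truncate n (WittVector.frobenius x))
  /-- Verschiebung -/
  V : ∀ n, obj n →+ obj (n + 1)
  V_mem : ∀ n q x, x ∈ gr n q → V n x ∈ gr (n + 1) q
  R_V : ∀ n x, R (n + 1) (V (n + 1) x) = V n (R n x)
  V_lam : ∀ n (x : WittVector p A),
    V n (lam n (WittVector.truncate n x)) =
      lam (n + 1) (WittVector.truncate (n + 1) (WittVector.verschiebung x))
  V_mul : ∀ n x y, V n x * y = V n (x * F n y)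
  F_V : ∀ n x, F n (V n x) = p • x
  /-- the differential -/
  d : ∀ n, obj n →+ obj n
  d_mem : ∀ n q x, x ∈ gr n q → d n x ∈ gr n (q + 1)
  R_d : ∀ n x, R n (d (n + 1) x) = d n (R n x)
  d_mul : ∀ n q x y, x ∈ gr n q → d n (x * y) = d n x * y + (-1) ^ q * (x * d n y)
  d_d : ∀ n x, d n (d n x) = 0
  F_d_V : ∀ n x, F n (d (n + 1) (V n x)) = d n x
  F_d_teichmuller : ∀ n (a : A),
    F n (d (n + 1) (lam (n + 1) (WittVector.truncate (n + 1) (WittVector.teichmuller p a)))) =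
      lam n (WittVector.truncate n (WittVector.teichmuller p a)) ^ (p - 1) *
        d n (lam n (WittVector.truncate n (WittVector.teichmuller p a)))

attribute [instance] WittComplex.ring

namespace WittComplex

variable {p : ℕ} [Fact p.Prime] {A : Type u} [CommRing A]

/-- A map of Witt complexes: a map of pro-graded rings compatible with `λ`, `d`, `F`, `V`. -/
@[ext]
structure Hom (D E : WittComplex.{v} p A) : Type v where
  map : ∀ n, D.obj n →+* E.obj n
  map_mem : ∀ n q x, x ∈ D.gr n q → map n x ∈ E.gr n q
  map_R : ∀ n x, map n (D.R n x) = E.R n (map (n + 1) x)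
  map_lam : ∀ n x, map n (D.lam n x) = E.lam n x
  map_d : ∀ n x, map n (D.d n x) = E.d n (map n x)
  map_F : ∀ n x, map n (D.F n x) = E.F n (map (n + 1) x)
  map_V : ∀ n x, map (n + 1) (D.V n x) = E.V n (map n x)

/-- The identity map. -/
def Hom.id (E : WittComplex.{v} p A) : Hom E E where
  map n := RingHom.id _
  map_mem _ _ _ h := h
  map_R _ _ := rfl
  map_lam _ _ := rfl
  map_d _ _ := rfl
  map_F _ _ := rfl
  map_V _ _ := rfl

/-- Composition of maps. -/
def Hom.comp {C D E : WittComplex.{v} p A} (f : Hom C D) (g : Hom D E) : Hom C E where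
  map n := (g.map n).comp (f.map n)
  map_mem n q x h := g.map_mem n q _ (f.map_mem n q x h)
  map_R n x := by simp [f.map_R, g.map_R]
  map_lam n x := by simp [f.map_lam, g.map_lam]
  map_d n x := by simp [f.map_d, g.map_d]
  map_F n x := by simp [f.map_F, g.map_F]
  map_V n x := by simp [f.map_V, g.map_V]

/-- The category of Witt complexes over `A`; its initial object is the de Rham-Witt complex
of `A`. -/
instance : Category (WittComplex.{v} p A) where
  Hom D E := Hom D E
  id E := Hom.id E
  comp f g := Hom.comp f g

/-- The element `V^i(1) = V^i([1]_{n-i})` of level `n` and degree `0`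
(for `i ≥ n` it comes from the zero ring of level `0`, so it is zero). -/
def vOne (E : WittComplex.{v} p A) : ∀ n : ℕ, ℕ → E.obj n
  | _, 0 => 1
  | 0, _ + 1 => 0
  | n + 1, i + 1 => E.V n (vOne E n i)

/-- The element `dV^i(1)` of level `n` and degree `1`. -/
def dvOne (E : WittComplex.{v} p A) (n i : ℕ) : E.obj n := E.d n (E.vOne n i)

end WittComplex

/-- A Witt complex over the log ring `(A, M)` given by the map of monoids `α : M →* A`: a Witt
complex over `A`, with a monoid `mon` and (compatible) pre-log structures `mon →* obj n` in degree
zero, making each level a log differential graded ring, together with an extension of `λ` to a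
strict map of pro-log rings from `(W_n(A), M)`, where `M` maps to `W_n(A)` by `a ↦ [α a]_n`. -/
structure LogWittComplex (p : ℕ) [Fact p.Prime] {A : Type u} [CommRing A] {M : Type w}
    [CommMonoid M] (α : M →* A) : Type (max u w (v + 1)) extends WittComplex.{v} p A where
  /-- the monoid of the pre-log structures -/
  mon : Type v
  [commMonoid : CommMonoid mon]
  /-- the pre-log structures -/
  pre : ∀ n, mon →* obj n
  pre_mem : ∀ n a, pre n a ∈ gr n 0
  R_pre : ∀ n a, R n (pre (n + 1) a) = pre n a
  /-- `λ` on the monoids -/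
  lamMon : M →* mon
  pre_lamMon : ∀ n a,
    pre n (lamMon a) = lam n (WittVector.truncate n (WittVector.teichmuller p (α a)))
  /-- the logarithmic derivation -/
  dlog : ∀ n, mon → obj n
  dlog_mem : ∀ n a, dlog n a ∈ gr n 1
  dlog_one : ∀ n, dlog n 1 = 0
  dlog_mul : ∀ n a b, dlog n (a * b) = dlog n a + dlog n b
  pre_mul_dlog : ∀ n a, pre n a * dlog n a = d n (pre n a)
  R_dlog : ∀ n a, R n (dlog (n + 1) a) = dlog n a
  d_dlog : ∀ n a, d n (dlog n a) = 0
  F_dlog : ∀ n (a : M), F n (dlog (n + 1) (lamMon a)) = dlog n (lamMon a)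

attribute [instance] LogWittComplex.commMonoid

namespace LogWittComplex

variable {p : ℕ} [Fact p.Prime] {A : Type u} [CommRing A] {M : Type w} [CommMonoid M] {α : M →* A}

/-- A map of Witt complexes over a log ring. -/
@[ext]
structure Hom (D E : LogWittComplex.{v} p α) : Type v extends
    WittComplex.Hom D.toWittComplex E.toWittComplex where
  mapMon : D.mon →* E.mon
  mapMon_lamMon : ∀ a, mapMon (D.lamMon a) = E.lamMon a
  map_pre : ∀ n a, map n (D.pre n a) = E.pre n (mapMon a)
  map_dlog : ∀ n a, map n (D.dlog n a) = E.dlog n (mapMon a)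

/-- The identity map. -/
def Hom.id (E : LogWittComplex.{v} p α) : Hom E E where
  toHom := WittComplex.Hom.id E.toWittComplex
  mapMon := MonoidHom.id _
  mapMon_lamMon _ := rfl
  map_pre _ _ := rfl
  map_dlog _ _ := rfl

/-- Composition of maps. -/
def Hom.comp {C D E : LogWittComplex.{v} p α} (f : Hom C D) (g : Hom D E) : Hom C E where
  toHom := WittComplex.Hom.comp f.toHom g.toHom
  mapMon := g.mapMon.comp f.mapMon
  mapMon_lamMon a := by simp [f.mapMon_lamMon, g.mapMon_lamMon]
  map_pre n a := by simp [WittComplex.Hom.comp, f.map_pre, g.map_pre]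
  map_dlog n a := by simp [WittComplex.Hom.comp, f.map_dlog, g.map_dlog]

/-- The category of Witt complexes over `(A, M)`; its initial object is the de Rham-Witt complex
of `(A, M)`. -/
instance : Category (LogWittComplex.{v} p α) where
  Hom D E := Hom D E
  id E := Hom.id E
  comp f g := Hom.comp f g

end LogWittComplex

/-- The prime ideal `(p)` of `ℤ`. -/
instance isPrime_span_prime (p : ℕ) [Fact p.Prime] : (Ideal.span {(p : ℤ)}).IsPrime :=
  (Ideal.span_singleton_prime (by exact_mod_cast (Fact.out : p.Prime).ne_zero)).2
    (Nat.prime_iff_prime_int.1 Fact.out)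

/-- The ring `ℤ_(p)`. -/
abbrev ZLoc (p : ℕ) [Fact p.Prime] : Type := Localization.AtPrime (Ideal.span {(p : ℤ)})

/-- The monoid `ℚ^* ∩ ℤ_(p)` of the nonzero elements of `ℤ_(p)`. -/
abbrev ZLocMonoid (p : ℕ) [Fact p.Prime] : Submonoid (ZLoc p) := nonZeroDivisors (ZLoc p)

/-- The canonical log structure `ℚ^* ∩ ℤ_(p) ↪ ℤ_(p)`. -/
abbrev canonicalLog (p : ℕ) [Fact p.Prime] : ZLocMonoid p →* ZLoc p := (ZLocMonoid p).subtype

theorem natCast_mem_ZLocMonoid (p : ℕ) [Fact p.Prime] : (p : ZLoc p) ∈ ZLocMonoid p := by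
  have h : (p : ℤ) ∈ nonZeroDivisors ℤ :=
    mem_nonZeroDivisors_of_ne_zero (by exact_mod_cast (Fact.out : p.Prime).ne_zero)
  have := IsLocalization.nonZeroDivisors_le_comap (Ideal.span {(p : ℤ)}).primeCompl (ZLoc p) h
  simpa using this

/-- The element `dlog [p]_n` of a Witt complex over `(ℤ_(p), ℚ^* ∩ ℤ_(p))`. -/
def LogWittComplex.dlogP {p : ℕ} [Fact p.Prime] (E : LogWittComplex.{v} p (canonicalLog p))
    (n : ℕ) : E.obj n :=
  E.dlog n (E.lamMon ⟨(p : ZLoc p), natCast_mem_ZLocMonoid p⟩)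

/-! In ghost coordinates `W_n(ℤ_(p))` is the ring `GhostRing p n` of sequences with `s (j+1) ≡ s j`
modulo `p^(j+1)`: Dwork's criterion with the identity as Frobenius lift. There `R` drops the last
entry, `F` drops the first, `V` puts `0` in front of `p s`, and `s = s 0 + ∑ c_j V^j(1)` with `c_j =
(s j - s (j-1)) / p^j` (`diffQuot`).

Upper bound: in every Witt complex `d` kills `ℤ_(p)`, `V d = p d V` in degree zero gives `p^j
dV^j(1) = 0`, an element `s` multiplies `dV^j(1)` by `s j` (`ofGhost_mul_dvOne`), the products
`dV^i(1) dV^j(1)` vanish, and `d s = ∑ c_j dV^j(1)` (`d_ofGhost`). So nothing is left to choose.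
Lower bound: these formulas on `∏_{j<n} ℤ/p^j` define a square-zero extension that satisfies all the
axioms. The one relation that is not formal, `F d[a] = [a]^(p-1) d[a]`, is a binomial estimate that
needs `p` odd (`dvd_diffQuot_teich`).

With the log structure there is one new generator, `dlog [p]`. Since `F` fixes it, `V(t) dlog [p] =
V(t dlog [p])`, so the action of `W_{n+1}` follows from that of `W_n` once `V(dlog [p]_n)` is known.
That value is forced by `[p] dlog [p] = d[p]`: writing `[p] = p + V(t)`, the last entry of `t` is
`-1` modulo `p^n`, and solving gives `V(dlog [p]) = p dlog [p] + dV(1) + p^(p-2) dV^2(1)`. The last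
term is zero for `p ≥ 5`, because `p^2` kills `dV^2(1)`, but not for `p = 3`; all exceptional terms
come from it. Torsion, action and `V` are obtained in one induction on the level
(`V_dlogP_of_lower`, `dlogP_structure`). For existence, `ℤ/p^n` is added to the previous model with
the action corrected by `logCoeff`, and `dlog (p^k u)` is `k dlog [p] + [u]⁻¹ d[u]`. -/

noncomputable section

/-! ### Arithmetic of `ℤ_(p)` -/

namespace ZLoc

variable {p : ℕ} [Fact p.Prime]

instance instIsDomain : IsDomain (ZLoc p) :=
  IsLocalization.isDomain_localization (Ideal.primeCompl_le_nonZeroDivisors _)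

theorem isUnit_intCast {m : ℤ} (hm : ¬ (p : ℤ) ∣ m) : IsUnit (m : ZLoc p) := by
  have h := IsLocalization.map_units (ZLoc p)
    (⟨m, fun h => hm (Ideal.mem_span_singleton.1 h)⟩ : (Ideal.span {(p : ℤ)}).primeCompl)
  simpa using h

theorem exists_mul_intCast_eq (a : ZLoc p) :
    ∃ k m : ℤ, ¬ (p : ℤ) ∣ m ∧ a * (m : ZLoc p) = k := by
  obtain ⟨⟨k, m⟩, h⟩ := IsLocalization.surj (Ideal.span {(p : ℤ)}).primeCompl a
  refine ⟨k, m, fun h => m.2 (Ideal.mem_span_singleton.2 h), ?_⟩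
  simpa using h

theorem natCast_p_ne_zero : (p : ZLoc p) ≠ 0 :=
  nonZeroDivisors.ne_zero (natCast_mem_ZLocMonoid p)

theorem pow_p_ne_zero (k : ℕ) : (p : ZLoc p) ^ k ≠ 0 := pow_ne_zero k natCast_p_ne_zero

/-- `ℤ → ℤ_(p)` is an epimorphism of rings. Compatibility of structure maps with scalars then needs
no computation. -/
theorem ringHom_ext {S : Type*} [Ring S] (f g : ZLoc p →+* S) : f = g := by
  refine IsLocalization.ringHom_ext (Ideal.span {(p : ℤ)}).primeCompl ?_
  exact RingHom.ext_int _ _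

theorem isUnit_zmod {m : ℤ} (hm : ¬ (p : ℤ) ∣ m) (k : ℕ) : IsUnit (m : ZMod (p ^ k)) := by
  rw [ZMod.coe_int_isUnit_iff_isCoprime]
  push_cast
  exact IsCoprime.pow_left
    ((Prime.coprime_iff_not_dvd (Nat.prime_iff_prime_int.1 (Fact.out : p.Prime))).2 hm)

/-- Reduction modulo `p ^ k`. -/
def red (p : ℕ) [Fact p.Prime] (k : ℕ) : ZLoc p →+* ZMod (p ^ k) :=
  IsLocalization.lift (M := (Ideal.span {(p : ℤ)}).primeCompl) (g := Int.castRingHom (ZMod (p ^ k)))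
    fun m => isUnit_zmod (fun h => m.2 (Ideal.mem_span_singleton.2 h)) k

theorem red_eq_zero_iff (k : ℕ) (a : ZLoc p) : red p k a = 0 ↔ (p : ZLoc p) ^ k ∣ a := by
  constructor
  · intro h
    obtain ⟨x, m, hm, e⟩ := exists_mul_intCast_eq a
    have h1 := congrArg (red p k) e
    rw [map_mul, h, zero_mul, map_intCast, eq_comm, ZMod.intCast_zmod_eq_zero_iff_dvd] at h1
    obtain ⟨y, rfl⟩ := h1
    refine (isUnit_intCast hm).dvd_mul_right.1 ⟨(y : ZLoc p), ?_⟩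
    rw [e]; push_cast; rfl
  · rintro ⟨b, rfl⟩
    have : ((p : ZMod (p ^ k)) ^ k) = 0 := by
      rw [← Nat.cast_pow, ZMod.natCast_self]
    rw [map_mul, map_pow, map_natCast, this, zero_mul]

theorem red_eq_iff (k : ℕ) (a b : ZLoc p) : red p k a = red p k b ↔ (p : ZLoc p) ^ k ∣ a - b := by
  rw [← red_eq_zero_iff, map_sub, sub_eq_zero]

theorem red_surjective (k : ℕ) : Function.Surjective (red p k) := ZMod.ringHom_surjective _

/-- The reduction `ℤ/p^(k+1) → ℤ/p^k`. -/
def trans (p k : ℕ) : ZMod (p ^ (k + 1)) →+* ZMod (p ^ k) :=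
  ZMod.castHom (pow_dvd_pow p k.le_succ) _

@[simp]
theorem trans_red (k : ℕ) (a : ZLoc p) : trans p k (red p (k + 1) a) = red p k a :=
  RingHom.congr_fun (ringHom_ext ((trans p k).comp (red p (k + 1))) (red p k)) a

/-- Multiplication by `p`, as a map `ℤ/p^k → ℤ/p^(k+1)`. -/
def mulP (p k : ℕ) : ZMod (p ^ k) →+ ZMod (p ^ (k + 1)) :=
  ZMod.lift (p ^ k) ⟨zmultiplesHom _ (p : ZMod (p ^ (k + 1))), by
    simp only [zmultiplesHom_apply]
    rw [natCast_zsmul, nsmul_eq_mul, ← Nat.cast_mul, ← pow_succ, ZMod.natCast_self]⟩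

@[simp]
theorem mulP_red (k : ℕ) (a : ZLoc p) : mulP p k (red p k a) = red p (k + 1) (p * a) := by
  obtain ⟨x, hx⟩ := ZMod.intCast_surjective (red p k a)
  have h1 : red p k a = red p k (x : ZLoc p) := by rw [← hx, map_intCast]
  rw [h1, map_intCast, mulP, ZMod.lift_coe]
  have h2 : red p (k + 1) (p * a) = red p (k + 1) (p * (x : ZLoc p)) := by
    rw [red_eq_iff] at h1 ⊢
    rw [← mul_sub, pow_succ']
    exact mul_dvd_mul_left _ h1
  rw [h2]
  simp [mul_comm]

theorem p_dvd_pow_sub_self (a : ZLoc p) : (p : ZLoc p) ∣ a ^ p - a := by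
  -- `red p 1` takes values in `ZMod (p ^ 1)`; a variable modulus lets it be identified with `p` by
  -- substitution, so that Fermat applies.
  have key : ∀ q, q = p → ∀ x : ZMod q, x ^ p = x := by
    rintro q rfl x
    exact ZMod.pow_card x
  have h := (red_eq_iff 1 (a ^ p) a).1 (by rw [map_pow]; exact key _ (pow_one p) _)
  rwa [pow_one] at h

/-- Each `p`-th power improves a congruence by one factor `p`, starting from `a^p ≡ a`. -/
theorem dvd_pow_sub_pow (a : ZLoc p) (k : ℕ) :
    (p : ZLoc p) ^ (k + 1) ∣ a ^ p ^ (k + 1) - a ^ p ^ k := by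
  have := dvd_sub_pow_of_dvd_sub (p_dvd_pow_sub_self a) k
  rwa [← pow_mul, ← pow_succ'] at this

end ZLoc

/-! ### Ghost coordinates of `W_n(ℤ_(p))` -/

namespace ZLoc

variable {p : ℕ} [Fact p.Prime]

/-- The ghost component of a sequence of Witt coordinates. -/
def ghostSum (x : ℕ → ZLoc p) (j : ℕ) : ZLoc p :=
  ∑ i ∈ Finset.range (j + 1), (p : ZLoc p) ^ i * x i ^ p ^ (j - i)

theorem ghostComponent_eq_ghostSum (w : WittVector p (ZLoc p)) (j : ℕ) :
    WittVector.ghostComponent j w = ghostSum w.coeff j := by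
  rw [WittVector.ghostComponent_apply, wittPolynomial_eq_sum_C_mul_X_pow, map_sum]
  simp [ghostSum]

/-- Passing from exponent `p^(j-i)` to `p^(j+1-i)` changes the power of `x i` by a multiple of
`p^(j-i+1)`; the coefficient `p^i` supplies the remaining factors. -/
theorem ghostSum_succ_congr (x : ℕ → ZLoc p) (j : ℕ) : (p : ZLoc p) ^ (j + 1) ∣
    (∑ i ∈ Finset.range (j + 1), (p : ZLoc p) ^ i * x i ^ p ^ (j + 1 - i)) - ghostSum x j := by
  rw [ghostSum, ← Finset.sum_sub_distrib]
  refine Finset.dvd_sum fun i hi => ?_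
  have hi' : i ≤ j := Nat.lt_succ_iff.1 (Finset.mem_range.1 hi)
  rw [← mul_sub, show j + 1 - i = (j - i) + 1 by omega, show j + 1 = i + ((j - i) + 1) by omega,
    pow_add]
  exact mul_dvd_mul_left _ (by simpa using dvd_pow_sub_pow (x i) (j - i))

theorem ghostSum_succ (x : ℕ → ZLoc p) (j : ℕ) : ghostSum x (j + 1) =
    (∑ i ∈ Finset.range (j + 1), (p : ZLoc p) ^ i * x i ^ p ^ (j + 1 - i)) +
      (p : ZLoc p) ^ (j + 1) * x (j + 1) := by
  rw [ghostSum, Finset.sum_range_succ]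
  simp

theorem dvd_ghostSum_succ_sub (x : ℕ → ZLoc p) (j : ℕ) :
    (p : ZLoc p) ^ (j + 1) ∣ ghostSum x (j + 1) - ghostSum x j := by
  rw [ghostSum_succ, add_sub_right_comm]
  exact dvd_add (ghostSum_succ_congr x j) (dvd_mul_right _ _)

theorem ghostSum_congr {x y : ℕ → ZLoc p} {j : ℕ} (h : ∀ i ≤ j, x i = y i) :
    ghostSum x j = ghostSum y j :=
  Finset.sum_congr rfl fun i hi => by rw [h i (Nat.lt_succ_iff.1 (Finset.mem_range.1 hi))]

/-- The ghost map is triangular, and the coefficient `p^j` of the new coordinate is not a zero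
divisor. -/
theorem eq_zero_of_ghostSum_eq_zero {x : ℕ → ZLoc p} {n : ℕ} (h : ∀ j < n, ghostSum x j = 0) :
    ∀ j < n, x j = 0 := by
  intro j
  induction j using Nat.strong_induction_on with
  | _ j ih =>
    intro hj
    have h1 := h j hj
    rw [ghostSum, Finset.sum_range_succ, Finset.sum_eq_zero, zero_add] at h1
    · simpa [natCast_p_ne_zero] using h1
    · intro i hi
      rw [ih i (Finset.mem_range.1 hi) ((Finset.mem_range.1 hi).trans hj), zero_pow, mul_zero]
      exact pow_ne_zero _ (Fact.out : p.Prime).ne_zero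

/-- The converse half of Dwork's criterion. The coordinate `x j` enters the `j`-th ghost component
only through `p^j x j`, so the congruence is exactly the solvability condition. -/
theorem exists_ghostSum_eq (s : ℕ → ZLoc p) (n : ℕ)
    (h : ∀ i, i + 1 < n → (p : ZLoc p) ^ (i + 1) ∣ s (i + 1) - s i) :
    ∃ x : ℕ → ZLoc p, ∀ j < n, ghostSum x j = s j := by
  induction n with
  | zero => exact ⟨0, by simp⟩
  | succ n ih =>
    obtain ⟨x, hx⟩ := ih fun i hi => h i (hi.trans n.lt_succ_self)
    have key : ∃ b, ghostSum (Function.update x n b) n = s n := by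
      cases n with
      | zero => exact ⟨s 0, by simp [ghostSum]⟩
      | succ n =>
        obtain ⟨c, hc⟩ := h n (by omega)
        obtain ⟨e, he⟩ := ghostSum_succ_congr x n
        refine ⟨c - e, ?_⟩
        have h2 : ∑ i ∈ Finset.range (n + 1),
            (p : ZLoc p) ^ i * Function.update x (n + 1) (c - e) i ^ p ^ (n + 1 - i) =
            ∑ i ∈ Finset.range (n + 1), (p : ZLoc p) ^ i * x i ^ p ^ (n + 1 - i) :=
          Finset.sum_congr rfl fun i hi => by
            rw [Function.update_of_ne (Finset.mem_range.1 hi).ne]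
        rw [ghostSum_succ, h2, Function.update_self]
        have h3 := hx n (by omega)
        linear_combination he - hc + h3
    obtain ⟨b, hb⟩ := key
    refine ⟨Function.update x n b, fun j hj => ?_⟩
    rcases Nat.lt_succ_iff_lt_or_eq.1 hj with hj | rfl
    · rw [← hx j hj]
      exact ghostSum_congr fun i hi => Function.update_of_ne (by omega) _ _
    · exact hb

end ZLoc

/-- The ring of sequences `s` of length `n` in `ℤ_(p)` with `s (i + 1) ≡ s i` modulo `p ^ (i + 1)`:
the image of the ghost map on Witt vectors of length `n`. -/
def GhostRing (p : ℕ) [Fact p.Prime] (n : ℕ) : Subring (Fin n → ZLoc p) where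
  carrier := {s | ∀ i (h : i + 1 < n),
    (p : ZLoc p) ^ (i + 1) ∣ s ⟨i + 1, h⟩ - s ⟨i, i.lt_succ_self.trans h⟩}
  mul_mem' {s t} hs ht i h := by
    have e : (s * t) ⟨i + 1, h⟩ - (s * t) ⟨i, i.lt_succ_self.trans h⟩ =
      s ⟨i + 1, h⟩ * (t ⟨i + 1, h⟩ - t ⟨i, i.lt_succ_self.trans h⟩) +
      t ⟨i, i.lt_succ_self.trans h⟩ * (s ⟨i + 1, h⟩ - s ⟨i, i.lt_succ_self.trans h⟩) := by
      simp only [Pi.mul_apply]; ring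
    rw [e]
    exact dvd_add (Dvd.dvd.mul_left (ht i h) _) (Dvd.dvd.mul_left (hs i h) _)
  one_mem' i h := by simp
  add_mem' {s t} hs ht i h := by
    have e : (s + t) ⟨i + 1, h⟩ - (s + t) ⟨i, i.lt_succ_self.trans h⟩ =
      (s ⟨i + 1, h⟩ - s ⟨i, i.lt_succ_self.trans h⟩) +
      (t ⟨i + 1, h⟩ - t ⟨i, i.lt_succ_self.trans h⟩) := by
      simp only [Pi.add_apply]; ring
    rw [e]
    exact dvd_add (hs i h) (ht i h)
  zero_mem' i h := by simp
  neg_mem' {s} hs i h := by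
    have e : (-s) ⟨i + 1, h⟩ - (-s) ⟨i, i.lt_succ_self.trans h⟩ =
      -(s ⟨i + 1, h⟩ - s ⟨i, i.lt_succ_self.trans h⟩) := by
      simp only [Pi.neg_apply]; ring
    rw [e]
    exact (hs i h).neg_right

namespace GhostRing

open ZLoc

variable {p : ℕ} [Fact p.Prime] {n : ℕ}

theorem ext {s t : GhostRing p n} (h : ∀ j, s.1 j = t.1 j) : s = t := Subtype.ext (funext h)

/-- The ghost map on Witt vectors, truncated. -/
def ghost (p : ℕ) [Fact p.Prime] (n : ℕ) : WittVector p (ZLoc p) →+* GhostRing p n :=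
  (RingHom.pi fun j : Fin n => WittVector.ghostComponent (p := p) (R := ZLoc p) j.1).codRestrict _
    fun w i h => by
      change _ ∣ WittVector.ghostComponent (i + 1) w - WittVector.ghostComponent i w
      rw [ghostComponent_eq_ghostSum, ghostComponent_eq_ghostSum]
      exact dvd_ghostSum_succ_sub _ _

theorem ghost_val (w : WittVector p (ZLoc p)) (j : Fin n) :
    (ghost p n w).1 j = WittVector.ghostComponent j.1 w := rfl

theorem ghost_eq_zero_iff (w : WittVector p (ZLoc p)) :
    ghost p n w = 0 ↔ WittVector.truncate n w = 0 := by
  rw [← RingHom.mem_ker (f := WittVector.truncate n), WittVector.mem_ker_truncate]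
  constructor
  · intro h
    refine eq_zero_of_ghostSum_eq_zero fun j hj => ?_
    rw [← ghostComponent_eq_ghostSum]
    exact congrFun (congrArg Subtype.val h) ⟨j, hj⟩
  · intro h
    refine ext fun j => ?_
    rw [ghost_val, ghostComponent_eq_ghostSum, ghostSum]
    refine Finset.sum_eq_zero fun i hi => ?_
    rw [h i ((Nat.lt_succ_iff.1 (Finset.mem_range.1 hi)).trans_lt j.2), zero_pow, mul_zero]
    exact pow_ne_zero _ (Fact.out : p.Prime).ne_zero

theorem ghost_surjective : Function.Surjective (ghost p n) := by
  intro s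
  obtain ⟨x, hx⟩ := exists_ghostSum_eq (fun j => if h : j < n then s.1 ⟨j, h⟩ else 0) n
    fun i hi => by
      rw [dif_pos hi, dif_pos (i.lt_succ_self.trans hi)]
      exact s.2 i hi
  refine ⟨WittVector.mk p x, ext fun j => ?_⟩
  rw [ghost_val, ghostComponent_eq_ghostSum]
  exact (hx j.1 j.2).trans (dif_pos j.2)

/-- The ghost map on `W_n(ℤ_(p))`, as a map of rings. -/
def ghostTrunc (p : ℕ) [Fact p.Prime] (n : ℕ) :
    TruncatedWittVector p n (ZLoc p) →+* GhostRing p n :=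
  RingHom.liftOfRightInverse (WittVector.truncate n) TruncatedWittVector.out
    TruncatedWittVector.truncateFun_out
    ⟨ghost p n, fun w hw => (ghost_eq_zero_iff w).2 hw⟩

theorem ghostTrunc_truncate (w : WittVector p (ZLoc p)) :
    ghostTrunc p n (WittVector.truncate n w) = ghost p n w :=
  RingHom.liftOfRightInverse_comp_apply _ _ _ _ _

/-- `W_n(ℤ_(p))` is isomorphic to its image under the ghost map. -/
def equiv (p : ℕ) [Fact p.Prime] (n : ℕ) : TruncatedWittVector p n (ZLoc p) ≃+* GhostRing p n :=
  RingEquiv.ofBijective (ghostTrunc p n) <| by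
    constructor
    · rw [injective_iff_map_eq_zero]
      intro x hx
      obtain ⟨w, rfl⟩ := WittVector.truncate_surjective p n (ZLoc p) x
      rwa [ghostTrunc_truncate, ghost_eq_zero_iff] at hx
    · intro s
      obtain ⟨w, rfl⟩ := ghost_surjective s
      exact ⟨_, ghostTrunc_truncate w⟩

theorem equiv_truncate (w : WittVector p (ZLoc p)) :
    equiv p n (WittVector.truncate n w) = ghost p n w := ghostTrunc_truncate w

theorem equiv_symm_ghost (w : WittVector p (ZLoc p)) :
    (equiv p n).symm (ghost p n w) = WittVector.truncate n w := by
  rw [RingEquiv.symm_apply_eq, equiv_truncate]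

end GhostRing

/-! ### Restriction, Frobenius and Verschiebung in ghost coordinates -/

namespace GhostRing

open ZLoc

variable {p : ℕ} [Fact p.Prime] {n : ℕ}

/-- Restriction in ghost coordinates. -/
def res (p : ℕ) [Fact p.Prime] (n : ℕ) : GhostRing p (n + 1) →+* GhostRing p n :=
  ((RingHom.pi fun j : Fin n => Pi.evalRingHom (fun _ : Fin (n + 1) => ZLoc p) j.castSucc).comp
    (GhostRing p (n + 1)).subtype).codRestrict _ fun s i h => s.2 i (h.trans n.lt_succ_self)

/-- Frobenius in ghost coordinates. -/
def frob (p : ℕ) [Fact p.Prime] (n : ℕ) : GhostRing p (n + 1) →+* GhostRing p n :=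
  ((RingHom.pi fun j : Fin n => Pi.evalRingHom (fun _ : Fin (n + 1) => ZLoc p) j.succ).comp
    (GhostRing p (n + 1)).subtype).codRestrict _ fun s i h =>
      (pow_dvd_pow _ (i + 1).le_succ).trans (s.2 (i + 1) (Nat.succ_lt_succ h))

/-- Verschiebung in ghost coordinates. -/
def ver (p : ℕ) [Fact p.Prime] (n : ℕ) : GhostRing p n →+ GhostRing p (n + 1) where
  toFun s := ⟨Fin.cases 0 fun j => p * s.1 j, fun i h => by
    cases i with
    | zero => exact ⟨s.1 ⟨0, Nat.lt_of_succ_lt_succ h⟩, by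
        change p * s.1 ⟨0, Nat.lt_of_succ_lt_succ h⟩ - 0 = _; ring⟩
    | succ i =>
      have h' := Nat.lt_of_succ_lt_succ h
      change _ ∣ p * s.1 ⟨i + 1, h'⟩ - p * s.1 ⟨i, i.lt_succ_self.trans h'⟩
      rw [← mul_sub, pow_succ']
      exact mul_dvd_mul_left _ (s.2 i h')⟩
  map_zero' := ext fun j => by
    cases j using Fin.cases with
    | zero => rfl
    | succ j => exact mul_zero _
  map_add' s t := ext fun j => by
    cases j using Fin.cases with
    | zero => exact (add_zero _).symm
    | succ j => exact mul_add _ _ _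

theorem res_val (s : GhostRing p (n + 1)) (j : Fin n) : (res p n s).1 j = s.1 j.castSucc := rfl
theorem frob_val (s : GhostRing p (n + 1)) (j : Fin n) : (frob p n s).1 j = s.1 j.succ := rfl
theorem ver_zero (s : GhostRing p n) : (ver p n s).1 0 = 0 := rfl
theorem ver_succ (s : GhostRing p n) (j : Fin n) : (ver p n s).1 j.succ = p * s.1 j := rfl
theorem mul_val (s t : GhostRing p n) (j : Fin n) : (s * t).1 j = s.1 j * t.1 j := rfl
theorem add_val (s t : GhostRing p n) (j : Fin n) : (s + t).1 j = s.1 j + t.1 j := rfl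

theorem res_ver (s : GhostRing p (n + 1)) :
    res p (n + 1) (ver p (n + 1) s) = ver p n (res p n s) := ext fun j => by
  cases j using Fin.cases <;> rfl

theorem ver_mul (s : GhostRing p n) (t : GhostRing p (n + 1)) :
    ver p n s * t = ver p n (s * frob p n t) := ext fun j => by
  cases j using Fin.cases with
  | zero => exact zero_mul _
  | succ j => exact mul_assoc _ _ _

theorem frob_ver (s : GhostRing p n) : frob p n (ver p n s) = p • s := ext fun j => by
  change (p : ZLoc p) * s.1 j = p • s.1 j
  rw [nsmul_eq_mul]

/-- The constant sequences: the structure of `ℤ_(p)`-algebra. -/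
def const (p : ℕ) [Fact p.Prime] (n : ℕ) : ZLoc p →+* GhostRing p n :=
  (RingHom.pi fun _ : Fin n => RingHom.id (ZLoc p)).codRestrict _ fun s i h => by
    change _ ∣ s - s
    simp

theorem const_val (a : ZLoc p) (j : Fin n) : (const p n a).1 j = a := rfl
theorem frob_const (a : ZLoc p) : frob p n (const p (n + 1) a) = const p n a := rfl

/-- The Teichmüller representatives in ghost coordinates. -/
def teich (p : ℕ) [Fact p.Prime] (n : ℕ) : ZLoc p →* GhostRing p n where
  toFun a := ⟨fun j => a ^ p ^ j.1, fun i _ => dvd_pow_sub_pow a i⟩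
  map_one' := ext fun _ => one_pow _
  map_mul' _ _ := ext fun _ => mul_pow _ _ _

theorem res_teich (a : ZLoc p) : res p n (teich p (n + 1) a) = teich p n a := rfl

theorem frob_teich (a : ZLoc p) : frob p n (teich p (n + 1) a) = teich p n a ^ p :=
  ext fun j => by
    change a ^ p ^ (j.1 + 1) = (a ^ p ^ j.1) ^ p
    rw [pow_succ, pow_mul]

theorem ghost_teichmuller (a : ZLoc p) :
    ghost p n (WittVector.teichmuller p a) = teich p n a :=
  ext fun _ => WittVector.ghostComponent_teichmuller _ _ _

theorem ghost_frobenius (w : WittVector p (ZLoc p)) :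
    ghost p n (WittVector.frobenius w) = frob p n (ghost p (n + 1) w) :=
  ext fun _ => WittVector.ghostComponent_frobenius _ _

theorem ghost_verschiebung (w : WittVector p (ZLoc p)) :
    ghost p (n + 1) (WittVector.verschiebung w) = ver p n (ghost p n w) :=
  ext fun j => by
    cases j using Fin.cases with
    | zero => exact WittVector.ghostComponent_zero_verschiebung w
    | succ j => exact WittVector.ghostComponent_verschiebung w j.1

theorem res_ghost (w : WittVector p (ZLoc p)) : res p n (ghost p (n + 1) w) = ghost p n w := rfl

/-- The elements `V^i(1)`. -/
def vOne (p : ℕ) [Fact p.Prime] : ∀ n : ℕ, ℕ → GhostRing p n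
  | _, 0 => 1
  | 0, _ + 1 => 0
  | n + 1, i + 1 => ver p n (vOne p n i)

theorem p_dvd_sub_zero (s : GhostRing p (n + 1)) (j : Fin (n + 1)) :
    (p : ZLoc p) ∣ s.1 j - s.1 0 := by
  obtain ⟨j, hj⟩ := j
  induction j with
  | zero => exact ⟨0, by rw [mul_zero]; exact sub_self _⟩
  | succ j ih =>
    have h := dvd_add ((dvd_pow_self (p : ZLoc p) j.succ_ne_zero).trans (s.2 j hj)) (ih (by omega))
    rwa [sub_add_sub_cancel] at h

/-- All entries agree with `s 0` modulo `p`, and division by `p` lowers each congruence by one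
power, which is the index shift of `ver`. This splitting drives the inductions on the level. -/
theorem exists_eq_const_add_ver (s : GhostRing p (n + 1)) :
    ∃ t : GhostRing p n, s = const p (n + 1) (s.1 0) + ver p n t := by
  choose t ht using p_dvd_sub_zero s
  refine ⟨⟨fun j => t j.succ, fun i h => ?_⟩, ext fun j => ?_⟩
  · rw [← mul_dvd_mul_iff_left (natCast_p_ne_zero (p := p)), mul_sub, ← ht, ← ht,
      sub_sub_sub_cancel_right, ← pow_succ']
    exact s.2 (i + 1) (Nat.succ_lt_succ h)
  · cases j using Fin.cases with
    | zero => exact (add_zero _).symm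
    | succ j =>
      rw [add_val, const_val, ver_succ]
      exact (add_sub_cancel _ _).symm.trans (congrArg _ (ht j.succ))

theorem const_mul_ver (a : ZLoc p) (s : GhostRing p n) :
    const p (n + 1) a * ver p n s = ver p n (const p n a * s) := by
  rw [mul_comm, ver_mul, frob_const, mul_comm]

theorem ver_injective : Function.Injective (ver p n) := fun _ _ h => ext fun j =>
  mul_left_cancel₀ (natCast_p_ne_zero (p := p)) (congrFun (congrArg Subtype.val h) j.succ)

theorem sum_vOne_succ (c : Fin (n + 1) → ZLoc p) :
    ∑ i, const p (n + 1) (c i) * vOne p (n + 1) i =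
      const p (n + 1) (c 0) + ver p n (∑ i : Fin n, const p n (c i.succ) * vOne p n i) := by
  rw [Fin.sum_univ_succ, map_sum]
  congr 1
  · exact mul_one _
  · exact Finset.sum_congr rfl fun i _ => const_mul_ver _ _

theorem existsUnique_sum_vOne (s : GhostRing p n) :
    ∃! c : Fin n → ZLoc p, s = ∑ i, const p n (c i) * vOne p n i := by
  induction n with
  | zero => exact ⟨fun _ => 0, ext fun j => j.elim0, fun c _ => funext fun j => j.elim0⟩
  | succ n ih =>
    obtain ⟨t, ht⟩ := exists_eq_const_add_ver s
    obtain ⟨c, hc, hu⟩ := ih t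
    refine ⟨Fin.cons (s.1 0) c, ?_, fun c' hc' => ?_⟩
    · simp only [sum_vOne_succ, Fin.cons_zero, Fin.cons_succ]
      rw [← hc, ← ht]
    · change s = _ at hc'
      rw [sum_vOne_succ] at hc'
      have h0 : s.1 0 = c' 0 := by
        conv_lhs => rw [hc']
        rw [add_val, const_val, ver_zero, add_zero]
      rw [← h0] at hc'
      have h1 : t = ∑ i : Fin n, const p n (c' i.succ) * vOne p n i :=
        ver_injective (add_left_cancel (ht.symm.trans hc'))
      rw [← hu _ h1, h0]
      exact (Fin.cons_self_tail c').symm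

/-! ### Difference quotients: the components of `d` -/

/-- The quotients `(s j - s (j - 1)) / p ^ j`. -/
def diffQuot (s : GhostRing p n) : Fin n → ZLoc p
  | ⟨0, _⟩ => 0
  | ⟨i + 1, h⟩ => (s.2 i h).choose

theorem diffQuot_zero (s : GhostRing p n) (h : 0 < n) : diffQuot s ⟨0, h⟩ = 0 := rfl

theorem diffQuot_spec (s : GhostRing p n) (i : ℕ) (h : i + 1 < n) :
    (p : ZLoc p) ^ (i + 1) * diffQuot s ⟨i + 1, h⟩ =
      s.1 ⟨i + 1, h⟩ - s.1 ⟨i, i.lt_succ_self.trans h⟩ :=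
  (s.2 i h).choose_spec.symm

theorem diffQuot_eq {s : GhostRing p n} {i : ℕ} {h : i + 1 < n} {c : ZLoc p}
    (hc : (p : ZLoc p) ^ (i + 1) * c = s.1 ⟨i + 1, h⟩ - s.1 ⟨i, i.lt_succ_self.trans h⟩) :
    diffQuot s ⟨i + 1, h⟩ = c :=
  mul_left_cancel₀ (pow_p_ne_zero _) ((diffQuot_spec s i h).trans hc.symm)

theorem diffQuot_add (s t : GhostRing p n) (j : Fin n) :
    diffQuot (s + t) j = diffQuot s j + diffQuot t j := by
  obtain ⟨_ | i, h⟩ := j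
  · exact (add_zero _).symm
  · refine diffQuot_eq ?_
    rw [mul_add, diffQuot_spec, diffQuot_spec, add_val, add_val]
    ring

/-- A twisted Leibniz rule: `t` is evaluated at `i` instead of `i + 1`. The two values agree modulo
`p^(i+1)`, so the twist disappears in `ℤ/p^(i+1)`. -/
theorem diffQuot_mul (s t : GhostRing p n) (i : ℕ) (h : i + 1 < n) :
    diffQuot (s * t) ⟨i + 1, h⟩ = s.1 ⟨i + 1, h⟩ * diffQuot t ⟨i + 1, h⟩ +
      t.1 ⟨i, i.lt_succ_self.trans h⟩ * diffQuot s ⟨i + 1, h⟩ := by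
  refine diffQuot_eq ?_
  rw [mul_add, mul_left_comm, diffQuot_spec, mul_left_comm, diffQuot_spec, mul_val, mul_val]
  ring

theorem diffQuot_const (a : ZLoc p) (j : Fin n) : diffQuot (const p n a) j = 0 := by
  obtain ⟨_ | i, h⟩ := j
  · rfl
  · refine diffQuot_eq ?_
    rw [const_val, const_val, mul_zero, sub_self]

theorem diffQuot_res (s : GhostRing p (n + 1)) (j : Fin n) :
    diffQuot (res p n s) j = diffQuot s j.castSucc := by
  obtain ⟨_ | i, h⟩ := j
  · rfl
  · exact diffQuot_eq (diffQuot_spec s i _)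

theorem diffQuot_frob (s : GhostRing p (n + 1)) (i : ℕ) (h : i + 1 < n) :
    diffQuot (frob p n s) ⟨i + 1, h⟩ = p * diffQuot s ⟨i + 2, Nat.succ_lt_succ h⟩ := by
  refine diffQuot_eq ?_
  rw [← mul_assoc, ← pow_succ]
  exact diffQuot_spec s (i + 1) _

theorem diffQuot_ver_succ (s : GhostRing p n) (i : ℕ) (h : i + 1 < n) :
    diffQuot (ver p n s) ⟨i + 2, Nat.succ_lt_succ h⟩ = diffQuot s ⟨i + 1, h⟩ := by
  refine diffQuot_eq ?_
  rw [pow_succ', mul_assoc, diffQuot_spec, mul_sub]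
  rfl

theorem diffQuot_ver_one (s : GhostRing p n) (h : 0 < n) :
    diffQuot (ver p n s) ⟨0 + 1, Nat.succ_lt_succ h⟩ = s.1 ⟨0, h⟩ := by
  refine diffQuot_eq ?_
  change _ = (p : ZLoc p) * s.1 ⟨0, h⟩ - 0
  ring

/-- The middle terms contain `p` from the binomial coefficient and at least `p^(2j)` from the power.
The top term has no binomial factor, and `jp ≥ 2j + 1` holds because `p ≥ 3`. -/
theorem dvd_add_pow_sub {R : Type*} [CommRing R] (hp : p ≠ 2) (y t : R) {j : ℕ} (hj : 1 ≤ j) :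
    (p : R) ^ (2 * j + 1) ∣ (y + p ^ j * t) ^ p - y ^ p - p * y ^ (p - 1) * (p ^ j * t) := by
  have hp' : p.Prime := Fact.out
  obtain ⟨q, rfl⟩ : ∃ q, p = q + 2 := ⟨p - 2, by have := hp'.two_le; omega⟩
  set P : R := ((q + 2 : ℕ) : R) with hP
  have hq : 1 ≤ q := by omega
  rw [add_comm y, add_pow, Finset.sum_range_succ', Finset.sum_range_succ']
  have e : ∀ A : R, A + (P ^ j * t) ^ (0 + 1) * y ^ (q + 2 - (0 + 1)) * ((q + 2).choose (0 + 1) : ℕ)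
      + (P ^ j * t) ^ 0 * y ^ (q + 2 - 0) * ((q + 2).choose 0 : ℕ) - y ^ (q + 2)
      - P * y ^ (q + 2 - 1) * (P ^ j * t) = A := by
    intro A
    simp only [zero_add, Nat.choose_one_right, Nat.choose_zero_right, ← hP, pow_one, pow_zero,
      Nat.sub_zero, Nat.cast_one]
    ring
  rw [e]
  refine Finset.dvd_sum fun k hk => ?_
  have hk' : k < q + 1 := Finset.mem_range.1 hk
  rcases Nat.lt_succ_iff_lt_or_eq.1 hk' with hk' | rfl
  · have h1 : (P : R) ∣ ((q + 2).choose (k + 1 + 1) : ℕ) :=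
      Nat.cast_dvd_cast (hp'.dvd_choose_self (by omega) (by omega))
    have h2 : P ^ (2 * j) ∣ (P ^ j * t) ^ (k + 1 + 1) * y ^ (q + 2 - (k + 1 + 1)) := by
      refine Dvd.dvd.mul_right ?_ _
      rw [mul_pow, ← pow_mul]
      exact Dvd.dvd.mul_right (pow_dvd_pow _ (by nlinarith)) _
    rw [pow_succ]
    exact mul_dvd_mul h2 h1
  · refine Dvd.dvd.mul_right (Dvd.dvd.mul_right ?_ _) _
    rw [mul_pow, ← pow_mul]
    exact Dvd.dvd.mul_right (pow_dvd_pow _ (by nlinarith)) _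

/-- This is `F d[a] = [a]^(p-1) d[a]` at index `i + 1`. With `y = a^(p^(i+1))` one has `a^(p^i) = y
- p^(i+1) c'`; its `p`-th power is known modulo `p^(2(i+1)+1)`, and division by `p^(i+2)` leaves
precision `p^(i+1)`. -/
theorem dvd_diffQuot_teich (hp : p ≠ 2) (a : ZLoc p) (i : ℕ) (h : i + 2 < n) :
    (p : ZLoc p) ^ (i + 1) ∣ diffQuot (teich p n a) ⟨i + 2, h⟩ -
      (a ^ p ^ (i + 1)) ^ (p - 1) * diffQuot (teich p n a) ⟨i + 1, by omega⟩ := by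
  have h1 : _ = a ^ p ^ (i + 2) - a ^ p ^ (i + 1) := diffQuot_spec (teich p n a) (i + 1) h
  have h2 : _ = a ^ p ^ (i + 1) - a ^ p ^ i := diffQuot_spec (teich p n a) i (by omega)
  set c := diffQuot (teich p n a) ⟨i + 2, h⟩
  set c' := diffQuot (teich p n a) ⟨i + 1, by omega⟩
  obtain ⟨e, he⟩ := dvd_add_pow_sub (R := ZLoc p) hp (a ^ p ^ (i + 1)) (-c') (Nat.succ_pos i)
  have h3 : a ^ p ^ (i + 1) + (p : ZLoc p) ^ (i + 1) * -c' = a ^ p ^ i := by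
    linear_combination -h2
  rw [Nat.succ_eq_add_one, h3, ← pow_mul, ← pow_mul, ← pow_succ, ← pow_succ] at he
  refine ⟨-e, mul_left_cancel₀ (pow_p_ne_zero (i + 1 + 1)) ?_⟩
  rw [mul_sub, h1, ← pow_mul]
  linear_combination -he

end GhostRing

/-! ### Square-zero extensions, in an arbitrary universe -/

/-- The square-zero extension `R ⊕ M`, placed in the universe `v`. -/
@[ext]
structure SqZeroExt (R M : Type) : Type v where
  /-- the component in `R` -/
  fst : R
  /-- the component in `M` -/
  snd : M

namespace SqZeroExt

variable {R M : Type} [CommRing R] [AddCommGroup M]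

instance : Zero (SqZeroExt.{v} R M) := ⟨⟨0, 0⟩⟩
instance : One (SqZeroExt.{v} R M) := ⟨⟨1, 0⟩⟩
instance : Add (SqZeroExt.{v} R M) := ⟨fun x y => ⟨x.1 + y.1, x.2 + y.2⟩⟩
instance : Neg (SqZeroExt.{v} R M) := ⟨fun x => ⟨-x.1, -x.2⟩⟩

@[simp] theorem fst_zero : (0 : SqZeroExt.{v} R M).fst = 0 := rfl
@[simp] theorem snd_zero : (0 : SqZeroExt.{v} R M).snd = 0 := rfl
@[simp] theorem fst_one : (1 : SqZeroExt.{v} R M).fst = 1 := rfl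
@[simp] theorem snd_one : (1 : SqZeroExt.{v} R M).snd = 0 := rfl
@[simp] theorem fst_add (x y : SqZeroExt.{v} R M) : (x + y).fst = x.fst + y.fst := rfl
@[simp] theorem snd_add (x y : SqZeroExt.{v} R M) : (x + y).snd = x.snd + y.snd := rfl
@[simp] theorem fst_neg (x : SqZeroExt.{v} R M) : (-x).fst = -x.fst := rfl
@[simp] theorem snd_neg (x : SqZeroExt.{v} R M) : (-x).snd = -x.snd := rfl

variable [Module R M]

instance : Mul (SqZeroExt.{v} R M) := ⟨fun x y => ⟨x.1 * y.1, x.1 • y.2 + y.1 • x.2⟩⟩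

@[simp] theorem fst_mul (x y : SqZeroExt.{v} R M) : (x * y).fst = x.fst * y.fst := rfl
@[simp] theorem snd_mul (x y : SqZeroExt.{v} R M) :
    (x * y).snd = x.fst • y.snd + y.fst • x.snd := rfl

instance : CommRing (SqZeroExt.{v} R M) where
  add_assoc x y z := SqZeroExt.ext (add_assoc _ _ _) (add_assoc _ _ _)
  zero_add x := SqZeroExt.ext (zero_add _) (zero_add _)
  add_zero x := SqZeroExt.ext (add_zero _) (add_zero _)
  add_comm x y := SqZeroExt.ext (add_comm _ _) (add_comm _ _)
  neg_add_cancel x := SqZeroExt.ext (neg_add_cancel _) (neg_add_cancel _)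
  mul_assoc x y z := SqZeroExt.ext (mul_assoc _ _ _) (by simp; module)
  one_mul x := by ext <;> simp
  mul_one x := by ext <;> simp
  zero_mul x := by ext <;> simp
  mul_zero x := by ext <;> simp
  mul_comm x y := by ext <;> simp [mul_comm, add_comm]
  left_distrib x y z := SqZeroExt.ext (mul_add _ _ _) (by simp; module)
  right_distrib x y z := SqZeroExt.ext (add_mul _ _ _) (by simp; module)
  nsmul := nsmulRec
  zsmul := zsmulRec

/-- The inclusion of `R`. -/
def inl : R →+* SqZeroExt.{v} R M where
  toFun r := ⟨r, 0⟩
  map_zero' := rfl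
  map_one' := rfl
  map_add' _ _ := by ext <;> simp
  map_mul' _ _ := by ext <;> simp

/-- The inclusion of `M`. -/
def inr : M →+ SqZeroExt.{v} R M where
  toFun m := ⟨0, m⟩
  map_zero' := rfl
  map_add' _ _ := by ext <;> simp

/-- The projection to `R`. -/
def fstHom : SqZeroExt.{v} R M →+* R where
  toFun := fst
  map_zero' := rfl
  map_one' := rfl
  map_add' _ _ := rfl
  map_mul' _ _ := rfl

/-- The projection to `M`. -/
def sndHom : SqZeroExt.{v} R M →+ M where
  toFun := snd
  map_zero' := rfl
  map_add' _ _ := rfl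

@[simp] theorem fst_inl (r : R) : (inl r : SqZeroExt.{v} R M).fst = r := rfl
@[simp] theorem snd_inl (r : R) : (inl r : SqZeroExt.{v} R M).snd = 0 := rfl
@[simp] theorem fst_inr (m : M) : (inr m : SqZeroExt.{v} R M).fst = 0 := rfl
@[simp] theorem snd_inr (m : M) : (inr m : SqZeroExt.{v} R M).snd = m := rfl

theorem eq_inl_add_inr (x : SqZeroExt.{v} R M) : x = inl x.fst + inr x.snd := by ext <;> simp

theorem fst_nsmul (k : ℕ) (x : SqZeroExt.{v} R M) : (k • x).fst = k • x.fst :=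
  map_nsmul (fstHom : SqZeroExt.{v} R M →+* R) k x

theorem snd_nsmul (k : ℕ) (x : SqZeroExt.{v} R M) : (k • x).snd = k • x.snd :=
  map_nsmul (sndHom : SqZeroExt.{v} R M →+ M) k x

/-- The grading: `R` in degree zero and `M` in degree one. -/
def gr (R M : Type) [CommRing R] [AddCommGroup M] [Module R M] :
    ℕ → AddSubgroup (SqZeroExt.{v} R M)
  | 0 => (sndHom : SqZeroExt.{v} R M →+ M).ker
  | 1 => (fstHom : SqZeroExt.{v} R M →+* R).toAddMonoidHom.ker
  | _ + 2 => ⊥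

theorem mem_gr_zero {x : SqZeroExt.{v} R M} : x ∈ gr R M 0 ↔ x.snd = 0 := Iff.rfl
theorem mem_gr_one {x : SqZeroExt.{v} R M} : x ∈ gr R M 1 ↔ x.fst = 0 := Iff.rfl
theorem mem_gr_add_two {x : SqZeroExt.{v} R M} {q : ℕ} : x ∈ gr R M (q + 2) ↔ x = 0 := Iff.rfl
theorem inl_mem (r : R) : (inl r : SqZeroExt.{v} R M) ∈ gr R M 0 := rfl
theorem inr_mem (m : M) : (inr m : SqZeroExt.{v} R M) ∈ gr R M 1 := rfl

theorem mul_mem_gr (i j : ℕ) (x y : SqZeroExt.{v} R M) (hx : x ∈ gr R M i) (hy : y ∈ gr R M j) :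
    x * y ∈ gr R M (i + j) := by
  match i, j with
  | 0, 0 => rw [mem_gr_zero] at *; simp [hx, hy]
  | 0, 1 => rw [mem_gr_one] at *; simp [hy]
  | 1, 0 => rw [mem_gr_one] at *; simp [hx]
  | 1, 1 =>
    rw [mem_gr_one] at *
    exact SqZeroExt.ext (by simp [hx]) (by simp [hx, hy])
  | i + 2, j =>
    rw [mem_gr_add_two] at hx
    rw [hx, zero_mul]
    exact zero_mem _
  | i, j + 2 =>
    rw [mem_gr_add_two] at hy
    rw [hy, mul_zero]
    exact zero_mem _

theorem mul_eq_zero_of_mem_gr_one {x y : SqZeroExt.{v} R M} (hx : x ∈ gr R M 1)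
    (hy : y ∈ gr R M 1) : x * y = 0 := mul_mem_gr 1 1 x y hx hy

theorem graded_comm (i j : ℕ) (x y : SqZeroExt.{v} R M) (hx : x ∈ gr R M i) (hy : y ∈ gr R M j) :
    x * y = (-1) ^ (i * j) * (y * x) := by
  match i, j with
  | 0, j => rw [zero_mul, pow_zero, one_mul, mul_comm]
  | 1, 0 => rw [mul_zero, pow_zero, one_mul, mul_comm]
  | 1, 1 => rw [mul_eq_zero_of_mem_gr_one hx hy, mul_eq_zero_of_mem_gr_one hy hx, mul_zero]
  | i + 2, j =>
    rw [mem_gr_add_two] at hx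
    rw [hx, zero_mul, mul_zero, mul_zero]
  | i, j + 2 =>
    rw [mem_gr_add_two] at hy
    rw [hy, zero_mul, mul_zero, mul_zero]

/-- The projection to degree zero. -/
def projZero : SqZeroExt.{v} R M →+ (gr R M 0 : AddSubgroup (SqZeroExt.{v} R M)) :=
  ((inl : R →+* SqZeroExt.{v} R M).toAddMonoidHom.comp
    (fstHom : SqZeroExt.{v} R M →+* R).toAddMonoidHom).codRestrict _ fun x => inl_mem x.fst

/-- The projection to degree one. -/
def projOne : SqZeroExt.{v} R M →+ (gr R M 1 : AddSubgroup (SqZeroExt.{v} R M)) :=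
  ((inr : M →+ SqZeroExt.{v} R M).comp sndHom).codRestrict _ fun x => inr_mem x.snd

/-- Only degrees zero and one are nonzero, so the sum of the two projections is a two-sided inverse
of the summation map. -/
theorem gr_isInternal : DirectSum.IsInternal (gr R M : ℕ → AddSubgroup (SqZeroExt.{v} R M)) := by
  classical
  have key : ∀ i (x : (gr R M i : AddSubgroup (SqZeroExt.{v} R M))),
      DirectSum.of (fun i => (gr R M i : AddSubgroup (SqZeroExt.{v} R M))) 0 (projZero x.1) +
      DirectSum.of (fun i => (gr R M i : AddSubgroup (SqZeroExt.{v} R M))) 1 (projOne x.1) =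
      DirectSum.of (fun i => (gr R M i : AddSubgroup (SqZeroExt.{v} R M))) i x := by
    rintro i ⟨x, hx⟩
    match i with
    | 0 =>
      have h0 : projZero x = ⟨x, hx⟩ := Subtype.ext (SqZeroExt.ext rfl hx.symm)
      have h1 : projOne x = 0 := Subtype.ext (SqZeroExt.ext rfl hx)
      rw [h0, h1, map_zero, add_zero]
    | 1 =>
      have h0 : projZero x = 0 := Subtype.ext (SqZeroExt.ext hx rfl)
      have h1 : projOne x = ⟨x, hx⟩ := Subtype.ext (SqZeroExt.ext hx.symm rfl)
      rw [h0, h1, map_zero, zero_add]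
    | i + 2 =>
      have h : (⟨x, hx⟩ : (gr R M (i + 2) : AddSubgroup (SqZeroExt.{v} R M))) = 0 :=
        Subtype.ext hx
      rw [h, ZeroMemClass.coe_zero, map_zero, map_zero, map_zero, map_zero, map_zero, add_zero]
  let := DirectSum.Decomposition.ofAddHom (gr R M : ℕ → AddSubgroup (SqZeroExt.{v} R M))
    (((DirectSum.of (fun i => (gr R M i : AddSubgroup (SqZeroExt.{v} R M))) 0).comp projZero) +
      ((DirectSum.of (fun i => (gr R M i : AddSubgroup (SqZeroExt.{v} R M))) 1).comp projOne))
    (AddMonoidHom.ext fun x => by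
      simp only [AddMonoidHom.comp_apply, AddMonoidHom.add_apply, map_add,
        DirectSum.coeAddMonoidHom_of, AddMonoidHom.id_apply]
      exact (eq_inl_add_inr x).symm)
    (DirectSum.addHom_ext fun i x => by
      simp only [AddMonoidHom.comp_apply, AddMonoidHom.add_apply,
        DirectSum.coeAddMonoidHom_of, AddMonoidHom.id_apply]
      exact key i x)
  exact DirectSum.Decomposition.isInternal _

end SqZeroExt

/-! ### Witt complexes concentrated in degrees zero and one -/

/-- The data needed to make the square-zero extensions of the rings `W_n(ℤ_(p))` by modules `N n`
into a Witt complex over `ℤ_(p)` which vanishes in degrees at least two. -/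
structure WittModule (p : ℕ) [Fact p.Prime] where
  /-- the part of degree one -/
  N : ℕ → Type
  [addCommGroup : ∀ n, AddCommGroup (N n)]
  [module : ∀ n, Module (GhostRing p n) (N n)]
  subsingleton : Subsingleton (N 0)
  /-- restriction -/
  R : ∀ n, N (n + 1) →+ N n
  R_smul : ∀ n (s : GhostRing p (n + 1)) m, R n (s • m) = GhostRing.res p n s • R n m
  /-- Frobenius -/
  F : ∀ n, N (n + 1) →+ N n
  F_smul : ∀ n (s : GhostRing p (n + 1)) m, F n (s • m) = GhostRing.frob p n s • F n m
  R_F : ∀ n m, R n (F (n + 1) m) = F n (R (n + 1) m)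
  /-- Verschiebung -/
  V : ∀ n, N n →+ N (n + 1)
  R_V : ∀ n m, R (n + 1) (V (n + 1) m) = V n (R n m)
  ver_smul : ∀ n (s : GhostRing p n) m, GhostRing.ver p n s • m = V n (s • F n m)
  smul_V : ∀ n (s : GhostRing p (n + 1)) m, s • V n m = V n (GhostRing.frob p n s • m)
  F_V : ∀ n m, F n (V n m) = p • m
  /-- the differential -/
  d : ∀ n, GhostRing p n →+ N n
  d_mul : ∀ n s t, d n (s * t) = s • d n t + t • d n s
  R_d : ∀ n s, R n (d (n + 1) s) = d n (GhostRing.res p n s)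
  F_d_ver : ∀ n s, F n (d (n + 1) (GhostRing.ver p n s)) = d n s
  F_d_teich : ∀ n a, F n (d (n + 1) (GhostRing.teich p (n + 1) a)) =
    GhostRing.teich p n a ^ (p - 1) • d n (GhostRing.teich p n a)

attribute [instance] WittModule.addCommGroup WittModule.module

namespace WittModule

open SqZeroExt GhostRing

variable {p : ℕ} [Fact p.Prime] (D : WittModule p)

/-- A compatible pair of additive maps between square-zero extensions. -/
def mapAdd {R M R' M' : Type} [CommRing R] [AddCommGroup M]
    [CommRing R'] [AddCommGroup M'] [Module R M] [Module R' M'] (f : R →+ R') (g : M →+ M') :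
    SqZeroExt.{v} R M →+ SqZeroExt.{v} R' M' where
  toFun x := ⟨f x.fst, g x.snd⟩
  map_zero' := SqZeroExt.ext (map_zero f) (map_zero g)
  map_add' _ _ := SqZeroExt.ext (map_add f _ _) (map_add g _ _)

/-- A compatible pair of a map of rings and a semilinear map. -/
def mapRing {R M R' M' : Type} [CommRing R] [AddCommGroup M]
    [CommRing R'] [AddCommGroup M'] [Module R M] [Module R' M'] (f : R →+* R') (g : M →+ M')
    (h : ∀ r m, g (r • m) = f r • g m) :
    SqZeroExt.{v} R M →+* SqZeroExt.{v} R' M' where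
  toFun x := ⟨f x.fst, g x.snd⟩
  map_zero' := SqZeroExt.ext (map_zero f) (map_zero g)
  map_one' := SqZeroExt.ext (map_one f) (map_zero g)
  map_add' _ _ := SqZeroExt.ext (map_add f _ _) (map_add g _ _)
  map_mul' _ _ := SqZeroExt.ext (map_mul f _ _) (by simp [h])

theorem mk_mem_gr {R M R' M' : Type} [CommRing R] [AddCommGroup M]
    [CommRing R'] [AddCommGroup M'] [Module R M] [Module R' M'] (f : R →+ R') (g : M →+ M')
    (q : ℕ) (x : SqZeroExt.{v} R M) (hx : x ∈ gr R M q) :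
    (⟨f x.fst, g x.snd⟩ : SqZeroExt.{v} R' M') ∈ gr R' M' q := by
  match q with
  | 0 => rw [mem_gr_zero] at *; simp [hx]
  | 1 => rw [mem_gr_one] at *; simp [hx]
  | q + 2 =>
    rw [mem_gr_add_two] at *
    exact SqZeroExt.ext (by simp [hx]) (by simp [hx])

/-- The differential on the square-zero extension. -/
def dHom (n : ℕ) :
    SqZeroExt.{v} (GhostRing p n) (D.N n) →+ SqZeroExt.{v} (GhostRing p n) (D.N n) :=
  inr.comp ((D.d n).comp
    (fstHom : SqZeroExt.{v} (GhostRing p n) (D.N n) →+* GhostRing p n).toAddMonoidHom)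

theorem dHom_apply (n : ℕ) (x : SqZeroExt.{v} (GhostRing p n) (D.N n)) :
    D.dHom n x = inr (D.d n x.fst) := rfl

/-- The Witt complex given by a `WittModule`. -/
def toWittComplex : WittComplex.{v} p (ZLoc p) where
  obj n := SqZeroExt.{v} (GhostRing p n) (D.N n)
  gr n := gr (GhostRing p n) (D.N n)
  one_mem n := rfl
  mul_mem n := mul_mem_gr
  isInternal n := gr_isInternal
  graded_comm n := SqZeroExt.graded_comm
  level_zero := ⟨fun x y => SqZeroExt.ext (GhostRing.ext fun j => j.elim0)
    (D.subsingleton.elim _ _)⟩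
  R n := mapRing (res p n) (D.R n) (D.R_smul n)
  R_mem n q x hx := mk_mem_gr (res p n).toAddMonoidHom (D.R n) q x hx
  lam n := inl.comp (equiv p n).toRingHom
  lam_mem n x := rfl
  R_lam n x := SqZeroExt.ext
    ((congrArg (res p n) (equiv_truncate x)).trans (equiv_truncate x).symm) (map_zero _)
  F n := mapRing (frob p n) (D.F n) (D.F_smul n)
  F_mem n q x hx := mk_mem_gr (frob p n).toAddMonoidHom (D.F n) q x hx
  R_F n x := SqZeroExt.ext rfl (D.R_F n x.snd)
  F_lam n x := SqZeroExt.ext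
    ((congrArg (frob p n) (equiv_truncate x)).trans
      ((ghost_frobenius x).symm.trans (equiv_truncate _).symm)) (map_zero _)
  V n := mapAdd (ver p n) (D.V n)
  V_mem n q x hx := mk_mem_gr (ver p n) (D.V n) q x hx
  R_V n x := SqZeroExt.ext (res_ver _) (D.R_V n x.snd)
  V_lam n x := SqZeroExt.ext
    ((congrArg (ver p n) (equiv_truncate x)).trans
      ((ghost_verschiebung x).symm.trans (equiv_truncate _).symm)) (map_zero _)
  -- In degree one the projection formula has two halves: `ver_smul` when `y` has degree one,
  -- `smul_V` when `x` does.
  V_mul n x y := SqZeroExt.ext (ver_mul _ _) (by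
    change ver p n x.fst • y.snd + y.fst • D.V n x.snd =
      D.V n (x.fst • D.F n y.snd + frob p n y.fst • x.snd)
    rw [map_add, D.ver_smul, D.smul_V])
  F_V n x := SqZeroExt.ext ((frob_ver _).trans (fst_nsmul _ _).symm)
    ((D.F_V n _).trans (snd_nsmul _ _).symm)
  d n := D.dHom n
  d_mem n q x hx := by
    match q with
    | 0 => exact inr_mem _
    | 1 =>
      rw [mem_gr_one] at hx
      refine mem_gr_add_two.2 (SqZeroExt.ext rfl ?_)
      change D.d n x.fst = 0
      rw [hx, map_zero]
    | q + 2 =>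
      rw [mem_gr_add_two] at hx
      rw [hx, map_zero]
      exact zero_mem _
  R_d n x := SqZeroExt.ext (map_zero _) (D.R_d n x.fst)
  d_mul n q x y hx := by
    match q with
    | 0 =>
      rw [pow_zero, one_mul, dHom_apply, dHom_apply, dHom_apply]
      refine SqZeroExt.ext (by simp) ?_
      simp [D.d_mul, add_comm]
    | 1 =>
      rw [mem_gr_one] at hx
      rw [dHom_apply, dHom_apply, dHom_apply]
      refine SqZeroExt.ext (by simp) ?_
      simp [hx]
    | q + 2 =>
      rw [mem_gr_add_two] at hx
      subst hx
      simp
  d_d n x := SqZeroExt.ext rfl (map_zero (D.d n))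
  F_d_V n x := SqZeroExt.ext (map_zero _) (D.F_d_ver n x.fst)
  F_d_teichmuller n a := by
    have h : ∀ k, (equiv p k) (WittVector.truncate k (WittVector.teichmuller p a)) =
      teich p k a := fun k => (equiv_truncate _).trans (ghost_teichmuller a)
    change mapRing (frob p n) (D.F n) (D.F_smul n) (inr (D.d (n + 1) (equiv p (n + 1)
      (WittVector.truncate (n + 1) (WittVector.teichmuller p a))))) =
      inl (equiv p n (WittVector.truncate n (WittVector.teichmuller p a))) ^ (p - 1) *
      inr (D.d n (equiv p n (WittVector.truncate n (WittVector.teichmuller p a))))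
    rw [h, h, ← map_pow]
    refine SqZeroExt.ext ?_ ?_
    · simp [mapRing]
    · simp only [snd_mul, fst_inl, fst_inr, snd_inl, snd_inr, smul_zero, add_zero]
      exact D.F_d_teich n a

end WittModule

namespace GhostRing

variable {p : ℕ} [Fact p.Prime]

/-- A telescoping sum: `V^j(1)` has entries `0` before index `j` and `p^j` from there on. -/
theorem eq_const_add_sum {n : ℕ} (s : GhostRing p (n + 1)) :
    s = const p (n + 1) (s.1 0) +
      ∑ j : Fin n, const p (n + 1) (diffQuot s j.succ) * vOne p (n + 1) (j.1 + 1) := by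
  induction n with
  | zero =>
    rw [Finset.univ_eq_empty, Finset.sum_empty, add_zero]
    refine ext fun j => ?_
    cases j using Fin.cases with
    | zero => rfl
    | succ j => exact j.elim0
  | succ n ih =>
    obtain ⟨t, ht⟩ := exists_eq_const_add_ver s
    conv_lhs => rw [ht]
    congr 1
    have hq : ∀ j, diffQuot s j = diffQuot (ver p (n + 1) t) j := fun j => by
      conv_lhs => rw [ht]
      rw [diffQuot_add, diffQuot_const, zero_add]
    have hv : ∀ j : Fin (n + 1), const p (n + 2) (diffQuot s j.succ) * vOne p (n + 2) (j.1 + 1) =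
        ver p (n + 1) (const p (n + 1) (diffQuot (ver p (n + 1) t) j.succ) *
          vOne p (n + 1) j.1) := fun j => by
      rw [hq]
      exact const_mul_ver _ _
    rw [Finset.sum_congr rfl fun j _ => hv j, ← map_sum]
    congr 1
    rw [Fin.sum_univ_succ]
    conv_lhs => rw [ih t]
    congr 1
    · have h : diffQuot (ver p (n + 1) t) (Fin.succ 0) = t.1 0 := diffQuot_ver_one t n.succ_pos
      rw [h]
      exact (mul_one _).symm
    · refine Finset.sum_congr rfl fun j _ => ?_
      have h : diffQuot (ver p (n + 1) t) j.succ.succ = diffQuot t j.succ :=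
        diffQuot_ver_succ t j.1 _
      rw [h]
      rfl

end GhostRing

/-! ### Relations valid in every Witt complex over `ℤ_(p)` -/

namespace WittComplex

open GhostRing

variable {p : ℕ} [Fact p.Prime] (E : WittComplex.{v} p (ZLoc p))

/-- The map `λ` in ghost coordinates. -/
def ofGhost (n : ℕ) : GhostRing p n →+* E.obj n := (E.lam n).comp (equiv p n).symm.toRingHom

theorem ofGhost_ghost (n : ℕ) (x : WittVector p (ZLoc p)) :
    E.ofGhost n (ghost p n x) = E.lam n (WittVector.truncate n x) :=
  congrArg (E.lam n) (equiv_symm_ghost x)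

theorem ofGhost_equiv (n : ℕ) (x : TruncatedWittVector p n (ZLoc p)) :
    E.ofGhost n (equiv p n x) = E.lam n x :=
  congrArg (E.lam n) ((equiv p n).symm_apply_apply x)

theorem ofGhost_mem (n : ℕ) (s : GhostRing p n) : E.ofGhost n s ∈ E.gr n 0 := E.lam_mem n _

theorem R_ofGhost (n : ℕ) (s : GhostRing p (n + 1)) :
    E.R n (E.ofGhost (n + 1) s) = E.ofGhost n (res p n s) := by
  obtain ⟨x, rfl⟩ := ghost_surjective s
  rw [ofGhost_ghost, R_lam, res_ghost, ofGhost_ghost]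

theorem F_ofGhost (n : ℕ) (s : GhostRing p (n + 1)) :
    E.F n (E.ofGhost (n + 1) s) = E.ofGhost n (frob p n s) := by
  obtain ⟨x, rfl⟩ := ghost_surjective s
  rw [ofGhost_ghost, F_lam, ← ghost_frobenius, ofGhost_ghost]

theorem V_ofGhost (n : ℕ) (s : GhostRing p n) :
    E.V n (E.ofGhost n s) = E.ofGhost (n + 1) (ver p n s) := by
  obtain ⟨x, rfl⟩ := ghost_surjective s
  rw [ofGhost_ghost, V_lam, ← ghost_verschiebung, ofGhost_ghost]

theorem ofGhost_vOne (n i : ℕ) : E.ofGhost n (GhostRing.vOne p n i) = E.vOne n i := by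
  induction n generalizing i with
  | zero => exact E.level_zero.elim _ _
  | succ n ih =>
    cases i with
    | zero => exact map_one _
    | succ i => exact (E.V_ofGhost n _).symm.trans (congrArg (E.V n) (ih i))

/-- The structure of `ℤ_(p)`-algebra on a Witt complex. -/
def scalar (n : ℕ) : ZLoc p →+* E.obj n := (E.ofGhost n).comp (const p n)

theorem scalar_mem (n : ℕ) (a : ZLoc p) : E.scalar n a ∈ E.gr n 0 := E.ofGhost_mem n _

theorem ofGhost_const (n : ℕ) (a : ZLoc p) : E.ofGhost n (const p n a) = E.scalar n a := rfl

theorem F_scalar (n : ℕ) (a : ZLoc p) : E.F n (E.scalar (n + 1) a) = E.scalar n a :=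
  RingHom.congr_fun (ZLoc.ringHom_ext ((E.F n).comp (E.scalar (n + 1))) (E.scalar n)) a

theorem R_scalar (n : ℕ) (a : ZLoc p) : E.R n (E.scalar (n + 1) a) = E.scalar n a :=
  RingHom.congr_fun (ZLoc.ringHom_ext ((E.R n).comp (E.scalar (n + 1))) (E.scalar n)) a

theorem vOne_mem (n i : ℕ) : E.vOne n i ∈ E.gr n 0 := by
  rw [← ofGhost_vOne]; exact E.ofGhost_mem _ _

theorem dvOne_mem (n i : ℕ) : E.dvOne n i ∈ E.gr n 1 := E.d_mem n 0 _ (E.vOne_mem n i)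

theorem R_vOne (n i : ℕ) : E.R n (E.vOne (n + 1) i) = E.vOne n i := by
  induction n generalizing i with
  | zero => exact E.level_zero.elim _ _
  | succ n ih =>
    cases i with
    | zero => exact map_one _
    | succ i => exact (E.R_V n _).trans (congrArg (E.V n) (ih i))

theorem R_dvOne (n i : ℕ) : E.R n (E.dvOne (n + 1) i) = E.dvOne n i := by
  rw [dvOne, R_d, R_vOne, dvOne]

variable {E} in
theorem mul_comm_of_mem_zero {n q : ℕ} {x y : E.obj n} (hx : x ∈ E.gr n 0) (hy : y ∈ E.gr n q) :
    x * y = y * x := by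
  rw [E.graded_comm n 0 q x y hx hy, zero_mul, pow_zero, one_mul]

variable {E} in
theorem mul_V {n q : ℕ} {x : E.obj (n + 1)} {y : E.obj n} (hx : x ∈ E.gr (n + 1) 0)
    (hy : y ∈ E.gr n q) : x * E.V n y = E.V n (E.F n x * y) := by
  rw [mul_comm_of_mem_zero hx (E.V_mem n q y hy), V_mul,
    mul_comm_of_mem_zero (E.F_mem n 0 x hx) hy]

theorem scalar_mul_V (n q : ℕ) (a : ZLoc p) {y : E.obj n} (hy : y ∈ E.gr n q) :
    E.scalar (n + 1) a * E.V n y = E.V n (E.scalar n a * y) := by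
  rw [mul_V (E.scalar_mem _ a) hy, F_scalar]

theorem d_one (n : ℕ) : E.d n 1 = 0 := by
  have h := E.d_mul n 0 1 1 (E.one_mem n)
  rw [mul_one, mul_one, pow_zero, one_mul, one_mul] at h
  exact left_eq_add.1 h

theorem dvOne_zero (n : ℕ) : E.dvOne n 0 = 0 := by
  cases n <;> exact E.d_one _

theorem d_intCast (n : ℕ) (k : ℤ) : E.d n k = 0 := by
  rw [← zsmul_one, map_zsmul, d_one, smul_zero]

/-- Clear the denominator: `d` kills integers, and integers prime to `p` act invertibly. -/
theorem d_scalar (n : ℕ) (a : ZLoc p) : E.d n (E.scalar n a) = 0 := by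
  obtain ⟨k, m, hm, h⟩ := ZLoc.exists_mul_intCast_eq a
  have h1 := congrArg (E.scalar n) h
  rw [map_mul, map_intCast, map_intCast] at h1
  have h2 := congrArg (E.d n) h1
  rw [E.d_mul n 0 _ _ (E.scalar_mem n a), d_intCast, d_intCast, mul_zero, mul_zero, add_zero] at h2
  have hu := (ZLoc.isUnit_intCast hm).map (E.scalar n)
  rw [map_intCast] at hu
  exact hu.mul_left_eq_zero.1 h2

theorem d_scalar_mul (n : ℕ) (a : ZLoc p) (x : E.obj n) :
    E.d n (E.scalar n a * x) = E.scalar n a * E.d n x := by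
  rw [E.d_mul n 0 _ _ (E.scalar_mem n a), d_scalar, zero_mul, zero_add, pow_zero, one_mul]

theorem V_one_mul (n : ℕ) (x : E.obj (n + 1)) : E.V n 1 * x = E.V n (E.F n x) := by
  rw [V_mul, one_mul]

theorem V_mul_V (n : ℕ) (x y : E.obj n) : E.V n x * E.V n y = p • E.V n (x * y) := by
  rw [V_mul, F_V, mul_smul_comm, map_nsmul]

variable {E} in
-- Apply `d` to `V(1) V(x) = p V(x)`. Here `V(1) dV(x) = V(F dV(x)) = V(dx)`, while `dV(1) V(x) =
-- V(x d1)` vanishes.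
theorem V_d {n : ℕ} {x : E.obj n} (hx : x ∈ E.gr n 0) :
    E.V n (E.d n x) = p • E.d (n + 1) (E.V n x) := by
  have h1 : E.V n 1 ∈ E.gr (n + 1) 0 := E.V_mem n 0 1 (E.one_mem n)
  have h2 : E.V n x ∈ E.gr (n + 1) 0 := E.V_mem n 0 x hx
  have h := E.d_mul (n + 1) 0 (E.V n 1) (E.V n x) h1
  rw [V_mul_V, one_mul, map_nsmul, pow_zero, one_mul, V_one_mul, F_d_V,
    ← mul_comm_of_mem_zero h2 (E.d_mem _ _ _ h1), V_mul, F_d_V, d_one, mul_zero, map_zero,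
    zero_add] at h
  exact h.symm

theorem V_vOne (n i : ℕ) : E.V n (E.vOne n i) = E.vOne (n + 1) (i + 1) := rfl

theorem F_vOne (n i : ℕ) : E.F n (E.vOne (n + 1) (i + 1)) = p • E.vOne n i := E.F_V n _

theorem F_dvOne (n i : ℕ) : E.F n (E.dvOne (n + 1) (i + 1)) = E.dvOne n i := E.F_d_V n _

theorem V_dvOne (n i : ℕ) : E.V n (E.dvOne n i) = p • E.dvOne (n + 1) (i + 1) :=
  V_d (E.vOne_mem n i)

theorem dvOne_level_zero (i : ℕ) : E.dvOne 0 i = 0 := E.level_zero.elim _ _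

/-- Since `p dV^(i+1)(1) = V(dV^i(1))`, torsion is inherited from the level below with one more
factor `p`. -/
theorem pow_smul_dvOne (n i : ℕ) : p ^ i • E.dvOne n i = 0 := by
  induction n generalizing i with
  | zero => rw [dvOne_level_zero, smul_zero]
  | succ n ih =>
    cases i with
    | zero => rw [dvOne_zero, smul_zero]
    | succ i => rw [pow_succ, mul_smul, ← V_dvOne, ← map_nsmul, ih, map_zero]

theorem V_mul_dvOne (n i : ℕ) (x : E.obj n) :
    E.V n x * E.dvOne (n + 1) (i + 1) = E.V n (x * E.dvOne n i) := by
  rw [V_mul, F_dvOne]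

theorem scalar_natCast_mul (n k : ℕ) (x : E.obj n) : E.scalar n k * x = k • x := by
  rw [map_natCast, nsmul_eq_mul]

/-- Write `s = s 0 + V(t)`. Then `V(t) dV^(j+1)(1) = V(t dV^j(1))`, which by induction is `t j ·
V(dV^j(1)) = p t j · dV^(j+1)(1)`, and `s 0 + p t j` is the next entry of `s`. -/
theorem ofGhost_mul_dvOne (n : ℕ) (s : GhostRing p n) (j : Fin n) :
    E.ofGhost n s * E.dvOne n j.1 = E.scalar n (s.1 j) * E.dvOne n j.1 := by
  induction n with
  | zero => exact j.elim0
  | succ n ih =>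
    obtain ⟨t, ht⟩ := exists_eq_const_add_ver s
    cases j using Fin.cases with
    | zero => rw [Fin.val_zero, dvOne_zero, mul_zero, mul_zero]
    | succ j =>
      conv_lhs => rw [ht]
      have h : s.1 j.succ = s.1 0 + p * t.1 j := by
        conv_lhs => rw [ht]
        rfl
      rw [map_add, ofGhost_const, ← V_ofGhost, add_mul, Fin.val_succ, V_mul_dvOne, ih,
        ← E.scalar_mul_V _ _ _ (E.dvOne_mem n j), V_dvOne, h, map_add, add_mul,
        mul_comm (p : ZLoc p), map_mul, mul_assoc, scalar_natCast_mul]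

theorem vOne_eq_zero {n i : ℕ} (h : n ≤ i) : E.vOne n i = 0 := by
  induction n generalizing i with
  | zero => exact E.level_zero.elim _ _
  | succ n ih =>
    obtain ⟨i, rfl⟩ := Nat.exists_eq_add_of_le' (Nat.one_le_of_lt h)
    exact (congrArg (E.V n) (ih (by omega))).trans (map_zero _)

theorem dvOne_eq_zero {n i : ℕ} (h : n ≤ i) : E.dvOne n i = 0 := by
  rw [dvOne, vOne_eq_zero E h, map_zero]

theorem d_dvOne (n i : ℕ) : E.d n (E.dvOne n i) = 0 := E.d_d n _

/-- `V^i(1) dV^j(1)` is a scalar multiple of `dV^j(1)`, hence closed; its differential is the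
product in question. -/
theorem dvOne_mul_dvOne (n i j : ℕ) : E.dvOne n i * E.dvOne n j = 0 := by
  rcases lt_or_ge j n with hj | hj
  · have h := E.d_mul n 0 (E.vOne n i) (E.dvOne n j) (E.vOne_mem n i)
    rw [d_dvOne, mul_zero, mul_zero, add_zero, ← ofGhost_vOne,
      E.ofGhost_mul_dvOne n _ ⟨j, hj⟩, d_scalar_mul, d_dvOne, mul_zero, ofGhost_vOne] at h
    exact h.symm
  · rw [dvOne_eq_zero E hj, mul_zero]

theorem d_ofGhost (n : ℕ) (s : GhostRing p n) : E.d n (E.ofGhost n s) =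
    ∑ j : Fin n, E.scalar n (diffQuot s j) * E.dvOne n j.1 := by
  cases n with
  | zero => exact E.level_zero.elim _ _
  | succ n =>
    conv_lhs => rw [eq_const_add_sum s]
    rw [map_add, map_add, ofGhost_const, d_scalar, zero_add, map_sum, map_sum, Fin.sum_univ_succ,
      Fin.val_zero, dvOne_zero, mul_zero, zero_add]
    refine Finset.sum_congr rfl fun j _ => ?_
    rw [map_mul, ofGhost_const, ofGhost_vOne, d_scalar_mul, Fin.val_succ, dvOne]

/-! Products of the elements `V^i(1)` and `dV^i(1)`. -/

theorem vOne_mul_vOne (n : ℕ) {i j : ℕ} (h : i ≤ j) :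
    E.vOne n i * E.vOne n j = p ^ i • E.vOne n j := by
  induction n generalizing i j with
  | zero => exact E.level_zero.elim _ _
  | succ n ih =>
    cases i with
    | zero => rw [pow_zero, one_smul]; exact one_mul _
    | succ i =>
      obtain ⟨j, rfl⟩ := Nat.exists_eq_add_of_le' (Nat.one_le_of_lt h)
      rw [← V_vOne, ← V_vOne, V_mul_V, ih (Nat.succ_le_succ_iff.1 h), map_nsmul, smul_smul,
        pow_succ']

theorem vOne_mul_dvOne (n : ℕ) {i j : ℕ} (h : i < j) :
    E.vOne n i * E.dvOne n j = p ^ i • E.dvOne n j := by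
  induction n generalizing i j with
  | zero => exact E.level_zero.elim _ _
  | succ n ih =>
    cases i with
    | zero => rw [pow_zero, one_smul]; exact one_mul _
    | succ i =>
      obtain ⟨j, rfl⟩ := Nat.exists_eq_add_of_le' (Nat.one_le_of_lt h)
      rw [← V_vOne, V_mul_dvOne, ih (Nat.succ_lt_succ_iff.1 h), map_nsmul, V_dvOne, smul_smul,
        pow_succ]

theorem vOne_mul_dvOne_of_le (n : ℕ) {i j : ℕ} (h : j ≤ i) :
    E.vOne n i * E.dvOne n j = 0 := by
  induction n generalizing i j with
  | zero => exact E.level_zero.elim _ _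
  | succ n ih =>
    cases j with
    | zero => rw [dvOne_zero, mul_zero]
    | succ j =>
      obtain ⟨i, rfl⟩ := Nat.exists_eq_add_of_le' (Nat.one_le_of_lt h)
      rw [← V_vOne, V_mul_dvOne, ih (Nat.succ_le_succ_iff.1 h), map_zero]

/-- The map `ℤ/p^k → E_n` with `1 ↦ x`, where `x` is killed by `p^k`. -/
def torsionMap {E : WittComplex.{v} p (ZLoc p)} {n k : ℕ} (x : E.obj n) (h : p ^ k • x = 0) :
    ZMod (p ^ k) →+ E.obj n :=
  ZMod.lift (p ^ k) ⟨zmultiplesHom _ x, by rw [zmultiplesHom_apply, natCast_zsmul, h]⟩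

theorem torsionMap_red {n k : ℕ} (x : E.obj n) (h : p ^ k • x = 0) (a : ZLoc p) :
    torsionMap x h (ZLoc.red p k a) = E.scalar n a * x := by
  obtain ⟨y, hy⟩ := ZMod.intCast_surjective (ZLoc.red p k a)
  rw [← hy, torsionMap, ZMod.lift_coe]
  rw [← map_intCast (ZLoc.red p k), ZLoc.red_eq_iff] at hy
  obtain ⟨b, hb⟩ := hy
  have e : a = y - b * ((p ^ k : ℕ) : ZLoc p) := by
    push_cast
    linear_combination -hb
  rw [e, map_sub, map_mul, sub_mul, mul_assoc, scalar_natCast_mul, h, mul_zero, sub_zero,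
    map_intCast, zmultiplesHom_apply, zsmul_eq_mul]

end WittComplex

/-! ### Maps out of the Witt complex of a `WittModule` -/

namespace WittModule

open SqZeroExt GhostRing WittComplex

variable {p : ℕ} [Fact p.Prime] (D : WittModule p)

/-- A map from the Witt complex of a `WittModule` to a Witt complex `E`, given in degree one. -/
structure DegreeOneMap (E : WittComplex.{v} p (ZLoc p)) where
  /-- the map in degree one -/
  ψ : ∀ n, D.N n →+ E.obj n
  mem : ∀ n m, ψ n m ∈ E.gr n 1
  smul : ∀ n s m, ψ n (s • m) = E.ofGhost n s * ψ n m
  mul : ∀ n m m', ψ n m * ψ n m' = 0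
  map_R : ∀ n m, ψ n (D.R n m) = E.R n (ψ (n + 1) m)
  map_d : ∀ n s, ψ n (D.d n s) = E.d n (E.ofGhost n s)
  d_map : ∀ n m, E.d n (ψ n m) = 0
  map_F : ∀ n m, ψ n (D.F n m) = E.F n (ψ (n + 1) m)
  map_V : ∀ n m, ψ (n + 1) (D.V n m) = E.V n (ψ n m)

namespace DegreeOneMap

variable {D} {E : WittComplex.{v} p (ZLoc p)} (f : D.DegreeOneMap E)

/-- The map of rings of level `n`. -/
def ringHom (n : ℕ) : SqZeroExt.{v} (GhostRing p n) (D.N n) →+* E.obj n where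
  toFun x := E.ofGhost n x.fst + f.ψ n x.snd
  map_zero' := by rw [fst_zero, snd_zero, map_zero, map_zero, add_zero]
  map_one' := by rw [fst_one, snd_one, map_zero, map_one, add_zero]
  map_add' x y := by rw [fst_add, snd_add, map_add, map_add, add_add_add_comm]
  map_mul' x y := by
    rw [fst_mul, snd_mul, map_mul, map_add, f.smul, f.smul,
      mul_comm_of_mem_zero (E.ofGhost_mem n y.fst) (f.mem n x.snd), mul_add, add_mul, add_mul,
      f.mul, add_zero]
    abel

/-- The map of Witt complexes determined by its part of degree one. -/
def hom : WittComplex.Hom D.toWittComplex E where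
  map n := f.ringHom n
  map_mem n q x hx := by
    match q with
    | 0 =>
      have h : x.snd = 0 := hx
      change E.ofGhost n x.fst + f.ψ n x.snd ∈ _
      rw [h, map_zero, add_zero]
      exact E.ofGhost_mem n _
    | 1 =>
      have h : x.fst = 0 := hx
      change E.ofGhost n x.fst + f.ψ n x.snd ∈ _
      rw [h, map_zero, zero_add]
      exact f.mem n _
    | q + 2 =>
      have h : x = (0 : SqZeroExt.{v} (GhostRing p n) (D.N n)) := hx
      have h' : f.ringHom n x = 0 := by rw [h, map_zero]
      exact h'.symm ▸ zero_mem (E.gr n (q + 2))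
  map_R n x := by
    change E.ofGhost n (res p n x.fst) + f.ψ n (D.R n x.snd) =
      E.R n (E.ofGhost (n + 1) x.fst + f.ψ (n + 1) x.snd)
    rw [map_add, R_ofGhost, f.map_R]
  map_lam n x := by
    change E.ofGhost n (equiv p n x) + f.ψ n 0 = E.lam n x
    rw [map_zero, add_zero, ofGhost_equiv]
  map_d n x := by
    change E.ofGhost n 0 + f.ψ n (D.d n x.fst) = E.d n (E.ofGhost n x.fst + f.ψ n x.snd)
    rw [map_zero, zero_add, f.map_d, map_add, f.d_map, add_zero]
  map_F n x := by
    change E.ofGhost n (frob p n x.fst) + f.ψ n (D.F n x.snd) =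
      E.F n (E.ofGhost (n + 1) x.fst + f.ψ (n + 1) x.snd)
    rw [map_add, F_ofGhost, f.map_F]
  map_V n x := by
    change E.ofGhost (n + 1) (ver p n x.fst) + f.ψ (n + 1) (D.V n x.snd) =
      E.V n (E.ofGhost n x.fst + f.ψ n x.snd)
    rw [map_add, V_ofGhost, f.map_V]

end DegreeOneMap

theorem hom_apply_inl {E : WittComplex.{v} p (ZLoc p)} (g : WittComplex.Hom D.toWittComplex E)
    (n : ℕ) (s : GhostRing p n) : g.map n (inl s) = E.ofGhost n s := by
  have h := g.map_lam n ((equiv p n).symm s)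
  have e : D.toWittComplex.lam n ((equiv p n).symm s) = inl s :=
    congrArg (inl : _ →+* SqZeroExt.{v} (GhostRing p n) (D.N n)) ((equiv p n).apply_symm_apply s)
  rw [e] at h
  exact h

/-- Compatibility with `λ` fixes a map in degree zero, so only degree one has to be compared. -/
theorem hom_ext {E : WittComplex.{v} p (ZLoc p)} {g h : WittComplex.Hom D.toWittComplex E}
    (H : ∀ n m, g.map n (inr m) = h.map n (inr m)) : g = h := by
  refine WittComplex.Hom.ext (funext fun n => RingHom.ext fun x => ?_)
  have e : x = inl x.fst + inr x.snd := eq_inl_add_inr x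
  rw [e]
  have h1 : ∀ k : WittComplex.Hom D.toWittComplex E, k.map n (inl x.fst + inr x.snd) =
      k.map n (inl x.fst) + k.map n (inr x.snd) := fun k => map_add _ _ _
  rw [h1, h1, hom_apply_inl, hom_apply_inl, H]

theorem dvOne_eq_inr (n i : ℕ) : D.toWittComplex.{v}.dvOne n i =
    (inr (D.d n (GhostRing.vOne p n i)) : SqZeroExt.{v} (GhostRing p n) (D.N n)) := by
  rw [dvOne, ← ofGhost_vOne]
  change inr (D.d n (equiv p n ((equiv p n).symm (GhostRing.vOne p n i)))) = _
  rw [RingEquiv.apply_symm_apply]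

end WittModule

namespace WittComplex.Hom

variable {p : ℕ} [Fact p.Prime] {A : Type u} [CommRing A] {D E : WittComplex.{v} p A}

theorem map_vOne (f : WittComplex.Hom D E) (n i : ℕ) : f.map n (D.vOne n i) = E.vOne n i := by
  induction n generalizing i with
  | zero => exact E.level_zero.elim _ _
  | succ n ih =>
    cases i with
    | zero => exact map_one _
    | succ i => exact (f.map_V n _).trans (congrArg (E.V n) (ih i))

theorem map_dvOne (f : WittComplex.Hom D E) (n i : ℕ) : f.map n (D.dvOne n i) = E.dvOne n i := by
  rw [WittComplex.dvOne, f.map_d, map_vOne, WittComplex.dvOne]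

end WittComplex.Hom

/-! ### The de Rham-Witt complex of `ℤ_(p)` -/

/-- The group `W_n Ω^1` of `ℤ_(p)`. -/
def DRWOne (p n : ℕ) : Type := (j : Fin n) → ZMod (p ^ j.1)

namespace DRWOne

open ZLoc GhostRing

variable {p : ℕ} {n : ℕ}

instance : CommRing (DRWOne p n) := inferInstanceAs (CommRing ((j : Fin n) → ZMod (p ^ j.1)))

@[ext] theorem ext {m m' : DRWOne p n} (h : ∀ j, m j = m' j) : m = m' := funext h

@[simp] theorem zero_apply (j : Fin n) : (0 : DRWOne p n) j = 0 := rfl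

/-- The component at index `0` is `ℤ/p^0 = 0`. It is kept so that component `j` belongs both to
`dV^j(1)` and to the ghost entry `j`. -/
theorem eq_at_zero {h : 0 < n} (a b : ZMod (p ^ (⟨0, h⟩ : Fin n).1)) : a = b :=
  Subsingleton.elim (α := ZMod 1) a b

variable [Fact p.Prime]

/-- The reduction map from sequences in `ℤ_(p)`. -/
def redHom (p n : ℕ) [Fact p.Prime] : (Fin n → ZLoc p) →+* DRWOne p n :=
  RingHom.pi fun j => (red p j.1).comp (Pi.evalRingHom _ j)

theorem redHom_apply (a : Fin n → ZLoc p) (j : Fin n) : redHom p n a j = red p j.1 (a j) := rfl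

theorem redHom_surjective : Function.Surjective (redHom p n) := fun m =>
  ⟨fun j => (red_surjective j.1 (m j)).choose, funext fun j =>
    (red_surjective j.1 (m j)).choose_spec⟩

instance : Module (GhostRing p n) (DRWOne p n) :=
  Module.compHom _ ((redHom p n).comp (GhostRing p n).subtype)

theorem smul_redHom (s : GhostRing p n) (a : Fin n → ZLoc p) :
    s • redHom p n a = redHom p n (s.1 * a) := (map_mul (redHom p n) s.1 a).symm

/-- Restriction. -/
def R (p n : ℕ) : DRWOne p (n + 1) →+ DRWOne p n where
  toFun m j := m j.castSucc
  map_zero' := rfl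
  map_add' _ _ := rfl

theorem R_redHom (a : Fin (n + 1) → ZLoc p) :
    R p n (redHom p (n + 1) a) = redHom p n fun j => a j.castSucc := rfl

/-- Frobenius. -/
def F (p n : ℕ) : DRWOne p (n + 1) →+ DRWOne p n where
  toFun m j := trans p j.1 (m j.succ)
  map_zero' := funext fun _ => map_zero _
  map_add' _ _ := funext fun _ => map_add _ _ _

theorem F_redHom (a : Fin (n + 1) → ZLoc p) :
    F p n (redHom p (n + 1) a) = redHom p n fun j => a j.succ :=
  funext fun j => trans_red j.1 (a j.succ)

/-- Verschiebung. -/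
def V (p n : ℕ) : DRWOne p n →+ DRWOne p (n + 1) where
  toFun m := Fin.cases 0 fun j => mulP p j.1 (m j)
  map_zero' := funext fun j => by
    cases j using Fin.cases with
    | zero => rfl
    | succ j => exact map_zero (mulP p j.1)
  map_add' _ _ := funext fun j => by
    cases j using Fin.cases with
    | zero => exact (add_zero _).symm
    | succ j => exact map_add (mulP p j.1) _ _

theorem V_redHom (a : Fin n → ZLoc p) :
    V p n (redHom p n a) = redHom p (n + 1) (Fin.cases 0 fun j => p * a j) := funext fun j => by
  cases j using Fin.cases with
  | zero => exact (map_zero (red p 0)).symm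
  | succ j => exact mulP_red j.1 (a j)

theorem redHom_eq {a b : Fin n → ZLoc p}
    (h : ∀ i (hi : i + 1 < n), (p : ZLoc p) ^ (i + 1) ∣ a ⟨i + 1, hi⟩ - b ⟨i + 1, hi⟩) :
    redHom p n a = redHom p n b := funext fun j => by
  obtain ⟨_ | i, hi⟩ := j
  · exact eq_at_zero _ _
  · exact (red_eq_iff _ _ _).2 (h i hi)

theorem p_smul_redHom (a : Fin n → ZLoc p) : p • redHom p n a = redHom p n fun j => p * a j := by
  rw [← map_nsmul]
  congr 1
  funext j
  exact nsmul_eq_mul _ _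

/-- The differential. -/
def d (p : ℕ) [Fact p.Prime] (n : ℕ) : GhostRing p n →+ DRWOne p n where
  toFun s := redHom p n (diffQuot s)
  map_zero' := funext fun j => by
    have h : diffQuot (0 : GhostRing p n) j = 0 := by
      rw [← map_zero (const p n), diffQuot_const]
    rw [redHom_apply, h, map_zero, zero_apply]
  map_add' s t := by
    rw [← map_add]
    exact congrArg _ (funext fun j => diffQuot_add s t j)

theorem d_apply (s : GhostRing p n) : d p n s = redHom p n (diffQuot s) := rfl

theorem d_mul (s t : GhostRing p n) : d p n (s * t) = s • d p n t + t • d p n s := by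
  rw [d_apply, d_apply, d_apply, smul_redHom, smul_redHom, ← map_add]
  refine redHom_eq fun i hi => ?_
  rw [diffQuot_mul]
  change _ ∣ _ - (s.1 ⟨i + 1, hi⟩ * diffQuot t ⟨i + 1, hi⟩ +
    t.1 ⟨i + 1, hi⟩ * diffQuot s ⟨i + 1, hi⟩)
  rw [add_sub_add_left_eq_sub, ← sub_mul, ← dvd_neg, ← neg_mul, neg_sub]
  exact (t.2 i hi).mul_right _

end DRWOne

/-- The data giving the de Rham-Witt complex of `ℤ_(p)`. -/
def drw (p : ℕ) [Fact p.Prime] (hp : p ≠ 2) : WittModule p where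
  N := DRWOne p
  subsingleton := ⟨fun _ _ => funext fun j => j.elim0⟩
  R := DRWOne.R p
  R_smul n s m := rfl
  F := DRWOne.F p
  F_smul n s m := by
    obtain ⟨a, rfl⟩ := DRWOne.redHom_surjective m
    rw [DRWOne.smul_redHom, DRWOne.F_redHom, DRWOne.F_redHom, DRWOne.smul_redHom]
    rfl
  R_F n m := rfl
  V := DRWOne.V p
  R_V n m := funext fun j => by cases j using Fin.cases <;> rfl
  ver_smul n s m := by
    obtain ⟨a, rfl⟩ := DRWOne.redHom_surjective m
    rw [DRWOne.smul_redHom, DRWOne.F_redHom, DRWOne.smul_redHom, DRWOne.V_redHom]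
    refine congrArg _ (funext fun j => ?_)
    cases j using Fin.cases with
    | zero => exact zero_mul _
    | succ j => exact mul_assoc _ _ _
  smul_V n s m := by
    obtain ⟨a, rfl⟩ := DRWOne.redHom_surjective m
    rw [DRWOne.V_redHom, DRWOne.smul_redHom, DRWOne.smul_redHom, DRWOne.V_redHom]
    refine congrArg _ (funext fun j => ?_)
    cases j using Fin.cases with
    | zero => exact mul_zero _
    | succ j => exact mul_left_comm _ _ _
  F_V n m := by
    obtain ⟨a, rfl⟩ := DRWOne.redHom_surjective m
    rw [DRWOne.V_redHom, DRWOne.F_redHom, DRWOne.p_smul_redHom]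
    rfl
  d := DRWOne.d p
  d_mul n := DRWOne.d_mul
  R_d n s := by
    rw [DRWOne.d_apply, DRWOne.R_redHom, DRWOne.d_apply]
    exact congrArg _ (funext fun j => (GhostRing.diffQuot_res s j).symm)
  F_d_ver n s := by
    rw [DRWOne.d_apply, DRWOne.F_redHom, DRWOne.d_apply]
    refine DRWOne.redHom_eq fun i hi => ?_
    have h : GhostRing.diffQuot (GhostRing.ver p n s) (Fin.succ ⟨i + 1, hi⟩) = _ :=
      GhostRing.diffQuot_ver_succ s i hi
    rw [h, sub_self]
    exact dvd_zero _
  F_d_teich n a := by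
    rw [DRWOne.d_apply, DRWOne.F_redHom, DRWOne.d_apply, DRWOne.smul_redHom]
    exact DRWOne.redHom_eq fun i hi =>
      GhostRing.dvd_diffQuot_teich (n := n + 1) hp a i (Nat.succ_lt_succ hi)

namespace GhostRing

variable {p : ℕ} [Fact p.Prime]

/-- `diffQuot` reads off coefficients in the basis `V^i(1)`; this makes `dV^j(1)` the `j`-th
standard generator of `DRWOne`. -/
theorem diffQuot_vOne (n i k : ℕ) (h : k + 1 < n) :
    diffQuot (vOne p n i) ⟨k + 1, h⟩ = if i = k + 1 then 1 else 0 := by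
  induction n generalizing i k with
  | zero => exact absurd h (Nat.not_lt_zero _)
  | succ n ih =>
    cases i with
    | zero =>
      have e : vOne p (n + 1) 0 = const p (n + 1) 1 := (map_one _).symm
      rw [e, diffQuot_const, if_neg (Nat.succ_ne_zero k).symm]
    | succ i =>
      cases k with
      | zero =>
        have e := diffQuot_ver_one (vOne p n i) (Nat.lt_of_succ_lt_succ h)
        refine e.trans ?_
        cases n with
        | zero => omega
        | succ n => cases i <;> rfl
      | succ k =>
        have e := diffQuot_ver_succ (vOne p n i) k (Nat.lt_of_succ_lt_succ h)
        refine e.trans ((ih i k _).trans ?_)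
        simp only [Nat.succ_inj]

end GhostRing

namespace DRWOne

open GhostRing ZLoc

variable {p : ℕ} [Fact p.Prime] {n : ℕ}

theorem d_vOne (j : Fin n) : d p n (GhostRing.vOne p n j.1) =
    (Pi.single j 1 : (j : Fin n) → ZMod (p ^ j.1)) := by
  have e : (Pi.single j 1 : (j : Fin n) → ZMod (p ^ j.1)) =
      redHom p n (Pi.single j 1) := funext fun k => by
    rw [redHom_apply]
    rcases eq_or_ne k j with rfl | h
    · rw [Pi.single_eq_same, Pi.single_eq_same, map_one]
    · rw [Pi.single_eq_of_ne h, Pi.single_eq_of_ne h, map_zero]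
  rw [e, d_apply]
  refine redHom_eq fun i hi => ?_
  rw [diffQuot_vOne]
  have : (Pi.single j 1 : Fin n → ZLoc p) ⟨i + 1, hi⟩ = if j.1 = i + 1 then 1 else 0 := by
    split_ifs with h
    · have : j = ⟨i + 1, hi⟩ := Fin.ext h
      subst this
      exact Pi.single_eq_same _ _
    · exact Pi.single_eq_of_ne (fun h' => h (congrArg Fin.val h').symm) _
  rw [this, sub_self]
  exact dvd_zero _

theorem addHom_ext {X : Type*} [AddCommGroup X] {f g : DRWOne p n →+ X}
    (h : ∀ i, f (d p n (GhostRing.vOne p n i)) = g (d p n (GhostRing.vOne p n i))) : f = g := by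
  let f' : ((j : Fin n) → ZMod (p ^ j.1)) →+ X := f
  let g' : ((j : Fin n) → ZMod (p ^ j.1)) →+ X := g
  change f' = g'
  refine AddMonoidHom.functions_ext _ _ _ fun j x => ?_
  obtain ⟨k, rfl⟩ := ZMod.intCast_surjective x
  have e : Pi.single j (k : ZMod (p ^ j.1)) =
      k • (Pi.single j 1 : (j : Fin n) → ZMod (p ^ j.1)) := by
    rw [← Pi.single_smul, zsmul_one]
  rw [e, map_zsmul, map_zsmul, ← d_vOne]
  exact congrArg _ (h j.1)

end DRWOne

/-! ### Universality of the model for `ℤ_(p)` -/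

namespace WittComplex

open GhostRing DRWOne

variable {p : ℕ} [Fact p.Prime] (E : WittComplex.{v} p (ZLoc p))

/-- The map in degree one from the de Rham-Witt complex of `ℤ_(p)`. -/
def psi (n : ℕ) : DRWOne p n →+ E.obj n :=
  ∑ j : Fin n, (torsionMap (E.dvOne n j.1) (E.pow_smul_dvOne n j.1)).comp
    (Pi.evalAddMonoidHom (fun j : Fin n => ZMod (p ^ j.1)) j)

theorem psi_redHom (n : ℕ) (a : Fin n → ZLoc p) :
    E.psi n (redHom p n a) = ∑ j : Fin n, E.scalar n (a j) * E.dvOne n j.1 := by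
  rw [psi, AddMonoidHom.finsetSum_apply]
  exact Finset.sum_congr rfl fun j _ => torsionMap_red E _ (E.pow_smul_dvOne n j.1) _

theorem psi_mem (n : ℕ) (m : DRWOne p n) : E.psi n m ∈ E.gr n 1 := by
  obtain ⟨a, rfl⟩ := redHom_surjective m
  rw [psi_redHom]
  exact sum_mem fun j _ => E.mul_mem n 0 1 _ _ (E.scalar_mem n _) (E.dvOne_mem n _)

theorem psi_smul (n : ℕ) (s : GhostRing p n) (m : DRWOne p n) :
    E.psi n (s • m) = E.ofGhost n s * E.psi n m := by
  obtain ⟨a, rfl⟩ := redHom_surjective m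
  rw [smul_redHom, psi_redHom, psi_redHom, Finset.mul_sum]
  refine Finset.sum_congr rfl fun j _ => ?_
  rw [← mul_assoc, ← mul_comm_of_mem_zero (E.scalar_mem n _) (E.ofGhost_mem n s), mul_assoc,
    ofGhost_mul_dvOne, ← mul_assoc, ← map_mul, Pi.mul_apply, mul_comm]

theorem psi_mul_psi (n : ℕ) (m m' : DRWOne p n) : E.psi n m * E.psi n m' = 0 := by
  obtain ⟨a, rfl⟩ := redHom_surjective m
  obtain ⟨b, rfl⟩ := redHom_surjective m'
  rw [psi_redHom, psi_redHom, Finset.sum_mul_sum]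
  refine Finset.sum_eq_zero fun i _ => Finset.sum_eq_zero fun j _ => ?_
  rw [mul_assoc, ← mul_assoc (E.dvOne n i.1),
    ← mul_comm_of_mem_zero (E.scalar_mem n _) (E.dvOne_mem n i.1), mul_assoc, dvOne_mul_dvOne,
    mul_zero, mul_zero]

theorem psi_R (n : ℕ) (m : DRWOne p (n + 1)) :
    E.psi n (DRWOne.R p n m) = E.R n (E.psi (n + 1) m) := by
  obtain ⟨a, rfl⟩ := redHom_surjective m
  rw [R_redHom, psi_redHom, psi_redHom, map_sum, Fin.sum_univ_castSucc]
  simp only [map_mul, R_scalar, R_dvOne, Fin.val_last, Fin.val_castSucc]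
  -- The component forgotten by restriction belongs to `dV^n(1)`, which is already zero at level
  -- `n`.
  rw [dvOne_eq_zero E le_rfl, mul_zero, add_zero]

theorem psi_d (n : ℕ) (s : GhostRing p n) :
    E.psi n (DRWOne.d p n s) = E.d n (E.ofGhost n s) := by
  rw [d_apply, psi_redHom, d_ofGhost]

theorem d_psi (n : ℕ) (m : DRWOne p n) : E.d n (E.psi n m) = 0 := by
  obtain ⟨a, rfl⟩ := redHom_surjective m
  rw [psi_redHom, map_sum]
  exact Finset.sum_eq_zero fun j _ => by rw [d_scalar_mul, d_dvOne, mul_zero]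

theorem psi_F (n : ℕ) (m : DRWOne p (n + 1)) :
    E.psi n (DRWOne.F p n m) = E.F n (E.psi (n + 1) m) := by
  obtain ⟨a, rfl⟩ := redHom_surjective m
  rw [F_redHom, psi_redHom, psi_redHom, map_sum, Fin.sum_univ_succ]
  simp only [map_mul, F_scalar, Fin.val_succ, Fin.val_zero, F_dvOne, dvOne_zero, map_zero,
    mul_zero, zero_add]

theorem psi_V (n : ℕ) (m : DRWOne p n) :
    E.psi (n + 1) (DRWOne.V p n m) = E.V n (E.psi n m) := by
  obtain ⟨a, rfl⟩ := redHom_surjective m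
  rw [V_redHom, psi_redHom, psi_redHom, map_sum, Fin.sum_univ_succ, Fin.val_zero, dvOne_zero,
    mul_zero, zero_add]
  refine Finset.sum_congr rfl fun j _ => ?_
  rw [← E.scalar_mul_V _ _ _ (E.dvOne_mem n j), V_dvOne, Fin.cases_succ, mul_comm (p : ZLoc p),
    map_mul, mul_assoc, scalar_natCast_mul, Fin.val_succ]

theorem psi_d_vOne (n i : ℕ) : E.psi n (DRWOne.d p n (GhostRing.vOne p n i)) = E.dvOne n i := by
  rw [psi_d, ofGhost_vOne, dvOne]

end WittComplex

/-- The map from the de Rham-Witt complex of `ℤ_(p)` to a Witt complex, in degree one. -/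
def drwMap {p : ℕ} [Fact p.Prime] (hp : p ≠ 2) (E : WittComplex.{v} p (ZLoc p)) :
    (drw p hp).DegreeOneMap E where
  ψ := E.psi
  mem := E.psi_mem
  smul := E.psi_smul
  mul := E.psi_mul_psi
  map_R := E.psi_R
  map_d := E.psi_d
  d_map := E.d_psi
  map_F := E.psi_F
  map_V := E.psi_V

/-- The elements `dV^i(1)` generate degree one additively, and every map of Witt complexes preserves
them. -/
theorem drw_hom_ext {p : ℕ} [Fact p.Prime] (hp : p ≠ 2) {E : WittComplex.{v} p (ZLoc p)}
    (g h : WittComplex.Hom (drw p hp).toWittComplex E) : g = h := by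
  refine WittModule.hom_ext _ fun n => ?_
  have key : ((g.map n).toAddMonoidHom.comp
        (SqZeroExt.inr : (drw p hp).N n →+ SqZeroExt.{v} (GhostRing p n) ((drw p hp).N n))) =
      ((h.map n).toAddMonoidHom.comp
        (SqZeroExt.inr : (drw p hp).N n →+ SqZeroExt.{v} (GhostRing p n) ((drw p hp).N n))) :=
    DRWOne.addHom_ext fun i => by
      have e := (drw p hp).dvOne_eq_inr.{v} n i
      have e1 := g.map_dvOne n i
      have e2 := h.map_dvOne n i
      rw [e] at e1 e2
      exact e1.trans e2.symm
  exact DFunLike.congr_fun key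

/-- The de Rham-Witt complex of `ℤ_(p)` is initial. -/
def drwIsInitial (p : ℕ) [Fact p.Prime] (hp : p ≠ 2) :
    IsInitial ((drw p hp).toWittComplex : WittComplex.{v} p (ZLoc p)) :=
  IsInitial.ofUniqueHom (fun E => (drwMap hp E).hom) fun _ _ => drw_hom_ext hp _ _

/-! ### The logarithmic de Rham-Witt complex of `ℤ_(p)` -/

namespace GhostRing

open ZLoc

variable {p : ℕ} [Fact p.Prime] {n : ℕ}

/-- The last entry of a sequence (zero if there is none). -/
def lastVal : ∀ {n : ℕ}, GhostRing p n → ZLoc p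
  | 0, _ => 0
  | n + 1, s => s.1 (Fin.last n)

theorem p_dvd_sub (s : GhostRing p n) (i j : Fin n) : (p : ZLoc p) ∣ s.1 i - s.1 j := by
  cases n with
  | zero => exact i.elim0
  | succ n =>
    have h := dvd_sub (p_dvd_sub_zero s i) (p_dvd_sub_zero s j)
    rwa [sub_sub_sub_cancel_right] at h

theorem p_dvd_lastVal_sub (s : GhostRing p n) (i : Fin n) :
    (p : ZLoc p) ∣ lastVal s - s.1 i := by
  cases n with
  | zero => exact i.elim0
  | succ n => exact p_dvd_sub s _ i

theorem lastVal_add (s t : GhostRing p n) : lastVal (s + t) = lastVal s + lastVal t := by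
  cases n with
  | zero => exact (add_zero _).symm
  | succ n => rfl

theorem lastVal_mul (s t : GhostRing p n) : lastVal (s * t) = lastVal s * lastVal t := by
  cases n with
  | zero => exact (mul_zero _).symm
  | succ n => rfl

/-- Only a congruence, because `lastVal` is `0` by default at level `0`. As a scalar on `dlog [p]_n`
it matters only modulo `p^n`, so the default is harmless. -/
theorem pow_dvd_lastVal_one_sub : (p : ZLoc p) ^ n ∣ lastVal (1 : GhostRing p n) - 1 := by
  cases n with
  | zero => exact ⟨-1, by rw [pow_zero, one_mul]; exact zero_sub 1⟩
  | succ n => exact ⟨0, by rw [mul_zero]; exact sub_self 1⟩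

theorem pow_dvd_lastVal_res_sub (s : GhostRing p (n + 1)) :
    (p : ZLoc p) ^ n ∣ lastVal s - lastVal (res p n s) := by
  cases n with
  | zero => rw [pow_zero]; exact one_dvd _
  | succ n => exact s.2 n _

theorem pow_dvd_lastVal_frob_sub (s : GhostRing p (n + 1)) :
    (p : ZLoc p) ^ n ∣ lastVal s - lastVal (frob p n s) := by
  cases n with
  | zero => rw [pow_zero]; exact one_dvd _
  | succ n => exact ⟨0, by rw [mul_zero]; exact sub_self _⟩

theorem lastVal_ver (s : GhostRing p n) : lastVal (ver p n s) = p * lastVal s := by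
  cases n with
  | zero => exact (mul_zero _).symm
  | succ n => rfl

/-- Coefficients describing the product of `s` and `dlog [p]`, up to a multiple of `dlog [p]`. -/
def logCoeff (s : GhostRing p n) : Fin n → ZLoc p
  | ⟨0, _⟩ => 0
  -- Expand `s` in the `V^k(1)`. Apart from its multiple of `dlog [p]`, the product `V^k(1) dlog
  -- [p]` is `p^(k-1) dV^k(1) + p^(p-3+k) dV^(k+1)(1)`; the terms `k = i + 1` and `k = i` contribute
  -- here.
  | ⟨i + 1, h⟩ => p ^ i * (diffQuot s ⟨i + 1, h⟩ +
      p ^ (p - 3) * diffQuot s ⟨i, i.lt_succ_self.trans h⟩)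

theorem logCoeff_succ (s : GhostRing p n) (i : ℕ) (h : i + 1 < n) :
    logCoeff s ⟨i + 1, h⟩ = p ^ i * (diffQuot s ⟨i + 1, h⟩ +
      p ^ (p - 3) * diffQuot s ⟨i, i.lt_succ_self.trans h⟩) := rfl

theorem logCoeff_add (s t : GhostRing p n) (j : Fin n) :
    logCoeff (s + t) j = logCoeff s j + logCoeff t j := by
  obtain ⟨_ | i, h⟩ := j
  · exact (add_zero _).symm
  · rw [logCoeff_succ, logCoeff_succ, logCoeff_succ, diffQuot_add, diffQuot_add]
    ring

theorem logCoeff_const (a : ZLoc p) (j : Fin n) : logCoeff (const p n a) j = 0 := by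
  obtain ⟨_ | i, h⟩ := j
  · rfl
  · rw [logCoeff_succ, diffQuot_const, diffQuot_const, mul_zero, add_zero, mul_zero]

theorem p_dvd_diffQuot_mul_sub (s t : GhostRing p n) (k j : Fin n) :
    (p : ZLoc p) ∣ diffQuot (s * t) j - (s.1 k * diffQuot t j + t.1 k * diffQuot s j) := by
  obtain ⟨_ | i, h⟩ := j
  · rw [diffQuot_zero, diffQuot_zero, diffQuot_zero]
    simp
  · rw [diffQuot_mul, add_sub_add_comm, ← sub_mul, ← sub_mul]
    exact dvd_add ((p_dvd_sub s _ _).mul_right _) ((p_dvd_sub t _ _).mul_right _)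

/-- The cocycle identity behind associativity of the action on `dlog [p]`. The prefactor `p^i`
reduces it to a statement modulo `p`, where all entries of a sequence coincide and `diffQuot` is a
derivation. -/
theorem dvd_logCoeff_mul_sub (s t : GhostRing p n) (i : ℕ) (h : i + 1 < n) :
    (p : ZLoc p) ^ (i + 1) ∣ logCoeff (s * t) ⟨i + 1, h⟩ -
      (s.1 ⟨i + 1, h⟩ * logCoeff t ⟨i + 1, h⟩ + lastVal t * logCoeff s ⟨i + 1, h⟩) := by
  rw [logCoeff_succ, logCoeff_succ, logCoeff_succ, pow_succ]
  obtain ⟨a, ha⟩ := p_dvd_diffQuot_mul_sub s t ⟨i + 1, h⟩ ⟨i + 1, h⟩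
  obtain ⟨b, hb⟩ := p_dvd_diffQuot_mul_sub s t ⟨i + 1, h⟩ ⟨i, i.lt_succ_self.trans h⟩
  obtain ⟨c, hc⟩ := p_dvd_lastVal_sub t ⟨i + 1, h⟩
  refine ⟨a + p ^ (p - 3) * b - c * (diffQuot s ⟨i + 1, h⟩ +
    p ^ (p - 3) * diffQuot s ⟨i, i.lt_succ_self.trans h⟩), ?_⟩
  linear_combination (p : ZLoc p) ^ i * ha + (p : ZLoc p) ^ i * p ^ (p - 3) * hb -
    (p : ZLoc p) ^ i * (diffQuot s ⟨i + 1, h⟩ +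
      p ^ (p - 3) * diffQuot s ⟨i, i.lt_succ_self.trans h⟩) * hc

theorem logCoeff_res (s : GhostRing p (n + 1)) (j : Fin n) :
    logCoeff (res p n s) j = logCoeff s j.castSucc := by
  obtain ⟨_ | i, h⟩ := j
  · rfl
  · rw [logCoeff_succ, diffQuot_res, diffQuot_res]
    rfl

/-- Equality holds except at `i = 0`, where the convention `diffQuot s 0 = 0` for the Frobenius
image loses a multiple of `p`. -/
theorem dvd_logCoeff_frob_sub (s : GhostRing p (n + 1)) (i : ℕ) (h : i + 1 < n) :
    (p : ZLoc p) ^ (i + 1) ∣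
      logCoeff s ⟨i + 2, Nat.succ_lt_succ h⟩ - logCoeff (frob p n s) ⟨i + 1, h⟩ := by
  rw [logCoeff_succ, logCoeff_succ, diffQuot_frob]
  cases i with
  | zero =>
    rw [diffQuot_zero]
    exact ⟨p ^ (p - 3) * diffQuot s ⟨1, by omega⟩, by ring⟩
  | succ i =>
    rw [diffQuot_frob]
    exact ⟨0, by ring⟩

/-- The coefficients of `V(dlog [p]) - p dlog [p]`. -/
def verCoeff (p : ℕ) [Fact p.Prime] (n : ℕ) : Fin n → ZLoc p
  | ⟨0, _⟩ => 0
  | ⟨1, _⟩ => 1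
  -- Zero modulo `p^2` unless `p = 3`; keeping it treats all odd primes uniformly.
  | ⟨2, _⟩ => p ^ (p - 2)
  | ⟨_ + 3, _⟩ => 0

/-- The coefficient form of `V(s) dlog [p] = V(s dlog [p])`. At the two lowest indices `diffQuot` of
`V(s)` involves `s 0`, which may be replaced by the last entry modulo `p`; from index `3` on the
identity is exact. -/
theorem dvd_logCoeff_ver_sub (hp : p ≠ 2) (s : GhostRing p n) (i : ℕ) (h : i + 1 < n + 1) :
    (p : ZLoc p) ^ (i + 1) ∣ logCoeff (ver p n s) ⟨i + 1, h⟩ -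
      (p * logCoeff s ⟨i, Nat.lt_of_succ_lt_succ h⟩ +
        lastVal s * verCoeff p (n + 1) ⟨i + 1, h⟩) := by
  have hp3 : 3 ≤ p := by have := (Fact.out : p.Prime).two_le; omega
  have hpow : (p : ZLoc p) ^ (p - 2) = p * p ^ (p - 3) := by
    rw [← pow_succ']; congr 1; omega
  rw [logCoeff_succ]
  match i with
  | 0 =>
    rw [diffQuot_ver_one s (by omega), diffQuot_zero]
    obtain ⟨a, ha⟩ := p_dvd_lastVal_sub s ⟨0, Nat.lt_of_succ_lt_succ h⟩
    refine ⟨-a, ?_⟩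
    change _ - (_ * 0 + _ * 1) = _
    linear_combination -ha
  | 1 =>
    rw [diffQuot_ver_succ s 0 (by omega), diffQuot_ver_one s (by omega), logCoeff_succ, diffQuot_zero]
    obtain ⟨a, ha⟩ := p_dvd_lastVal_sub s ⟨0, by omega⟩
    refine ⟨-a * p ^ (p - 3), ?_⟩
    change _ - (_ + _ * (p : ZLoc p) ^ (p - 2)) = _
    rw [hpow]
    linear_combination -(p : ZLoc p) * p ^ (p - 3) * ha
  | i + 2 =>
    rw [diffQuot_ver_succ s (i + 1) (by omega), diffQuot_ver_succ s i (by omega), logCoeff_succ]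
    refine ⟨0, ?_⟩
    change _ - (_ + _ * 0) = _
    ring

/-- Responsible for `F V dlog [p] = p dlog [p]`; it rests on `p ∣ p^(p-2)` for odd `p`. -/
theorem dvd_verCoeff_succ (hp : p ≠ 2) (i : ℕ) (h : i + 2 < n) :
    (p : ZLoc p) ^ (i + 1) ∣ verCoeff p n ⟨i + 2, h⟩ := by
  have hp3 : 3 ≤ p := by have := (Fact.out : p.Prime).two_le; omega
  match i with
  | 0 => exact pow_dvd_pow _ (by omega)
  | i + 1 => exact dvd_zero _

/-- Needed for `s V(dlog [p]) = V(F(s) dlog [p])`: the two scalars agree modulo `p`, and `verCoeff`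
at index `i + 1` provides the factor `p^i`. -/
theorem dvd_mul_verCoeff_sub (hp : p ≠ 2) (s : GhostRing p (n + 1)) (i : ℕ) (h : i + 1 < n + 1) :
    (p : ZLoc p) ^ (i + 1) ∣ (s.1 ⟨i + 1, h⟩ - lastVal (frob p n s)) *
      verCoeff p (n + 1) ⟨i + 1, h⟩ := by
  have h1 : (p : ZLoc p) ∣ s.1 ⟨i + 1, h⟩ - lastVal (frob p n s) := by
    rw [← dvd_neg, neg_sub]
    exact p_dvd_lastVal_sub (frob p n s) ⟨i, Nat.lt_of_succ_lt_succ h⟩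
  match i with
  | 0 => exact (pow_one (p : ZLoc p)).symm ▸ h1.mul_right _
  | i + 1 => rw [pow_succ']; exact mul_dvd_mul h1 (dvd_verCoeff_succ hp i h)

end GhostRing

/-! ### The module of logarithmic forms -/

/-- The group `W_n Ω^1` of `ℤ_(p)` with its canonical log structure. -/
def LogDRWOne (p n : ℕ) : Type := DRWOne p n × ZMod (p ^ n)

namespace LogDRWOne

open ZLoc GhostRing

variable {p n : ℕ}

instance : AddCommGroup (LogDRWOne p n) := inferInstanceAs (AddCommGroup (DRWOne p n × ZMod (p ^ n)))

theorem fst_add (x y : LogDRWOne p n) : (x + y).1 = x.1 + y.1 := rfl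
theorem snd_add (x y : LogDRWOne p n) : (x + y).2 = x.2 + y.2 := rfl

variable [Fact p.Prime]

/-- The diagonal action of `ℤ/p^n`. -/
def diag (p n k : ℕ) (h : k ≤ n + 1) : ZMod (p ^ n) →+* DRWOne p k :=
  RingHom.pi fun j : Fin k => ZMod.castHom (pow_dvd_pow p (by omega : j.1 ≤ n)) (ZMod (p ^ j.1))

theorem diag_red (k : ℕ) (h : k ≤ n + 1) (b : ZLoc p) :
    diag p n k h (red p n b) = DRWOne.redHom p k fun _ => b := funext fun j =>
  RingHom.congr_fun (ringHom_ext ((ZMod.castHom (pow_dvd_pow p (by omega : j.1 ≤ n))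
    (ZMod (p ^ j.1))).comp (red p n)) (red p j.1)) b

/-- The class of a family of coefficients. -/
def mk (a : Fin n → ZLoc p) (b : ZLoc p) : LogDRWOne p n := (DRWOne.redHom p n a, red p n b)

theorem exists_mk_eq (x : LogDRWOne p n) : ∃ a b, mk a b = x := by
  obtain ⟨a, ha⟩ := DRWOne.redHom_surjective x.1
  obtain ⟨b, hb⟩ := red_surjective n x.2
  exact ⟨a, b, Prod.ext ha hb⟩

theorem mk_eq {a a' : Fin n → ZLoc p} {b b' : ZLoc p}
    (h : ∀ i (hi : i + 1 < n), (p : ZLoc p) ^ (i + 1) ∣ a ⟨i + 1, hi⟩ - a' ⟨i + 1, hi⟩)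
    (hb : (p : ZLoc p) ^ n ∣ b - b') : mk a b = mk a' b' :=
  Prod.ext (DRWOne.redHom_eq h) ((red_eq_iff _ _ _).2 hb)

theorem mk_add_mk (a a' : Fin n → ZLoc p) (b b' : ZLoc p) :
    mk a b + mk a' b' = mk (a + a') (b + b') :=
  Prod.ext (map_add _ _ _).symm (map_add _ _ _).symm

theorem nsmul_mk (k : ℕ) (a : Fin n → ZLoc p) (b : ZLoc p) :
    k • mk a b = mk (k • a) (k • b) :=
  Prod.ext (map_nsmul _ _ _).symm (map_nsmul _ _ _).symm

/-- The action is triangular: it is the old one on the first summand, and it sends `dlog [p]` to its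
multiple by the last ghost entry plus the correction `logCoeff s`. -/
instance : SMul (GhostRing p n) (LogDRWOne p n) :=
  ⟨fun s x => (s • x.1 + diag p n n n.le_succ x.2 * DRWOne.redHom p n (logCoeff s),
    red p n (lastVal s) * x.2)⟩

theorem smul_mk (s : GhostRing p n) (a : Fin n → ZLoc p) (b : ZLoc p) :
    s • mk a b = mk (fun j => s.1 j * a j + b * logCoeff s j) (lastVal s * b) := by
  refine Prod.ext ?_ (map_mul _ _ _).symm
  change s • DRWOne.redHom p n a + diag p n n n.le_succ (red p n b) * _ = _
  rw [diag_red, DRWOne.smul_redHom, ← map_mul, ← map_add]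
  rfl

instance : Module (GhostRing p n) (LogDRWOne p n) where
  one_smul x := by
    obtain ⟨a, b, rfl⟩ := exists_mk_eq x
    rw [smul_mk]
    refine mk_eq (fun i hi => ?_) ?_
    · rw [← map_one (const p n), logCoeff_const, const_val, one_mul, mul_zero, add_zero, sub_self]
      exact dvd_zero _
    · rw [← sub_one_mul]
      exact pow_dvd_lastVal_one_sub.mul_right _
  mul_smul s t x := by
    obtain ⟨a, b, rfl⟩ := exists_mk_eq x
    rw [smul_mk, smul_mk, smul_mk]
    refine mk_eq (fun i hi => ?_) ?_
    · obtain ⟨c, hc⟩ := dvd_logCoeff_mul_sub s t i hi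
      refine ⟨b * c, ?_⟩
      rw [mul_val]
      linear_combination b * hc
    · rw [lastVal_mul, mul_assoc, sub_self]
      exact dvd_zero _
  smul_zero s := by
    have h : (0 : LogDRWOne p n) = mk 0 0 := Prod.ext (map_zero _).symm (map_zero _).symm
    rw [h, smul_mk]
    exact mk_eq (fun i hi => by simp) (by simp)
  smul_add s x y := by
    obtain ⟨a, b, rfl⟩ := exists_mk_eq x
    obtain ⟨a', b', rfl⟩ := exists_mk_eq y
    rw [mk_add_mk, smul_mk, smul_mk, smul_mk, mk_add_mk]
    refine mk_eq (fun i hi => ⟨0, ?_⟩) ⟨0, by ring⟩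
    simp only [Pi.add_apply]
    ring
  add_smul s t x := by
    obtain ⟨a, b, rfl⟩ := exists_mk_eq x
    rw [smul_mk, smul_mk, smul_mk, mk_add_mk]
    refine mk_eq (fun i hi => ⟨0, ?_⟩) ⟨0, ?_⟩
    · simp only [Pi.add_apply, add_val, logCoeff_add]
      ring
    · rw [lastVal_add]
      ring
  zero_smul x := by
    obtain ⟨a, b, rfl⟩ := exists_mk_eq x
    have h : (0 : LogDRWOne p n) = mk 0 0 := Prod.ext (map_zero _).symm (map_zero _).symm
    rw [h, smul_mk]
    refine mk_eq (fun i hi => ?_) ?_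
    · rw [← map_zero (const p n), logCoeff_const, const_val]
      simp
    · have : lastVal (0 : GhostRing p n) = 0 := by cases n <;> rfl
      rw [this]
      simp

/-- Restriction. -/
def R (p : ℕ) [Fact p.Prime] (n : ℕ) : LogDRWOne p (n + 1) →+ LogDRWOne p n :=
  AddMonoidHom.prodMap (DRWOne.R p n) (trans p n).toAddMonoidHom

theorem R_mk (a : Fin (n + 1) → ZLoc p) (b : ZLoc p) :
    R p n (mk a b) = mk (fun j => a j.castSucc) b := Prod.ext rfl (trans_red n b)

/-- Frobenius. -/
def F (p : ℕ) [Fact p.Prime] (n : ℕ) : LogDRWOne p (n + 1) →+ LogDRWOne p n :=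
  AddMonoidHom.prodMap (DRWOne.F p n) (trans p n).toAddMonoidHom

theorem F_mk (a : Fin (n + 1) → ZLoc p) (b : ZLoc p) :
    F p n (mk a b) = mk (fun j => a j.succ) b := Prod.ext (DRWOne.F_redHom a) (trans_red n b)

/-- Verschiebung. -/
def V (p : ℕ) [Fact p.Prime] (n : ℕ) : LogDRWOne p n →+ LogDRWOne p (n + 1) where
  toFun x := (DRWOne.V p n x.1 + diag p n (n + 1) le_rfl x.2 *
    DRWOne.redHom p (n + 1) (verCoeff p (n + 1)), mulP p n x.2)
  map_zero' := Prod.ext (by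
    change DRWOne.V p n 0 + diag p n (n + 1) le_rfl 0 * _ = 0
    rw [map_zero, map_zero, zero_mul, add_zero]) (map_zero (mulP p n))
  map_add' x y := Prod.ext (by
    change _ = (DRWOne.V p n x.1 + _) + (DRWOne.V p n y.1 + _)
    rw [fst_add, snd_add, map_add, map_add, add_mul, add_add_add_comm])
    (map_add (mulP p n) x.2 y.2)

theorem V_mk (a : Fin n → ZLoc p) (b : ZLoc p) :
    V p n (mk a b) = mk (fun j => (Fin.cases 0 (fun j => p * a j) j : ZLoc p) +
      b * verCoeff p (n + 1) j) (p * b) := by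
  refine Prod.ext ?_ (mulP_red n b)
  change DRWOne.V p n (DRWOne.redHom p n a) + diag p n (n + 1) le_rfl (red p n b) * _ = _
  rw [diag_red, DRWOne.V_redHom, ← map_mul, ← map_add]
  rfl

/-- The inclusion of the part without logarithmic poles. -/
def incl (p n : ℕ) : DRWOne p n →+ LogDRWOne p n := AddMonoidHom.inl _ _

theorem incl_redHom (a : Fin n → ZLoc p) : incl p n (DRWOne.redHom p n a) = mk a 0 :=
  Prod.ext rfl (map_zero _).symm

theorem incl_smul (s : GhostRing p n) (m : DRWOne p n) : incl p n (s • m) = s • incl p n m := by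
  obtain ⟨a, rfl⟩ := DRWOne.redHom_surjective m
  rw [DRWOne.smul_redHom, incl_redHom, incl_redHom, smul_mk]
  refine mk_eq (fun i hi => ⟨0, ?_⟩) ⟨0, by ring⟩
  simp only [Pi.mul_apply]
  ring

theorem R_incl (m : DRWOne p (n + 1)) : R p n (incl p (n + 1) m) = incl p n (DRWOne.R p n m) :=
  Prod.ext rfl (map_zero (trans p n))

theorem F_incl (m : DRWOne p (n + 1)) : F p n (incl p (n + 1) m) = incl p n (DRWOne.F p n m) :=
  Prod.ext rfl (map_zero (trans p n))

end LogDRWOne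

/-- The data giving the de Rham-Witt complex of `ℤ_(p)` with its canonical log structure. -/
def logDrw (p : ℕ) [Fact p.Prime] (hp : p ≠ 2) : WittModule p where
  N := LogDRWOne p
  subsingleton := ⟨fun x y => Prod.ext (funext fun j => j.elim0)
    (Subsingleton.elim (α := ZMod 1) x.2 y.2)⟩
  R := LogDRWOne.R p
  R_smul n s x := by
    obtain ⟨a, b, rfl⟩ := LogDRWOne.exists_mk_eq x
    rw [LogDRWOne.smul_mk, LogDRWOne.R_mk, LogDRWOne.R_mk, LogDRWOne.smul_mk]
    refine LogDRWOne.mk_eq (fun i hi => ⟨0, ?_⟩) ?_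
    · rw [GhostRing.logCoeff_res, GhostRing.res_val]
      ring
    · rw [← sub_mul]
      exact (GhostRing.pow_dvd_lastVal_res_sub s).mul_right _
  F := LogDRWOne.F p
  F_smul n s x := by
    obtain ⟨a, b, rfl⟩ := LogDRWOne.exists_mk_eq x
    rw [LogDRWOne.smul_mk, LogDRWOne.F_mk, LogDRWOne.F_mk, LogDRWOne.smul_mk]
    refine LogDRWOne.mk_eq (fun i hi => ?_) ?_
    · rw [GhostRing.frob_val, add_sub_add_left_eq_sub, ← mul_sub]
      exact (GhostRing.dvd_logCoeff_frob_sub s i hi).mul_left _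
    · rw [← sub_mul]
      exact (GhostRing.pow_dvd_lastVal_frob_sub s).mul_right _
  R_F n x := by
    obtain ⟨a, b, rfl⟩ := LogDRWOne.exists_mk_eq x
    rw [LogDRWOne.F_mk, LogDRWOne.R_mk, LogDRWOne.R_mk, LogDRWOne.F_mk]
    rfl
  V := LogDRWOne.V p
  R_V n x := by
    obtain ⟨a, b, rfl⟩ := LogDRWOne.exists_mk_eq x
    rw [LogDRWOne.V_mk, LogDRWOne.R_mk, LogDRWOne.R_mk, LogDRWOne.V_mk]
    refine LogDRWOne.mk_eq (fun i hi => ⟨0, ?_⟩) ⟨0, by ring⟩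
    rw [mul_zero, sub_eq_zero]
    have h : GhostRing.verCoeff p (n + 2) (Fin.castSucc ⟨i + 1, hi⟩) =
        GhostRing.verCoeff p (n + 1) ⟨i + 1, hi⟩ := by
      match i with
      | 0 => rfl
      | 1 => rfl
      | i + 2 => rfl
    rw [h]
    rfl
  ver_smul n s x := by
    obtain ⟨a, b, rfl⟩ := LogDRWOne.exists_mk_eq x
    rw [LogDRWOne.F_mk, LogDRWOne.smul_mk, LogDRWOne.smul_mk, LogDRWOne.V_mk]
    refine LogDRWOne.mk_eq (fun i hi => ?_) ⟨0, ?_⟩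
    · obtain ⟨c, hc⟩ := GhostRing.dvd_logCoeff_ver_sub hp s i hi
      refine ⟨b * c, ?_⟩
      change (p : ZLoc p) * s.1 ⟨i, Nat.lt_of_succ_lt_succ hi⟩ * a ⟨i + 1, hi⟩ + _ -
        (p * (s.1 ⟨i, Nat.lt_of_succ_lt_succ hi⟩ * a ⟨i + 1, hi⟩ +
          b * GhostRing.logCoeff s ⟨i, Nat.lt_of_succ_lt_succ hi⟩) + _) = _
      linear_combination b * hc
    · rw [GhostRing.lastVal_ver]
      ring
  smul_V n s x := by
    obtain ⟨a, b, rfl⟩ := LogDRWOne.exists_mk_eq x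
    rw [LogDRWOne.V_mk, LogDRWOne.smul_mk, LogDRWOne.smul_mk, LogDRWOne.V_mk]
    refine LogDRWOne.mk_eq (fun i hi => ?_) ?_
    · obtain ⟨c, hc⟩ := GhostRing.dvd_mul_verCoeff_sub hp s i hi
      -- The Frobenius congruence at index `i` only gives `p^i`; the factor `p` coming from `V`
      -- supplies the missing power.
      have h : (p : ZLoc p) ^ (i + 1) ∣ p * (GhostRing.logCoeff s ⟨i + 1, hi⟩ -
          GhostRing.logCoeff (GhostRing.frob p n s) ⟨i, Nat.lt_of_succ_lt_succ hi⟩) := by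
        rw [pow_succ']
        refine mul_dvd_mul_left _ ?_
        cases i with
        | zero => rw [pow_zero]; exact one_dvd _
        | succ i => exact GhostRing.dvd_logCoeff_frob_sub s i (Nat.lt_of_succ_lt_succ hi)
      obtain ⟨e, he⟩ := h
      refine ⟨b * c + b * e, ?_⟩
      change s.1 ⟨i + 1, hi⟩ * (p * a ⟨i, Nat.lt_of_succ_lt_succ hi⟩ + _) + _ -
        (p * (s.1 ⟨i + 1, hi⟩ * a ⟨i, Nat.lt_of_succ_lt_succ hi⟩ +
          b * GhostRing.logCoeff (GhostRing.frob p n s) ⟨i, Nat.lt_of_succ_lt_succ hi⟩) + _) = _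
      linear_combination b * hc + b * he
    · obtain ⟨c, hc⟩ := GhostRing.pow_dvd_lastVal_frob_sub s
      refine ⟨c * b, ?_⟩
      rw [pow_succ]
      linear_combination (p : ZLoc p) * b * hc
  F_V n x := by
    obtain ⟨a, b, rfl⟩ := LogDRWOne.exists_mk_eq x
    rw [LogDRWOne.V_mk, LogDRWOne.F_mk, LogDRWOne.nsmul_mk]
    refine LogDRWOne.mk_eq (fun i hi => ?_) ⟨0, by rw [nsmul_eq_mul]; ring⟩
    change _ ∣ (p : ZLoc p) * a ⟨i + 1, hi⟩ + b * GhostRing.verCoeff p (n + 1)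
      ⟨i + 2, Nat.succ_lt_succ hi⟩ - p • a ⟨i + 1, hi⟩
    rw [nsmul_eq_mul, add_sub_cancel_left]
    exact (GhostRing.dvd_verCoeff_succ hp i _).mul_left _
  d n := (LogDRWOne.incl p n).comp (DRWOne.d p n)
  d_mul n s t := by
    change LogDRWOne.incl p n (DRWOne.d p n (s * t)) = s • LogDRWOne.incl p n (DRWOne.d p n t) +
      t • LogDRWOne.incl p n (DRWOne.d p n s)
    rw [DRWOne.d_mul, map_add, LogDRWOne.incl_smul, LogDRWOne.incl_smul]
  R_d n s := (LogDRWOne.R_incl _).trans (congrArg (LogDRWOne.incl p n) ((drw p hp).R_d n s))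
  F_d_ver n s := (LogDRWOne.F_incl _).trans (congrArg (LogDRWOne.incl p n) ((drw p hp).F_d_ver n s))
  F_d_teich n a := (LogDRWOne.F_incl _).trans
    ((congrArg (LogDRWOne.incl p n) ((drw p hp).F_d_teich n a)).trans (LogDRWOne.incl_smul _ _))

/-! ### Valuations, and `dlog` on the logarithmic model -/

namespace ZLoc

variable {p : ℕ} [Fact p.Prime]

theorem not_isUnit_p : ¬ IsUnit (p : ZLoc p) := by
  intro h
  have h1 : red p 1 (p : ZLoc p) = 0 := (red_eq_zero_iff 1 _).2 (by rw [pow_one])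
  have h2 := h.map (red p 1)
  have : Fact (1 < p ^ 1) := ⟨by rw [pow_one]; exact (Fact.out : p.Prime).one_lt⟩
  rw [h1] at h2
  exact not_isUnit_zero h2

theorem exists_eq_pow_mul_unit {a : ZLoc p} (ha : a ≠ 0) :
    ∃ (k : ℕ) (u : (ZLoc p)ˣ), a = (p : ZLoc p) ^ k * u := by
  obtain ⟨x, m, hm, h⟩ := exists_mul_intCast_eq a
  have hx : x ≠ 0 := by
    rintro rfl
    rw [Int.cast_zero] at h
    exact ha ((isUnit_intCast hm).mul_left_eq_zero.1 h)
  have hfin : FiniteMultiplicity (p : ℤ) x :=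
    Int.finiteMultiplicity_iff.2 ⟨by simpa using (Fact.out : p.Prime).ne_one, hx⟩
  obtain ⟨y, hy, hyp⟩ := hfin.exists_eq_pow_mul_and_not_dvd
  refine ⟨multiplicity (p : ℤ) x, (isUnit_intCast hyp).unit * (isUnit_intCast hm).unit⁻¹, ?_⟩
  rw [Units.val_mul, ← mul_assoc, Units.eq_mul_inv_iff_mul_eq, IsUnit.unit_spec, IsUnit.unit_spec,
    h]
  conv_lhs => rw [hy]
  push_cast
  rfl

theorem pow_mul_unit_injective {k l : ℕ} {u w : (ZLoc p)ˣ}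
    (h : (p : ZLoc p) ^ k * u = (p : ZLoc p) ^ l * w) : k = l ∧ u = w := by
  have key : ∀ {k l : ℕ} {u w : (ZLoc p)ˣ}, (p : ZLoc p) ^ k * u = (p : ZLoc p) ^ l * w →
      l ≤ k := by
    intro k l u w h
    by_contra! hkl
    obtain ⟨r, rfl⟩ := Nat.exists_eq_add_of_lt hkl
    rw [add_assoc, pow_add, mul_assoc] at h
    have h1 := mul_left_cancel₀ (pow_p_ne_zero k) h
    rw [pow_succ', mul_assoc] at h1
    exact not_isUnit_p (isUnit_of_dvd_unit ⟨_, h1⟩ u.isUnit)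
  have hkl := le_antisymm (key h.symm) (key h)
  subst hkl
  exact ⟨rfl, Units.ext (mul_left_cancel₀ (pow_p_ne_zero k) h)⟩

/-- The `p`-adic valuation. -/
def val (a : ZLocMonoid p) : ℕ := (exists_eq_pow_mul_unit (nonZeroDivisors.ne_zero a.2)).choose

/-- The quotient of an element by the largest power of `p` dividing it. -/
def unitPart (a : ZLocMonoid p) : (ZLoc p)ˣ :=
  (exists_eq_pow_mul_unit (nonZeroDivisors.ne_zero a.2)).choose_spec.choose

theorem eq_pow_val_mul (a : ZLocMonoid p) : a.1 = (p : ZLoc p) ^ val a * unitPart a :=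
  (exists_eq_pow_mul_unit (nonZeroDivisors.ne_zero a.2)).choose_spec.choose_spec

/-- Uniqueness of the factorisation makes the chosen valuation and unit part multiplicative. -/
theorem val_unitPart_eq {a : ZLocMonoid p} {k : ℕ} {u : (ZLoc p)ˣ}
    (h : a.1 = (p : ZLoc p) ^ k * u) : val a = k ∧ unitPart a = u :=
  pow_mul_unit_injective ((eq_pow_val_mul a).symm.trans h)

theorem val_unitPart_one : val (1 : ZLocMonoid p) = 0 ∧ unitPart (1 : ZLocMonoid p) = 1 :=
  val_unitPart_eq (by simp)

theorem val_unitPart_mul (a b : ZLocMonoid p) :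
    val (a * b) = val a + val b ∧ unitPart (a * b) = unitPart a * unitPart b :=
  val_unitPart_eq (by
    rw [Submonoid.coe_mul, eq_pow_val_mul a, eq_pow_val_mul b, Units.val_mul]
    ring)

theorem val_unitPart_p : val ⟨(p : ZLoc p), natCast_mem_ZLocMonoid p⟩ = 1 ∧
    unitPart ⟨(p : ZLoc p), natCast_mem_ZLocMonoid p⟩ = 1 :=
  val_unitPart_eq (by simp)

theorem add_two_le_pow (hp : p ≠ 2) {i : ℕ} (hi : 1 ≤ i) : i + 2 ≤ p ^ i := by
  have hp3 : 3 ≤ p := by have := (Fact.out : p.Prime).two_le; omega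
  induction i, hi using Nat.le_induction with
  | base => rw [pow_one]; exact hp3
  | succ i hi ih => rw [pow_succ]; nlinarith

/-- For `j = i + 1 ≥ 3` this says `p^(j-1) - j ≥ j`, so `d[p]` has no component at `dV^j(1)`. -/
theorem two_mul_le_pow (hp : p ≠ 2) {i : ℕ} (hi : 2 ≤ i) : 2 * (i + 1) ≤ p ^ i := by
  have hp3 : 3 ≤ p := by have := (Fact.out : p.Prime).two_le; omega
  induction i, hi using Nat.le_induction with
  | base => nlinarith
  | succ i hi ih => rw [pow_succ]; nlinarith

end ZLoc

namespace GhostRing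

open ZLoc

variable {p : ℕ} [Fact p.Prime] {n : ℕ}

/-- Since `p^i ≥ i + 1`, no natural-number subtraction is truncated. -/
theorem diffQuot_teich_p (i : ℕ) (h : i + 1 < n) : diffQuot (teich p n (p : ZLoc p)) ⟨i + 1, h⟩ =
    (p : ZLoc p) ^ (p ^ (i + 1) - (i + 1)) - (p : ZLoc p) ^ (p ^ i - (i + 1)) := by
  have h1 : i + 1 ≤ p ^ (i + 1) := (Nat.lt_pow_self (Fact.out : p.Prime).one_lt).le
  have h2 : i + 1 ≤ p ^ i := Nat.lt_pow_self (Fact.out : p.Prime).one_lt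
  refine diffQuot_eq ?_
  rw [mul_sub, ← pow_add, ← pow_add, Nat.add_sub_cancel' h1, Nat.add_sub_cancel' h2]
  rfl

/-- The relation `[p] dlog [p] = d[p]` in coordinates. At index `1` both sides are equal. At index
`2` both are `-p^(p-2)` modulo `p^2`, which is where the second summand of `logCoeff` is needed.
From index `3` on both vanish. -/
theorem dvd_logCoeff_teich_p_sub (hp : p ≠ 2) (i : ℕ) (h : i + 1 < n) : (p : ZLoc p) ^ (i + 1) ∣
    logCoeff (teich p n (p : ZLoc p)) ⟨i + 1, h⟩ - diffQuot (teich p n (p : ZLoc p)) ⟨i + 1, h⟩ := by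
  have hp3 : 3 ≤ p := by have := (Fact.out : p.Prime).two_le; omega
  rw [logCoeff_succ]
  match i with
  | 0 =>
    rw [diffQuot_zero, mul_zero, add_zero, pow_zero, one_mul, sub_self]
    exact dvd_zero _
  | 1 =>
    obtain ⟨q, rfl⟩ : ∃ q, p = q + 3 := ⟨p - 3, by omega⟩
    rw [diffQuot_teich_p, diffQuot_teich_p]
    obtain ⟨r, hr⟩ : ∃ r, (q + 3) ^ (1 + 1) = r + 4 := ⟨(q + 3) ^ (1 + 1) - 4, by
      have : (q + 3) ^ (1 + 1) = q * q + 6 * q + 9 := by ring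
      omega⟩
    rw [hr]
    generalize ((q + 3 : ℕ) : ZLoc (q + 3)) = P
    simp only [pow_one, pow_zero, zero_add, Nat.reduceAdd, Nat.reduceSubDiff, Nat.add_sub_cancel]
    exact ⟨P ^ (r + 1) - P ^ q + P ^ (q + q + 1) - P ^ r, by ring⟩
  | i + 2 =>
    have h1 : i + 2 + 1 ≤ p ^ (i + 1) := add_two_le_pow hp (by omega)
    have h2 : 2 * (i + 2 + 1) ≤ p ^ (i + 2) := two_mul_le_pow hp (by omega)
    have h3 : p ^ (i + 2) ≤ p ^ (i + 2 + 1) := Nat.pow_le_pow_right (by omega) (by omega)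
    have h4 : i + 2 + 1 ≤ p ^ (i + 2) := by omega
    have hd : (p : ZLoc p) ^ (i + 2 + 1) ∣ diffQuot (teich p n (p : ZLoc p)) ⟨i + 2 + 1, h⟩ := by
      rw [diffQuot_teich_p]
      exact dvd_sub (pow_dvd_pow _ (by omega)) (pow_dvd_pow _ (by omega))
    have hd' : (p : ZLoc p) ^ (i + 2 + 1) ∣ (p : ZLoc p) ^ (i + 2) *
        diffQuot (teich p n (p : ZLoc p)) ⟨i + 2, by omega⟩ := by
      rw [diffQuot_spec]
      exact dvd_sub (pow_dvd_pow _ h4) (pow_dvd_pow _ h1)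
    refine dvd_sub ?_ hd
    rw [mul_add, mul_left_comm]
    exact dvd_add (hd.mul_left _) (hd'.mul_left _)

theorem pow_dvd_lastVal_teich_p : (p : ZLoc p) ^ n ∣ lastVal (teich p n (p : ZLoc p)) := by
  cases n with
  | zero => rw [pow_zero]; exact one_dvd _
  | succ n => exact pow_dvd_pow _ (Nat.lt_pow_self (Fact.out : p.Prime).one_lt)

/-- The Teichmüller representative of a unit. -/
def teichUnit (p : ℕ) [Fact p.Prime] (n : ℕ) : (ZLoc p)ˣ →* (GhostRing p n)ˣ :=
  Units.map (teich p n)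

theorem teichUnit_val (u : (ZLoc p)ˣ) : (teichUnit p n u : GhostRing p n) = teich p n u := rfl

end GhostRing

namespace LogDRWOne

open ZLoc GhostRing

variable {p : ℕ} [Fact p.Prime] {n : ℕ}

/-- The differential. -/
def d (p : ℕ) [Fact p.Prime] (n : ℕ) : GhostRing p n →+ LogDRWOne p n :=
  (incl p n).comp (DRWOne.d p n)

theorem d_mul (s t : GhostRing p n) : d p n (s * t) = s • d p n t + t • d p n s := by
  change incl p n (DRWOne.d p n (s * t)) = s • incl p n (DRWOne.d p n t) +
    t • incl p n (DRWOne.d p n s)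
  rw [DRWOne.d_mul, map_add, incl_smul, incl_smul]

/-- The element `dlog [p]`. -/
def dlogP (p : ℕ) [Fact p.Prime] (n : ℕ) : LogDRWOne p n := (0, 1)

theorem dlogP_eq_mk : dlogP p n = mk 0 1 := Prod.ext (map_zero _).symm (map_one _).symm

/-- The multiple of `dlog [p]` itself disappears, because the last entry of `[p]` is zero modulo
`p^n`. -/
theorem teich_p_smul_dlogP (hp : p ≠ 2) :
    teich p n (p : ZLoc p) • dlogP p n = d p n (teich p n (p : ZLoc p)) := by
  change _ = incl p n (DRWOne.redHom p n _)
  rw [dlogP_eq_mk, smul_mk, incl_redHom]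
  refine mk_eq (fun i hi => ?_) ?_
  · rw [Pi.zero_apply, mul_zero, zero_add, one_mul]
    exact dvd_logCoeff_teich_p_sub hp i hi
  · rw [mul_one, sub_zero]
    exact pow_dvd_lastVal_teich_p

/-- The logarithmic derivative of a unit. -/
def unitDlog (p : ℕ) [Fact p.Prime] (n : ℕ) (u : (ZLoc p)ˣ) : LogDRWOne p n :=
  ((teichUnit p n u)⁻¹ : (GhostRing p n)ˣ).1 • d p n (teich p n u)

theorem teich_smul_unitDlog (u : (ZLoc p)ˣ) :
    teich p n u • unitDlog p n u = d p n (teich p n u) := by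
  rw [unitDlog, smul_smul, ← teichUnit_val, Units.mul_inv, one_smul]

theorem smul_teich_injective (u : (ZLoc p)ˣ) {x y : LogDRWOne p n}
    (h : teich p n u • x = teich p n u • y) : x = y := by
  have h1 := congrArg (fun z => ((teichUnit p n u)⁻¹ : (GhostRing p n)ˣ).1 • z) h
  simpa only [smul_smul, ← teichUnit_val, Units.inv_mul, one_smul] using h1

theorem unitDlog_mul (u w : (ZLoc p)ˣ) :
    unitDlog p n (u * w) = unitDlog p n u + unitDlog p n w := by
  refine smul_teich_injective (u * w) ?_
  rw [teich_smul_unitDlog, Units.val_mul, map_mul, d_mul, smul_add, mul_smul, mul_smul,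
    teich_smul_unitDlog, smul_comm, teich_smul_unitDlog, add_comm]

theorem R_d (s : GhostRing p (n + 1)) : R p n (d p (n + 1) s) = d p n (res p n s) := by
  change R p n (incl p (n + 1) (DRWOne.d p (n + 1) s)) = incl p n (DRWOne.d p n (res p n s))
  rw [R_incl, DRWOne.d_apply, DRWOne.R_redHom, DRWOne.d_apply]
  exact congrArg _ (congrArg _ (funext fun j => (GhostRing.diffQuot_res s j).symm))

/-- The logarithmic derivation. -/
def dlog (p : ℕ) [Fact p.Prime] (n : ℕ) (a : ZLocMonoid p) : LogDRWOne p n :=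
  val a • dlogP p n + unitDlog p n (unitPart a)

theorem unitDlog_one : unitDlog p n 1 = 0 := by
  have h := unitDlog_mul (p := p) (n := n) 1 1
  rw [mul_one] at h
  exact left_eq_add.1 h

theorem dlog_one : dlog p n 1 = 0 := by
  rw [dlog, val_unitPart_one.1, val_unitPart_one.2, unitDlog_one, zero_smul, add_zero]

theorem dlog_mul (a b : ZLocMonoid p) : dlog p n (a * b) = dlog p n a + dlog p n b := by
  rw [dlog, (val_unitPart_mul a b).1, (val_unitPart_mul a b).2, unitDlog_mul, add_smul, dlog, dlog,
    add_add_add_comm]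

theorem dlog_p : dlog p n ⟨(p : ZLoc p), natCast_mem_ZLocMonoid p⟩ = dlogP p n := by
  rw [dlog, val_unitPart_p.1, val_unitPart_p.2, unitDlog_one, one_smul, add_zero]

theorem d_one : d p n 1 = 0 := by
  have h := d_mul (1 : GhostRing p n) 1
  rw [mul_one, one_smul] at h
  exact left_eq_add.1 h

/-- The relation holds for `p` and for units, and the Leibniz rule carries it to products. -/
theorem teich_smul_dlog (hp : p ≠ 2) (a : ZLocMonoid p) :
    teich p n a.1 • dlog p n a = d p n (teich p n a.1) := by
  have key : ∀ k : ℕ, teich p n ((p : ZLoc p) ^ k) • (k • dlogP p n) =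
      d p n (teich p n ((p : ZLoc p) ^ k)) := by
    intro k
    induction k with
    | zero => rw [zero_smul, smul_zero, pow_zero, map_one, d_one]
    | succ k ih =>
      rw [pow_succ, map_mul, d_mul, add_smul, one_smul, smul_add, mul_smul,
        smul_comm (teich p n ((p : ZLoc p) ^ k)) (teich p n (p : ZLoc p)), ih, mul_smul,
        teich_p_smul_dlogP hp, add_comm]
  rw [dlog, eq_pow_val_mul a, map_mul, d_mul, smul_add, mul_smul, mul_smul,
    smul_comm (teich p n ((p : ZLoc p) ^ val a)) (teich p n (unitPart a : ZLoc p)), key,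
    teich_smul_unitDlog, add_comm]

theorem R_dlogP : R p n (dlogP p (n + 1)) = dlogP p n := by
  rw [dlogP_eq_mk, R_mk, dlogP_eq_mk]
  rfl

theorem F_dlogP : F p n (dlogP p (n + 1)) = dlogP p n := by
  rw [dlogP_eq_mk, F_mk, dlogP_eq_mk]
  rfl

theorem R_dlog (hp : p ≠ 2) (a : ZLocMonoid p) : R p n (dlog p (n + 1) a) = dlog p n a := by
  have h : R p n (unitDlog p (n + 1) (unitPart a)) = unitDlog p n (unitPart a) := by
    refine smul_teich_injective (unitPart a) ?_
    rw [teich_smul_unitDlog, ← res_teich]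
    have h1 := (logDrw p hp).R_smul n (teich p (n + 1) (unitPart a : ZLoc p))
      (unitDlog p (n + 1) (unitPart a))
    refine h1.symm.trans ((congrArg (R p n) (teich_smul_unitDlog _)).trans (R_d _))
  rw [dlog, map_add, map_nsmul, R_dlogP, h, dlog]

/-- For a unit `u`, `[u]^p F(dlog u) = F(d[u]) = [u]^(p-1) d[u] = [u]^p dlog u`, and `[u]^p` is
invertible. The element `dlog [p]` is fixed by construction. -/
theorem F_dlog (hp : p ≠ 2) (a : ZLocMonoid p) : F p n (dlog p (n + 1) a) = dlog p n a := by
  have h : F p n (unitDlog p (n + 1) (unitPart a)) = unitDlog p n (unitPart a) := by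
    set w := unitPart a
    have hpos : p - 1 + 1 = p := Nat.sub_add_cancel (Fact.out : p.Prime).one_le
    have h1 : frob p n (teich p (n + 1) (w : ZLoc p)) • F p n (unitDlog p (n + 1) w) =
        F p n (teich p (n + 1) (w : ZLoc p) • unitDlog p (n + 1) w) :=
      ((logDrw p hp).F_smul n _ _).symm
    have h2 : F p n (d p (n + 1) (teich p (n + 1) (w : ZLoc p))) =
        teich p n (w : ZLoc p) ^ (p - 1) • d p n (teich p n (w : ZLoc p)) :=
      (logDrw p hp).F_d_teich n _
    rw [teich_smul_unitDlog, h2, ← teich_smul_unitDlog, smul_smul, ← pow_succ, hpos, frob_teich,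
      ← map_pow, ← Units.val_pow_eq_pow_val] at h1
    exact smul_teich_injective (w ^ p) h1
  rw [dlog, map_add, map_nsmul, F_dlogP, h, dlog]

end LogDRWOne

/-- The de Rham-Witt complex of `ℤ_(p)` with its canonical log structure. -/
def logDrwComplex (p : ℕ) [Fact p.Prime] (hp : p ≠ 2) :
    LogWittComplex.{v} p (canonicalLog p) where
  toWittComplex := (logDrw p hp).toWittComplex
  mon := ULift.{v} (ZLocMonoid p)
  pre n := (SqZeroExt.inl :
      GhostRing p n →+* SqZeroExt.{v} (GhostRing p n) (LogDRWOne p n)).toMonoidHom.comp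
    ((GhostRing.teich p n).comp ((canonicalLog p).comp
      (MulEquiv.ulift : ULift.{v} (ZLocMonoid p) ≃* ZLocMonoid p).toMonoidHom))
  pre_mem n a := rfl
  R_pre n a := SqZeroExt.ext rfl (map_zero (LogDRWOne.R p n))
  lamMon := (MulEquiv.ulift : ULift.{v} (ZLocMonoid p) ≃* ZLocMonoid p).symm.toMonoidHom
  pre_lamMon n a := SqZeroExt.ext
    ((GhostRing.ghost_teichmuller a.1).symm.trans (GhostRing.equiv_truncate _).symm) rfl
  dlog n a := (SqZeroExt.inr (LogDRWOne.dlog p n a.down) :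
    SqZeroExt.{v} (GhostRing p n) (LogDRWOne p n))
  dlog_mem n a := rfl
  dlog_one n := SqZeroExt.ext rfl LogDRWOne.dlog_one
  dlog_mul n a b := SqZeroExt.ext (add_zero _).symm (LogDRWOne.dlog_mul _ _)
  pre_mul_dlog n a := SqZeroExt.ext (mul_zero _) (by
    change GhostRing.teich p n a.down.1 • LogDRWOne.dlog p n a.down +
      (0 : GhostRing p n) • (0 : LogDRWOne p n) = LogDRWOne.d p n (GhostRing.teich p n a.down.1)
    rw [smul_zero, add_zero, LogDRWOne.teich_smul_dlog hp])
  R_dlog n a := SqZeroExt.ext (map_zero (GhostRing.res p n)) (LogDRWOne.R_dlog hp _)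
  d_dlog n a := SqZeroExt.ext rfl (map_zero (LogDRWOne.d p n))
  F_dlog n a := SqZeroExt.ext (map_zero (GhostRing.frob p n)) (LogDRWOne.F_dlog hp _)

/-! ### Relations for `dlog [p]` in every logarithmic Witt complex -/

namespace WittComplex

open GhostRing

variable {p : ℕ} [Fact p.Prime] (E : WittComplex.{v} p (ZLoc p))

theorem ofGhost_teich (n : ℕ) (a : ZLoc p) : E.ofGhost n (teich p n a) =
    E.lam n (WittVector.truncate n (WittVector.teichmuller p a)) := by
  rw [← ghost_teichmuller, ofGhost_ghost]

theorem scalar_mul_psi (n : ℕ) (c : ZLoc p) (a : Fin n → ZLoc p) :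
    E.scalar n c * E.psi n (DRWOne.redHom p n a) =
      E.psi n (DRWOne.redHom p n fun j => c * a j) := by
  rw [psi_redHom, psi_redHom, Finset.mul_sum]
  exact Finset.sum_congr rfl fun j _ => by rw [map_mul, mul_assoc]

theorem psi_verCoeff (n : ℕ) : E.psi n (DRWOne.redHom p n (verCoeff p n)) =
    E.dvOne n 1 + p ^ (p - 2) • E.dvOne n 2 := by
  rw [← psi_d_vOne, ← psi_d_vOne, ← map_nsmul, ← map_add, DRWOne.d_apply, DRWOne.d_apply,
    ← map_nsmul, ← map_add]
  congr 1
  refine DRWOne.redHom_eq fun i hi => ?_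
  rw [Pi.add_apply, Pi.smul_apply, diffQuot_vOne, diffQuot_vOne, nsmul_eq_mul]
  match i with
  | 0 => simp [verCoeff]
  | 1 => simp [verCoeff]
  | i + 2 => simp [verCoeff]

end WittComplex

namespace GhostRing

variable {p : ℕ} [Fact p.Prime] {n : ℕ}

theorem redHom_logCoeff_ver (hp : p ≠ 2) (t : GhostRing p n) :
    DRWOne.redHom p (n + 1) (logCoeff (ver p n t)) =
      DRWOne.V p n (DRWOne.redHom p n (logCoeff t)) +
        DRWOne.redHom p (n + 1) fun j => lastVal t * verCoeff p (n + 1) j := by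
  rw [DRWOne.V_redHom, ← map_add]
  exact DRWOne.redHom_eq fun i hi => dvd_logCoeff_ver_sub hp t i hi

theorem logCoeff_const_add (a : ZLoc p) (s : GhostRing p n) :
    logCoeff (const p n a + s) = logCoeff s :=
  funext fun j => by rw [logCoeff_add, logCoeff_const, zero_add]

end GhostRing

namespace LogWittComplex

open GhostRing WittComplex

variable {p : ℕ} [Fact p.Prime] (E : LogWittComplex.{v} p (canonicalLog p))

theorem pre_lamMon_eq (n : ℕ) (a : ZLocMonoid p) :
    E.pre n (E.lamMon a) = E.ofGhost n (teich p n a.1) := by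
  rw [E.pre_lamMon, ofGhost_teich]
  rfl

theorem ofGhost_teich_mul_dlog (n : ℕ) (a : ZLocMonoid p) :
    E.ofGhost n (teich p n a.1) * E.dlog n (E.lamMon a) =
      E.d n (E.ofGhost n (teich p n a.1)) := by
  rw [← pre_lamMon_eq, E.pre_mul_dlog]

theorem dlogP_mem (n : ℕ) : E.dlogP n ∈ E.gr n 1 := E.dlog_mem n _

theorem F_dlogP (n : ℕ) : E.F n (E.dlogP (n + 1)) = E.dlogP n := E.F_dlog n _

theorem R_dlogP (n : ℕ) : E.R n (E.dlogP (n + 1)) = E.dlogP n := E.R_dlog n _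

theorem d_dlogP (n : ℕ) : E.d n (E.dlogP n) = 0 := E.d_dlog n _

theorem ofGhost_teich_mul_dlogP (n : ℕ) : E.ofGhost n (teich p n (p : ZLoc p)) * E.dlogP n =
    E.psi n (DRWOne.redHom p n (diffQuot (teich p n (p : ZLoc p)))) :=
  (E.ofGhost_teich_mul_dlog n ⟨(p : ZLoc p), natCast_mem_ZLocMonoid p⟩).trans (psi_d _ n _).symm

/-- `F` fixes `dlog [p]`, so the projection formula moves the multiplication by `V(t)` down one
level. -/
theorem mul_dlogP_of_lower {n : ℕ}
    (ih : ∀ s : GhostRing p n, E.ofGhost n s * E.dlogP n = E.scalar n (lastVal s) * E.dlogP n +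
      E.psi n (DRWOne.redHom p n (logCoeff s))) (a : ZLoc p) (t : GhostRing p n) :
    E.ofGhost (n + 1) (const p (n + 1) a + ver p n t) * E.dlogP (n + 1) =
      E.scalar (n + 1) a * E.dlogP (n + 1) + E.scalar (n + 1) (lastVal t) * E.V n (E.dlogP n) +
        E.psi (n + 1) (DRWOne.V p n (DRWOne.redHom p n (logCoeff t))) := by
  rw [map_add, add_mul, ofGhost_const, ← V_ofGhost, V_mul, F_dlogP, ih, map_add,
    E.scalar_mul_V n 1 _ (E.dlogP_mem n), psi_V, add_assoc]

/-- Evaluate `[p] dlog [p]` in two ways, as `d[p]` and through `[p] = p + V(t)`. The terms from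
`logCoeff t` cancel, and `lastVal t ≡ -1` leaves a linear equation for `V(dlog [p])`. -/
theorem V_dlogP_of_lower (hp : p ≠ 2) {n : ℕ} (htors : p ^ n • E.dlogP n = 0)
    (ih : ∀ s : GhostRing p n, E.ofGhost n s * E.dlogP n = E.scalar n (lastVal s) * E.dlogP n +
      E.psi n (DRWOne.redHom p n (logCoeff s))) :
    E.V n (E.dlogP n) = p • E.dlogP (n + 1) +
      E.psi (n + 1) (DRWOne.redHom p (n + 1) (verCoeff p (n + 1))) := by
  obtain ⟨t, ht⟩ := exists_eq_const_add_ver (teich p (n + 1) (p : ZLoc p))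
  have h0 : (teich p (n + 1) (p : ZLoc p)).1 0 = p := pow_one _
  rw [h0] at ht
  have h1 := E.ofGhost_teich_mul_dlogP (n + 1)
  have hlog : logCoeff (teich p (n + 1) (p : ZLoc p)) = logCoeff (ver p n t) := by
    rw [ht, logCoeff_const_add]
  have hred : DRWOne.redHom p (n + 1) (diffQuot (teich p (n + 1) (p : ZLoc p))) =
      DRWOne.redHom p (n + 1) (logCoeff (teich p (n + 1) (p : ZLoc p))) :=
    DRWOne.redHom_eq fun i hi => by
      rw [← dvd_neg, neg_sub]
      exact dvd_logCoeff_teich_p_sub hp i hi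
  rw [hred, hlog, redHom_logCoeff_ver hp, map_add] at h1
  have h2 := E.mul_dlogP_of_lower ih p t
  rw [← ht, h1] at h2
  have htorsV : p ^ n • E.V n (E.dlogP n) = 0 := by rw [← map_nsmul, htors, map_zero]
  have hpn : n + 1 ≤ p ^ n := Nat.lt_pow_self (Fact.out : p.Prime).one_lt
  -- `lastVal t ≡ -1` modulo `p ^ n`
  have hlast : ∃ c, lastVal t = (p : ZLoc p) ^ n * c - 1 := by
    have e1 : lastVal (teich p (n + 1) (p : ZLoc p)) = p + p * lastVal t := by
      rw [ht, lastVal_add, lastVal_ver]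
      rfl
    have e2 : lastVal (teich p (n + 1) (p : ZLoc p)) = (p : ZLoc p) ^ p ^ n := rfl
    have e3 : (p : ZLoc p) ^ p ^ n = p * (p ^ n * p ^ (p ^ n - (n + 1))) := by
      rw [← pow_add, ← pow_succ']
      congr 1
      omega
    refine ⟨(p : ZLoc p) ^ (p ^ n - (n + 1)), mul_left_cancel₀ (ZLoc.natCast_p_ne_zero (p := p)) ?_⟩
    rw [mul_sub, ← e3, ← e2, e1]
    ring
  obtain ⟨c, hc⟩ := hlast
  have h3 : E.scalar (n + 1) (lastVal t) * E.V n (E.dlogP n) = -E.V n (E.dlogP n) := by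
    rw [hc, map_sub, map_one, sub_mul, one_mul, mul_comm, map_mul, mul_assoc,
      ← Nat.cast_pow, scalar_natCast_mul, htorsV, mul_zero, zero_sub]
  -- At level `n + 1` every generator `dV^j(1)` has `j ≤ n`, so `p^n` kills this part too.
  have h4 : DRWOne.redHom p (n + 1) (fun j => lastVal t * verCoeff p (n + 1) j) =
      -DRWOne.redHom p (n + 1) (verCoeff p (n + 1)) := by
    rw [← map_neg]
    refine DRWOne.redHom_eq fun i hi => ?_
    rw [hc, Pi.neg_apply]
    refine (pow_dvd_pow (p : ZLoc p) (Nat.lt_succ_iff.1 hi)).trans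
      ⟨c * verCoeff p (n + 1) ⟨i + 1, hi⟩, by ring⟩
  rw [h3, h4, map_neg, scalar_natCast_mul] at h2
  have h5 : p • E.dlogP (n + 1) + -E.V n (E.dlogP n) =
      -E.psi (n + 1) (DRWOne.redHom p (n + 1) (verCoeff p (n + 1))) :=
    add_right_cancel (h2.symm.trans (add_comm _ _))
  rw [← sub_eq_add_neg, sub_eq_iff_eq_add] at h5
  rw [h5]
  abel

/-- Torsion and action must be proved together: both at level `n` enter the formula for `V(dlog
[p]_n)`, which gives both at level `n + 1`. -/
theorem dlogP_structure (hp : p ≠ 2) (n : ℕ) : p ^ n • E.dlogP n = 0 ∧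
    ∀ s : GhostRing p n, E.ofGhost n s * E.dlogP n = E.scalar n (lastVal s) * E.dlogP n +
      E.psi n (DRWOne.redHom p n (logCoeff s)) := by
  induction n with
  | zero => exact ⟨E.level_zero.elim _ _, fun s => E.level_zero.elim _ _⟩
  | succ n ih =>
    obtain ⟨ih1, ih2⟩ := ih
    have hV := E.V_dlogP_of_lower hp ih1 ih2
    refine ⟨?_, fun s => ?_⟩
    · have h : p ^ n • E.psi (n + 1) (DRWOne.redHom p (n + 1) (verCoeff p (n + 1))) = 0 := by
        rw [← map_nsmul, ← map_nsmul, ← map_zero (E.psi (n + 1)), ← map_zero (DRWOne.redHom p (n + 1))]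
        congr 1
        refine DRWOne.redHom_eq fun i hi => ?_
        rw [Pi.smul_apply, Pi.zero_apply, sub_zero, nsmul_eq_mul, Nat.cast_pow]
        exact (pow_dvd_pow (p : ZLoc p) (Nat.lt_succ_iff.1 hi)).mul_right _
      have h2 := congrArg (fun x => p ^ n • x) hV
      simp only [smul_add, h, add_zero, smul_smul, ← pow_succ] at h2
      rw [← h2, ← map_nsmul, ih1, map_zero]
    · obtain ⟨t, ht⟩ := exists_eq_const_add_ver s
      have hl : lastVal s = s.1 0 + p * lastVal t := by
        conv_lhs => rw [ht]
        rw [lastVal_add, lastVal_ver]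
        rfl
      have hlog : logCoeff s = logCoeff (ver p n t) := by
        conv_lhs => rw [ht]
        rw [logCoeff_const_add]
      conv_lhs => rw [ht]
      rw [E.mul_dlogP_of_lower ih2, hV, mul_add, scalar_mul_psi, hlog, redHom_logCoeff_ver hp,
        map_add (E.psi (n + 1)), hl, map_add (E.scalar (n + 1)), add_mul, mul_comm (p : ZLoc p),
        map_mul, mul_assoc, scalar_natCast_mul]
      abel

theorem pow_smul_dlogP (hp : p ≠ 2) (n : ℕ) : p ^ n • E.dlogP n = 0 :=
  (E.dlogP_structure hp n).1

theorem ofGhost_mul_dlogP (hp : p ≠ 2) (n : ℕ) (s : GhostRing p n) :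
    E.ofGhost n s * E.dlogP n = E.scalar n (lastVal s) * E.dlogP n +
      E.psi n (DRWOne.redHom p n (logCoeff s)) :=
  (E.dlogP_structure hp n).2 s

theorem V_dlogP (hp : p ≠ 2) (n : ℕ) : E.V n (E.dlogP n) = p • E.dlogP (n + 1) +
    E.psi (n + 1) (DRWOne.redHom p (n + 1) (verCoeff p (n + 1))) :=
  E.V_dlogP_of_lower hp (E.pow_smul_dlogP hp n) (E.ofGhost_mul_dlogP hp n)

theorem V_dlogP_eq (hp : p ≠ 2) (n : ℕ) : E.V n (E.dlogP n) = p • E.dlogP (n + 1) +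
    (E.dvOne (n + 1) 1 + p ^ (p - 2) • E.dvOne (n + 1) 2) := by
  rw [V_dlogP E hp, psi_verCoeff]

/-- Iterate `V^(i+1)(1) dlog [p] = V(V^i(1) dlog [p])`. After the first step the correction in
`V(dlog [p])` is multiplied by a power of `p` that kills both `dV(1)` and `dV^2(1)`. -/
theorem vOne_mul_dlogP (hp : p ≠ 2) (n i : ℕ) : E.vOne n (i + 1) * E.dlogP n =
    p ^ (i + 1) • E.dlogP n + p ^ i • E.dvOne n (i + 1) +
      p ^ (p - 2 + i) • E.dvOne n (i + 2) := by
  induction n generalizing i with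
  | zero => exact E.level_zero.elim _ _
  | succ n ih =>
    have h : E.vOne (n + 1) (i + 1) * E.dlogP (n + 1) = E.V n (E.vOne n i * E.dlogP n) := by
      rw [← V_vOne, V_mul, F_dlogP]
    rw [h]
    cases i with
    | zero =>
      have h0 : E.vOne n 0 = 1 := by cases n <;> rfl
      rw [h0, one_mul, V_dlogP_eq E hp, ← add_assoc]
      simp
    | succ i =>
      have h1 : p ^ (i + 1) • E.dvOne (n + 1) 1 = 0 := by
        have := E.pow_smul_dvOne (n + 1) 1
        rw [pow_one] at this
        rw [pow_succ, mul_smul, this, smul_zero]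
      have h2 : p ^ (i + 1) • p ^ (p - 2) • E.dvOne (n + 1) 2 = 0 := by
        have := E.pow_smul_dvOne (n + 1) 2
        rw [smul_smul, ← pow_add]
        have hp3 : 3 ≤ p := by have := (Fact.out : p.Prime).two_le; omega
        rw [show i + 1 + (p - 2) = (i + 1 + (p - 2) - 2) + 2 by omega, pow_add, mul_smul, this,
          smul_zero]
      rw [ih, map_add, map_add, map_nsmul, map_nsmul, map_nsmul, V_dlogP_eq E hp, V_dvOne, V_dvOne,
        smul_add, smul_add, h1, h2, add_zero, add_zero, smul_smul, smul_smul, smul_smul,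
        ← pow_succ, ← pow_succ, ← pow_succ]
      rfl

/-- `2` is a unit in `ℤ_(p)`. Graded commutativity by itself only gives `x² = -x²` in odd degree. -/
theorem two_mul_eq_zero (hp : p ≠ 2) {n : ℕ} {x : E.obj n} (h : x = -x) : x = 0 := by
  have hu : IsUnit (E.scalar n ((2 : ℤ) : ZLoc p)) :=
    (ZLoc.isUnit_intCast fun h2 => hp
      ((Nat.prime_dvd_prime_iff_eq Fact.out Nat.prime_two).1 (by exact_mod_cast h2))).map _
  rw [map_intCast] at hu
  refine hu.mul_right_eq_zero.1 ?_
  rw [Int.cast_ofNat, two_mul]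
  nth_rewrite 2 [h]
  exact add_neg_cancel x

theorem dlogP_mul_dlogP (hp : p ≠ 2) (n : ℕ) : E.dlogP n * E.dlogP n = 0 := by
  refine E.two_mul_eq_zero hp ?_
  have h := E.graded_comm n 1 1 _ _ (E.dlogP_mem n) (E.dlogP_mem n)
  rw [one_mul, pow_one, neg_one_mul] at h
  exact h

/-- The product is `d(V^i(1) dlog [p])`, and `V^i(1) dlog [p]` is a `ℤ_(p)`-combination of closed
elements. -/
theorem dvOne_mul_dlogP (hp : p ≠ 2) (n i : ℕ) : E.dvOne n i * E.dlogP n = 0 := by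
  have h := E.d_mul n 0 (E.vOne n i) (E.dlogP n) (E.vOne_mem n i)
  rw [d_dlogP, mul_zero, mul_zero, add_zero] at h
  rw [dvOne, ← h, ← ofGhost_vOne, ofGhost_mul_dlogP E hp, map_add, d_scalar_mul, d_dlogP, mul_zero,
    d_psi, add_zero]

theorem psi_mul_dlogP (hp : p ≠ 2) (n : ℕ) (m : DRWOne p n) : E.psi n m * E.dlogP n = 0 := by
  obtain ⟨a, rfl⟩ := DRWOne.redHom_surjective m
  rw [psi_redHom, Finset.sum_mul]
  exact Finset.sum_eq_zero fun j _ => by rw [mul_assoc, dvOne_mul_dlogP E hp, mul_zero]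

theorem dlogP_mul_psi (hp : p ≠ 2) (n : ℕ) (m : DRWOne p n) : E.dlogP n * E.psi n m = 0 := by
  rw [E.graded_comm n 1 1 _ _ (E.dlogP_mem n) (E.psi_mem n m), psi_mul_dlogP E hp, mul_zero]

/-- The map in degree one from the logarithmic de Rham-Witt complex of `ℤ_(p)`. -/
def logPsi (hp : p ≠ 2) (n : ℕ) : LogDRWOne p n →+ E.obj n :=
  (E.psi n).coprod (torsionMap (E.dlogP n) (E.pow_smul_dlogP hp n))

theorem logPsi_mk (hp : p ≠ 2) (n : ℕ) (a : Fin n → ZLoc p) (b : ZLoc p) :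
    E.logPsi hp n (LogDRWOne.mk a b) =
      E.psi n (DRWOne.redHom p n a) + E.scalar n b * E.dlogP n :=
  congrArg (_ + ·) (torsionMap_red _ _ (E.pow_smul_dlogP hp n) b)

theorem logPsi_incl (hp : p ≠ 2) (n : ℕ) (m : DRWOne p n) :
    E.logPsi hp n (LogDRWOne.incl p n m) = E.psi n m :=
  (congrArg (_ + ·) (map_zero (torsionMap _ (E.pow_smul_dlogP hp n)))).trans (add_zero _)

theorem logPsi_dlogP (hp : p ≠ 2) (n : ℕ) : E.logPsi hp n (LogDRWOne.dlogP p n) = E.dlogP n := by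
  rw [LogDRWOne.dlogP_eq_mk, logPsi_mk, map_zero, map_zero, map_one, zero_add, one_mul]

theorem logPsi_smul (hp : p ≠ 2) (n : ℕ) (s : GhostRing p n) (x : LogDRWOne p n) :
    E.logPsi hp n (s • x) = E.ofGhost n s * E.logPsi hp n x := by
  obtain ⟨a, b, rfl⟩ := LogDRWOne.exists_mk_eq x
  have h : (fun j => s.1 j * a j + b * logCoeff s j) = s.1 * a + fun j => b * logCoeff s j := rfl
  rw [LogDRWOne.smul_mk, logPsi_mk, logPsi_mk, h, map_add, map_add, ← DRWOne.smul_redHom, psi_smul,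
    mul_add, ← mul_assoc (E.ofGhost n s), mul_comm_of_mem_zero (E.ofGhost_mem n s)
      (E.scalar_mem n b), mul_assoc (E.scalar n b), ofGhost_mul_dlogP E hp, mul_add, scalar_mul_psi,
    mul_comm (lastVal s), map_mul, mul_assoc]
  abel

theorem logPsi_mem (hp : p ≠ 2) (n : ℕ) (x : LogDRWOne p n) : E.logPsi hp n x ∈ E.gr n 1 := by
  obtain ⟨a, b, rfl⟩ := LogDRWOne.exists_mk_eq x
  rw [logPsi_mk]
  exact add_mem (E.psi_mem n _) (E.mul_mem n 0 1 _ _ (E.scalar_mem n _) (E.dlogP_mem n))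

theorem logPsi_mul_logPsi (hp : p ≠ 2) (n : ℕ) (x y : LogDRWOne p n) :
    E.logPsi hp n x * E.logPsi hp n y = 0 := by
  obtain ⟨a, b, rfl⟩ := LogDRWOne.exists_mk_eq x
  obtain ⟨a', b', rfl⟩ := LogDRWOne.exists_mk_eq y
  rw [logPsi_mk, logPsi_mk, add_mul, mul_add, mul_add, psi_mul_psi, ← mul_assoc (E.psi n _),
    ← mul_comm_of_mem_zero (E.scalar_mem n b') (E.psi_mem n _), mul_assoc (E.scalar n b'),
    psi_mul_dlogP E hp, mul_assoc (E.scalar n b), dlogP_mul_psi E hp, mul_assoc (E.scalar n b),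
    ← mul_assoc (E.dlogP n), ← mul_comm_of_mem_zero (E.scalar_mem n b') (E.dlogP_mem n),
    mul_assoc (E.scalar n b'), dlogP_mul_dlogP E hp]
  simp

theorem logPsi_R (hp : p ≠ 2) (n : ℕ) (x : LogDRWOne p (n + 1)) :
    E.logPsi hp n (LogDRWOne.R p n x) = E.R n (E.logPsi hp (n + 1) x) := by
  obtain ⟨a, b, rfl⟩ := LogDRWOne.exists_mk_eq x
  rw [LogDRWOne.R_mk, logPsi_mk, logPsi_mk, map_add, ← psi_R, map_mul, R_scalar, R_dlogP,
    DRWOne.R_redHom]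

theorem d_logPsi (hp : p ≠ 2) (n : ℕ) (x : LogDRWOne p n) : E.d n (E.logPsi hp n x) = 0 := by
  obtain ⟨a, b, rfl⟩ := LogDRWOne.exists_mk_eq x
  rw [logPsi_mk, map_add, d_psi, d_scalar_mul, d_dlogP, mul_zero, add_zero]

theorem logPsi_F (hp : p ≠ 2) (n : ℕ) (x : LogDRWOne p (n + 1)) :
    E.logPsi hp n (LogDRWOne.F p n x) = E.F n (E.logPsi hp (n + 1) x) := by
  obtain ⟨a, b, rfl⟩ := LogDRWOne.exists_mk_eq x
  rw [LogDRWOne.F_mk, logPsi_mk, logPsi_mk, map_add, ← psi_F, map_mul, F_scalar, F_dlogP,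
    DRWOne.F_redHom]

theorem logPsi_V (hp : p ≠ 2) (n : ℕ) (x : LogDRWOne p n) :
    E.logPsi hp (n + 1) (LogDRWOne.V p n x) = E.V n (E.logPsi hp n x) := by
  obtain ⟨a, b, rfl⟩ := LogDRWOne.exists_mk_eq x
  have h : (fun j : Fin (n + 1) => (Fin.cases 0 (fun j => p * a j) j : ZLoc p) +
      b * verCoeff p (n + 1) j) = (Fin.cases 0 (fun j => p * a j) : Fin (n + 1) → ZLoc p) +
      fun j => b * verCoeff p (n + 1) j := rfl
  rw [LogDRWOne.V_mk, logPsi_mk, logPsi_mk, map_add, ← psi_V, DRWOne.V_redHom,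
    ← E.scalar_mul_V n 1 _ (E.dlogP_mem n), V_dlogP E hp, h, map_add, map_add, mul_add,
    scalar_mul_psi, mul_comm (p : ZLoc p) b, map_mul, mul_assoc, scalar_natCast_mul]
  abel

/-- The map to a Witt complex over `ℤ_(p)` with its canonical log structure, in degree one. -/
def logDrwMap (hp : p ≠ 2) : (logDrw p hp).DegreeOneMap E.toWittComplex where
  ψ := E.logPsi hp
  mem := E.logPsi_mem hp
  smul := E.logPsi_smul hp
  mul := E.logPsi_mul_logPsi hp
  map_R := E.logPsi_R hp
  map_d n s := (E.logPsi_incl hp n _).trans (E.psi_d n s)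
  d_map := E.d_logPsi hp
  map_F := E.logPsi_F hp
  map_V := E.logPsi_V hp

/-- Both sides solve `[u] x = d[u]`, and `[u]` is invertible. -/
theorem logPsi_unitDlog (hp : p ≠ 2) (n : ℕ) (a : ZLocMonoid p) (u : (ZLoc p)ˣ) (h : a.1 = u) :
    E.logPsi hp n (LogDRWOne.unitDlog p n u) = E.dlog n (E.lamMon a) := by
  have h1 := E.ofGhost_teich_mul_dlog n a
  have h2 := congrArg (E.logPsi hp n) (LogDRWOne.teich_smul_unitDlog (n := n) u)
  have h3 : E.logPsi hp n (LogDRWOne.d p n (teich p n (u : ZLoc p))) = _ :=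
    (E.logPsi_incl hp n _).trans (E.psi_d n _)
  rw [logPsi_smul, h3, ← h, ← h1] at h2
  have hu : IsUnit (E.ofGhost n (teich p n a.1)) := by
    rw [h]
    exact (teichUnit p n u).isUnit.map (E.ofGhost n)
  exact hu.mul_left_cancel h2

theorem dlog_pow (n k : ℕ) (a : ZLocMonoid p) :
    E.dlog n (E.lamMon (a ^ k)) = k • E.dlog n (E.lamMon a) := by
  induction k with
  | zero => rw [pow_zero, map_one, E.dlog_one, zero_smul]
  | succ k ih => rw [pow_succ, map_mul, E.dlog_mul, ih, add_smul, one_smul]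

theorem logPsi_dlog (hp : p ≠ 2) (n : ℕ) (a : ZLocMonoid p) :
    E.logPsi hp n (LogDRWOne.dlog p n a) = E.dlog n (E.lamMon a) := by
  have hu : (ZLoc.unitPart a : ZLoc p) ∈ ZLocMonoid p :=
    mem_nonZeroDivisors_of_ne_zero (ZLoc.unitPart a).ne_zero
  have ha : a = ⟨(p : ZLoc p), natCast_mem_ZLocMonoid p⟩ ^ ZLoc.val a *
      ⟨(ZLoc.unitPart a : ZLoc p), hu⟩ := Subtype.ext (ZLoc.eq_pow_val_mul a)
  conv_rhs => rw [ha]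
  rw [map_mul, E.dlog_mul, dlog_pow, LogDRWOne.dlog, map_add, map_nsmul, logPsi_dlogP,
    E.logPsi_unitDlog hp n ⟨_, hu⟩ _ rfl]
  rfl

/-- The map from the logarithmic de Rham-Witt complex of `ℤ_(p)`. -/
def logDrwHom (hp : p ≠ 2) : LogWittComplex.Hom (logDrwComplex p hp) E where
  toHom := (E.logDrwMap hp).hom
  mapMon := E.lamMon.comp (MulEquiv.ulift : ULift.{v} (ZLocMonoid p) ≃* ZLocMonoid p).toMonoidHom
  mapMon_lamMon _ := rfl
  map_pre n a := by
    change E.ofGhost n (teich p n a.down.1) + E.logPsi hp n 0 = E.pre n (E.lamMon a.down)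
    rw [map_zero, add_zero, pre_lamMon_eq]
  map_dlog n a := by
    change E.ofGhost n 0 + E.logPsi hp n (LogDRWOne.dlog p n a.down) = E.dlog n (E.lamMon a.down)
    rw [map_zero, zero_add, logPsi_dlog]

end LogWittComplex

theorem LogWittComplex.Hom.map_dlogP {p : ℕ} [Fact p.Prime]
    {D E : LogWittComplex.{v} p (canonicalLog p)} (f : LogWittComplex.Hom D E) (n : ℕ) :
    f.map n (D.dlogP n) = E.dlogP n := by
  rw [LogWittComplex.dlogP, f.map_dlog, f.mapMon_lamMon, LogWittComplex.dlogP]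

theorem logDrwComplex_dlogP (p : ℕ) [Fact p.Prime] (hp : p ≠ 2) (n : ℕ) :
    (logDrwComplex.{v} p hp).dlogP n =
      (SqZeroExt.inr (LogDRWOne.dlogP p n) : SqZeroExt.{v} (GhostRing p n) (LogDRWOne p n)) :=
  congrArg _ LogDRWOne.dlog_p

theorem LogDRWOne.addHom_ext {p n : ℕ} [Fact p.Prime] {X : Type*} [AddCommGroup X]
    {f g : LogDRWOne p n →+ X}
    (h : ∀ i, f (d p n (GhostRing.vOne p n i)) = g (d p n (GhostRing.vOne p n i)))
    (h' : f (dlogP p n) = g (dlogP p n)) : f = g := by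
  have h1 : f.comp (incl p n) = g.comp (incl p n) := DRWOne.addHom_ext h
  refine AddMonoidHom.ext fun x => ?_
  obtain ⟨k, hk⟩ := ZMod.intCast_surjective x.2
  have e : x = incl p n x.1 + k • dlogP p n := by
    refine Prod.ext ?_ ?_
    · change x.1 = x.1 + k • (0 : DRWOne p n)
      rw [smul_zero, add_zero]
    · change x.2 = 0 + k • (1 : ZMod (p ^ n))
      rw [zsmul_one, hk, zero_add]
  rw [e, map_add, map_add, map_zsmul, map_zsmul, h']
  exact congrArg (· + _) (DFunLike.congr_fun h1 x.1)

/-- In degree one the generators `dV^i(1)` and `dlog [p]` are preserved; the monoid of the model is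
`M` itself, so `λ` fixes the map of monoids. -/
theorem logDrw_hom_ext {p : ℕ} [Fact p.Prime] (hp : p ≠ 2)
    {E : LogWittComplex.{v} p (canonicalLog p)}
    (g h : LogWittComplex.Hom (logDrwComplex p hp) E) : g = h := by
  have h1 : g.toHom = h.toHom := by
    refine WittModule.hom_ext (logDrw p hp) fun n => ?_
    have key : ((g.map n).toAddMonoidHom.comp
          (SqZeroExt.inr : LogDRWOne p n →+ SqZeroExt.{v} (GhostRing p n) (LogDRWOne p n))) =
        ((h.map n).toAddMonoidHom.comp
          (SqZeroExt.inr : LogDRWOne p n →+ SqZeroExt.{v} (GhostRing p n) (LogDRWOne p n))) := by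
      refine LogDRWOne.addHom_ext (fun i => ?_) ?_
      · have e := (logDrw p hp).dvOne_eq_inr.{v} n i
        have e1 := g.toHom.map_dvOne n i
        have e2 := h.toHom.map_dvOne n i
        have e1' := (congrArg (g.map n) e).symm.trans e1
        have e2' := (congrArg (h.map n) e).symm.trans e2
        exact e1'.trans e2'.symm
      · have e1 := (congrArg (g.map n) (logDrwComplex_dlogP p hp n)).symm.trans (g.map_dlogP n)
        have e2 := (congrArg (h.map n) (logDrwComplex_dlogP p hp n)).symm.trans (h.map_dlogP n)
        exact e1.trans e2.symm
    exact DFunLike.congr_fun key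
  have h2 : g.mapMon = h.mapMon := MonoidHom.ext fun a =>
    (g.mapMon_lamMon a.down).trans (h.mapMon_lamMon a.down).symm
  cases g
  cases h
  cases h1
  cases h2
  rfl

/-- The logarithmic de Rham-Witt complex of `ℤ_(p)` is initial. -/
def logDrwIsInitial (p : ℕ) [Fact p.Prime] (hp : p ≠ 2) :
    IsInitial (logDrwComplex.{v} p hp) :=
  IsInitial.ofUniqueHom (fun E => E.logDrwHom hp) fun _ _ => logDrw_hom_ext hp _ _

/-! ### Transport to an arbitrary initial object -/

namespace WittModule.DegreeOneMap

open SqZeroExt WittComplex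

variable {p : ℕ} [Fact p.Prime] {W : WittModule p} {E : WittComplex.{v} p (ZLoc p)}

theorem hom_map_eq (f : W.DegreeOneMap E) (n : ℕ) (x : SqZeroExt.{v} (GhostRing p n) (W.N n)) :
    f.hom.map n x = E.ofGhost n x.fst + f.ψ n x.snd := rfl

theorem ofGhost_injective (f : W.DegreeOneMap E) (b : WittComplex.Hom E W.toWittComplex)
    (hbf : ∀ n x, b.map n (f.hom.map n x) = x) (n : ℕ) :
    Function.Injective (E.ofGhost n) := fun s t h => by
  have h1 : ∀ s, f.hom.map n (inl s : SqZeroExt.{v} (GhostRing p n) (W.N n)) = E.ofGhost n s :=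
    fun s => (congrArg (_ + ·) (map_zero (f.ψ n))).trans (add_zero _)
  have h2 := congrArg (b.map n) ((h1 s).trans (h.trans (h1 t).symm))
  exact congrArg SqZeroExt.fst ((hbf n _).symm.trans (h2.trans (hbf n _)))

theorem ψ_injective (f : W.DegreeOneMap E) (b : WittComplex.Hom E W.toWittComplex)
    (hbf : ∀ n x, b.map n (f.hom.map n x) = x) (n : ℕ) :
    Function.Injective (f.ψ n) := fun s t h => by
  have h1 : ∀ s, f.hom.map n (inr s : SqZeroExt.{v} (GhostRing p n) (W.N n)) = f.ψ n s :=
    fun s => (congrArg (· + _) (map_zero (E.ofGhost n))).trans (zero_add _)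
  have h2 := congrArg (b.map n) ((h1 s).trans (h.trans (h1 t).symm))
  exact congrArg SqZeroExt.snd ((hbf n _).symm.trans (h2.trans (hbf n _)))

theorem exists_ofGhost_eq (f : W.DegreeOneMap E) (b : WittComplex.Hom E W.toWittComplex)
    (hfb : ∀ n y, f.hom.map n (b.map n y) = y) {n : ℕ} {y : E.obj n} (hy : y ∈ E.gr n 0) : ∃ s, E.ofGhost n s = y := by
  have h : SqZeroExt.snd (b.map n y) = 0 := b.map_mem n 0 y hy
  refine ⟨SqZeroExt.fst (b.map n y), ?_⟩
  refine Eq.trans ?_ ((f.hom_map_eq n (b.map n y)).symm.trans (hfb n y))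
  rw [h, map_zero, add_zero]

theorem exists_ψ_eq (f : W.DegreeOneMap E) (b : WittComplex.Hom E W.toWittComplex)
    (hfb : ∀ n y, f.hom.map n (b.map n y) = y) {n : ℕ} {y : E.obj n} (hy : y ∈ E.gr n 1) : ∃ m, f.ψ n m = y := by
  have h : SqZeroExt.fst (b.map n y) = 0 := b.map_mem n 1 y hy
  refine ⟨SqZeroExt.snd (b.map n y), ?_⟩
  refine Eq.trans ?_ ((f.hom_map_eq n (b.map n y)).symm.trans (hfb n y))
  rw [h, map_zero, zero_add]

theorem gr_eq_bot (f : W.DegreeOneMap E) (b : WittComplex.Hom E W.toWittComplex)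
    (hfb : ∀ n y, f.hom.map n (b.map n y) = y) {n q : ℕ} (hq : 2 ≤ q) : E.gr n q = ⊥ := by
  obtain ⟨q, rfl⟩ := Nat.exists_eq_add_of_le' hq
  rw [eq_bot_iff]
  intro y hy
  have h : b.map n y = (0 : SqZeroExt.{v} (GhostRing p n) (W.N n)) := b.map_mem n (q + 2) y hy
  have h1 := hfb n y
  have h2 : f.hom.map n (b.map n y) = 0 := by rw [h]; exact map_zero (f.hom.map n)
  exact h1.symm.trans h2

/-- The description of the degree-one part given by an isomorphism. -/
def grOneEquiv (f : W.DegreeOneMap E) (b : WittComplex.Hom E W.toWittComplex)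
    (hfb : ∀ n y, f.hom.map n (b.map n y) = y) (hbf : ∀ n x, b.map n (f.hom.map n x) = x) (n : ℕ) :
    W.N n ≃+ E.gr n 1 :=
  AddEquiv.ofBijective ((f.ψ n).codRestrict (E.gr n 1) (f.mem n))
    ⟨fun _ _ h => f.ψ_injective b hbf n (congrArg Subtype.val h),
      fun y => (f.exists_ψ_eq b hfb y.2).imp fun _ h => Subtype.ext h⟩

theorem bijOn_lam (f : W.DegreeOneMap E) (b : WittComplex.Hom E W.toWittComplex)
    (hfb : ∀ n y, f.hom.map n (b.map n y) = y) (hbf : ∀ n x, b.map n (f.hom.map n x) = x) (n : ℕ) :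
    Set.BijOn (E.lam n) Set.univ (E.gr n 0) := by
  refine ⟨fun x _ => E.lam_mem n x, fun x _ y _ h => ?_, fun y hy => ?_⟩
  · rw [← ofGhost_equiv, ← ofGhost_equiv] at h
    exact (GhostRing.equiv p n).injective (f.ofGhost_injective b hbf n h)
  · obtain ⟨s, rfl⟩ := f.exists_ofGhost_eq b hfb hy
    refine ⟨(GhostRing.equiv p n).symm s, trivial, ?_⟩
    rw [← ofGhost_equiv, RingEquiv.apply_symm_apply]

theorem existsUnique_sum_vOne (f : W.DegreeOneMap E) (b : WittComplex.Hom E W.toWittComplex)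
    (hfb : ∀ n y, f.hom.map n (b.map n y) = y) (hbf : ∀ n x, b.map n (f.hom.map n x) = x) {n : ℕ}
    {y : E.obj n} (hy : y ∈ E.gr n 0) :
    ∃! c : Fin n → ZLoc p, y = ∑ i, E.scalar n (c i) * E.vOne n i := by
  obtain ⟨s, rfl⟩ := f.exists_ofGhost_eq b hfb hy
  have key : ∀ c : Fin n → ZLoc p, ∑ i, E.scalar n (c i) * E.vOne n i =
      E.ofGhost n (∑ i, GhostRing.const p n (c i) * GhostRing.vOne p n i) := fun c => by
    rw [map_sum]
    exact Finset.sum_congr rfl fun i _ => by rw [map_mul, ofGhost_const, ofGhost_vOne]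
  obtain ⟨c, hc, hu⟩ := GhostRing.existsUnique_sum_vOne s
  refine ⟨c, ?_, fun c' hc' => hu c' ?_⟩
  · exact (congrArg (E.ofGhost n) hc).trans (key c).symm
  · exact f.ofGhost_injective b hbf n (Eq.trans hc' (key c'))

end WittModule.DegreeOneMap

/-- Discards the trivial component at index `0`; hence the shift of indices by one. -/
theorem DRWOne.exists_addEquiv (p : ℕ) [Fact p.Prime] (n : ℕ) :
    ∃ κ : ((i : Fin (n - 1)) → ZMod (p ^ (i.val + 1))) ≃+ DRWOne p n,
      ∀ i, κ (Pi.single i 1) = d p n (GhostRing.vOne p n (i.val + 1)) := by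
  cases n with
  | zero =>
    exact ⟨⟨⟨fun _ => 0, fun _ => 0, fun _ => funext fun i => i.elim0,
      fun _ => DRWOne.ext fun i => i.elim0⟩, fun _ _ => (add_zero _).symm⟩, fun i => i.elim0⟩
  | succ n =>
    let κ : ((i : Fin n) → ZMod (p ^ (i.val + 1))) ≃+ DRWOne p (n + 1) :=
      { toFun := fun c => Fin.cases (motive := fun j => ZMod (p ^ j.1)) 0 c
        invFun := fun m i => m i.succ
        left_inv := fun _ => rfl
        right_inv := fun m => DRWOne.ext fun j => by
          refine Fin.cases ?_ (fun i => rfl) j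
          exact eq_at_zero _ _
        map_add' := fun c c' => DRWOne.ext fun j => by
          refine Fin.cases ?_ (fun i => rfl) j
          exact eq_at_zero _ _ }
    refine ⟨κ, fun i => ?_⟩
    refine Eq.trans ?_ (DRWOne.d_vOne i.succ).symm
    refine DRWOne.ext fun j => ?_
    refine Fin.cases ?_ (fun k => ?_) j
    · exact eq_at_zero _ _
    · change (Pi.single i 1 : (i : Fin n) → ZMod (p ^ (i.val + 1))) k =
        (Pi.single i.succ 1 : (j : Fin (n + 1)) → ZMod (p ^ j.1)) k.succ
      rcases eq_or_ne k i with rfl | h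
      · rw [Pi.single_eq_same, Pi.single_eq_same]
      · rw [Pi.single_eq_of_ne h, Pi.single_eq_of_ne (fun h' => h (Fin.succ_injective _ h'))]

theorem WittComplex.Hom.map_psi {p : ℕ} [Fact p.Prime] {D E : WittComplex.{v} p (ZLoc p)}
    (f : WittComplex.Hom D E) (n : ℕ) (m : DRWOne p n) : f.map n (D.psi n m) = E.psi n m := by
  have h : (f.map n).toAddMonoidHom.comp (D.psi n) = E.psi n := DRWOne.addHom_ext fun i => by
    rw [psi_d_vOne]
    exact (congrArg (f.map n) (D.psi_d_vOne n i)).trans (f.map_dvOne n i)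
  exact DFunLike.congr_fun h m

end

theorem mainTheorem5 (p : ℕ) [Fact p.Prime] (hp : p ≠ 2) :
    -- the de Rham-Witt complexes of `ℤ_(p)` and of `(ℤ_(p), M)` exist
    HasInitial (WittComplex.{v} p (ZLoc p)) ∧
    HasInitial (LogWittComplex.{v} p (canonicalLog p)) ∧
    -- let `D`, `E` be these complexes and let `f : D ⟶ E` be the canonical map
    ∀ (D : WittComplex.{v} p (ZLoc p)) (hD : IsInitial D)
      (E : LogWittComplex.{v} p (canonicalLog p)) (_ : IsInitial E)
      (f : WittComplex.Hom D E.toWittComplex), f = hD.to E.toWittComplex →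
    -- (i) additive structure; degree zero
    (∀ n, Set.BijOn (f.map n) (D.gr n 0) (E.gr n 0) ∧
      Set.BijOn (D.lam n) Set.univ (D.gr n 0) ∧
      Set.BijOn (E.lam n) Set.univ (E.gr n 0) ∧
      ∃ φ : ZLoc p →+* E.obj n, (∀ a, φ a ∈ E.gr n 0) ∧
        ∀ x ∈ E.gr n 0, ∃! c : Fin n → ZLoc p, x = ∑ i, φ (c i) * E.vOne n i) ∧
    -- degree one
    (∀ n, ∃ e : ((i : Fin (n - 1)) → ZMod (p ^ (i.val + 1))) ≃+ D.gr n 1,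
      ∀ i, (e (Pi.single i 1) : D.obj n) = D.dvOne n (i.val + 1)) ∧
    (∀ n, ∃ e : D.gr n 1 × ZMod (p ^ n) ≃+ E.gr n 1,
      (∀ x, (e (x, 0) : E.obj n) = f.map n x) ∧ (e (0, 1) : E.obj n) = E.dlogP n) ∧
    -- degrees at least two
    (∀ n q, 2 ≤ q → D.gr n q = ⊥ ∧ E.gr n q = ⊥) ∧
    -- (ii) products
    (∀ n i j, i ≤ j → E.vOne n i * E.vOne n j = p ^ i • E.vOne n j) ∧
    (∀ n i j, i < j → E.vOne n i * E.dvOne n j = p ^ i • E.dvOne n j) ∧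
    (∀ n i j, j ≤ i → E.vOne n i * E.dvOne n j = 0) ∧
    (p = 3 → ∀ n i, 1 ≤ i → E.vOne n i * E.dlogP n =
      3 ^ i • E.dlogP n + 3 ^ (i - 1) • E.dvOne n i + 3 ^ i • E.dvOne n (i + 1)) ∧
    (5 ≤ p → ∀ n i, 1 ≤ i → E.vOne n i * E.dlogP n =
      p ^ i • E.dlogP n + p ^ (i - 1) • E.dvOne n i) ∧
    -- (iii) the operators `F` and `V`
    (∀ n i, E.F n (E.vOne (n + 1) (i + 1)) = p • E.vOne n i) ∧
    (∀ n i, E.F n (E.dvOne (n + 1) (i + 1)) = E.dvOne n i) ∧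
    (∀ n i, E.V n (E.vOne n i) = E.vOne (n + 1) (i + 1)) ∧
    (∀ n i, E.V n (E.dvOne n i) = p • E.dvOne (n + 1) (i + 1)) ∧
    (∀ n, E.F n (E.dlogP (n + 1)) = E.dlogP n) ∧
    (p = 3 → ∀ n, E.V n (E.dlogP n) =
      3 • E.dlogP (n + 1) + E.dvOne (n + 1) 1 + 3 • E.dvOne (n + 1) 2) ∧
    (5 ≤ p → ∀ n, E.V n (E.dlogP n) = p • E.dlogP (n + 1) + E.dvOne (n + 1) 1) := by
  refine ⟨(drwIsInitial p hp).hasInitial, (logDrwIsInitial p hp).hasInitial, ?_⟩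
  rintro D hD E hE f -
  -- `D` and the model are both initial, so the comparison map is invertible.
  obtain ⟨b, hfb, hbf⟩ : ∃ b : WittComplex.Hom D (drw p hp).toWittComplex,
      (∀ n y, (drwMap hp D).hom.map n (b.map n y) = y) ∧
        ∀ n x, b.map n ((drwMap hp D).hom.map n x) = x := by
    refine ⟨hD.to _, fun n y => ?_, fun n x => ?_⟩
    · have h : WittComplex.Hom.comp (hD.to (drw p hp).toWittComplex) (drwMap hp D).hom =
        WittComplex.Hom.id D := hD.hom_ext (Y := D) _ _
      exact congrArg (fun g : WittComplex.Hom D D => g.map n y) h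
    · have h : WittComplex.Hom.comp (drwMap hp D).hom (hD.to (drw p hp).toWittComplex) =
        WittComplex.Hom.id _ := drw_hom_ext hp _ _
      exact congrArg (fun g : WittComplex.Hom _ _ => g.map n x) h
  -- Initiality holds among logarithmic complexes, so the composites are compared there before the
  -- log structure is forgotten.
  obtain ⟨b', hfb', hbf'⟩ : ∃ b : WittComplex.Hom E.toWittComplex (logDrw p hp).toWittComplex,
      (∀ n y, (E.logDrwMap hp).hom.map n (b.map n y) = y) ∧
        ∀ n x, b.map n ((E.logDrwMap hp).hom.map n x) = x := by
    refine ⟨(hE.to (logDrwComplex p hp) : LogWittComplex.Hom _ _).toHom, fun n y => ?_,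
      fun n x => ?_⟩
    · have h : LogWittComplex.Hom.comp (hE.to (logDrwComplex p hp)) (E.logDrwHom hp) =
        LogWittComplex.Hom.id E := hE.hom_ext (Y := E) _ _
      exact congrArg (fun g : LogWittComplex.Hom E E => g.map n y) h
    · have h : LogWittComplex.Hom.comp (E.logDrwHom hp) (hE.to (logDrwComplex p hp)) =
        LogWittComplex.Hom.id _ := logDrw_hom_ext hp _ _
      exact congrArg (fun g : LogWittComplex.Hom _ _ => g.map n x) h
  have hDlam := (drwMap hp D).bijOn_lam b hfb hbf
  have hElam := (E.logDrwMap hp).bijOn_lam b' hfb' hbf'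
  have hp2 : 2 ≤ p := (Fact.out : p.Prime).two_le
  refine ⟨fun n => ⟨⟨fun x hx => f.map_mem n 0 x hx, ?_, ?_⟩, hDlam n, hElam n, E.scalar n,
      E.scalar_mem n, fun x hx => (E.logDrwMap hp).existsUnique_sum_vOne b' hfb' hbf' hx⟩,
    fun n => ?_, fun n => ?_,
    fun n q hq => ⟨(drwMap hp D).gr_eq_bot b hfb hq, (E.logDrwMap hp).gr_eq_bot b' hfb' hq⟩,
    fun n i j h => E.vOne_mul_vOne n h, fun n i j h => E.vOne_mul_dvOne n h,
    fun n i j h => E.vOne_mul_dvOne_of_le n h, ?_, ?_, E.F_vOne, E.F_dvOne,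
    fun n i => E.V_vOne n i, E.V_dvOne, E.F_dlogP, ?_, ?_⟩
  · intro x hx y hy h
    obtain ⟨x, -, rfl⟩ := (hDlam n).surjOn hx
    obtain ⟨y, -, rfl⟩ := (hDlam n).surjOn hy
    rw [f.map_lam, f.map_lam] at h
    rw [(hElam n).injOn trivial trivial h]
  · intro y hy
    obtain ⟨x, -, rfl⟩ := (hElam n).surjOn hy
    exact ⟨D.lam n x, D.lam_mem n x, f.map_lam n x⟩
  · obtain ⟨κ, hκ⟩ := DRWOne.exists_addEquiv p n
    refine ⟨κ.trans ((drwMap hp D).grOneEquiv b hfb hbf n), fun i => ?_⟩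
    exact (congrArg (D.psi n) (hκ i)).trans (D.psi_d_vOne n _)
  · let eD : DRWOne p n ≃+ D.gr n 1 := (drwMap hp D).grOneEquiv b hfb hbf n
    let eE : DRWOne p n × ZMod (p ^ n) ≃+ E.gr n 1 :=
      (E.logDrwMap hp).grOneEquiv b' hfb' hbf' n
    refine ⟨(eD.symm.prodCongr (AddEquiv.refl _)).trans eE, fun x => ?_, ?_⟩
    · obtain ⟨m, rfl⟩ := eD.surjective x
      have h1 : ((eD.symm.prodCongr (AddEquiv.refl (ZMod (p ^ n)))).trans eE) (eD m, 0) =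
          eE (m, 0) := congrArg (fun z => eE (z, 0)) (eD.symm_apply_apply m)
      rw [h1]
      exact (E.logPsi_incl hp n m).trans (f.map_psi n m).symm
    · have h1 : ((eD.symm.prodCongr (AddEquiv.refl (ZMod (p ^ n)))).trans eE) (0, 1) =
          eE (0, 1) := congrArg (fun z => eE (z, 1)) (map_zero eD.symm)
      rw [h1]
      exact E.logPsi_dlogP hp n
  · intro h3 n i hi
    obtain ⟨i, rfl⟩ := Nat.exists_eq_add_of_le' hi
    rw [E.vOne_mul_dlogP hp, Nat.add_sub_cancel]
    subst h3
    rw [add_comm (3 - 2) i]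
  · intro h5 n i hi
    obtain ⟨i, rfl⟩ := Nat.exists_eq_add_of_le' hi
    -- For `p ≥ 5` the exponent `p - 2 + i` is at least `i + 2`, the torsion exponent of
    -- `dV^(i+2)(1)`.
    have h : p ^ (p - 2 + i) • E.dvOne n (i + 2) = 0 := by
      rw [show p - 2 + i = p - 4 + (i + 2) by omega, pow_add, mul_smul, E.pow_smul_dvOne, smul_zero]
    rw [E.vOne_mul_dlogP hp, Nat.add_sub_cancel, h, add_zero]
  · intro h3 n
    rw [E.V_dlogP_eq hp, ← add_assoc]
    subst h3
    rfl
  · intro h5 n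
    have h : p ^ (p - 2) • E.dvOne (n + 1) 2 = 0 := by
      rw [show p - 2 = p - 4 + 2 by omega, pow_add, mul_smul, E.pow_smul_dvOne, smul_zero]
    rw [E.V_dlogP_eq hp, h, add_zero]
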